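/- Let $d\ge 1$, $\tau>0$ and $m>0$ with $m>1-\frac2d$. Let $\Omega$ be a convex domain of $\mathbb R^d$ (a convex subset with non-empty interior, possibly unbounded) with the Euclidean distance $\mathsf d$, or the flat torus $\mathbb T^d=\mathbb R^d/\mathbb Z^d$ with the quotient distance $\mathsf d$. Let $\mathcal P_2(\Omega)$ be the set of Borel probability measures on $\Omega$ with finite second moment, and let $$W_2(\mu,\nu)^2=\inf_{\gamma}\int \mathsf d(x,y)^2\,d\gamma(x,y),$$ the infimum being over all probability measures $\gamma$ on $\Omega\times\Omega$ with marginals $\mu$ and $\nu$. Put $f_m(t)=\frac{1}{m-1}t^m$ if $m\neq1$ and $f_1(t)=t\log t$. For $\rho\in\mathcal P_2(\Omega)$ with Lebesgue decomposition $\rho=\rho^{ac}\mathcal L^d+\rho^\perp$, let $\mathcal E_m[\rho]=+\infty$ if $m\ge1$ and $\rho^\perp\ne0$, and $\mathcal E_m[\rho]=\int_\Omega f_m(\rho^{ac})\,d\mathcal L^d$ otherwise. A minimizer of the one-step JKO problem from $\mu\in\mathcal P_2(\Omega)$ on $\Omega$ is a minimizer over $\eta\in\mathcal P_2(\Omega)$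 of $$\mathcal E_m[\eta]+\frac1{2\tau}W_2(\eta,\mu)^2 .$$ Let either $(\Omega_n)_{n\ge0}$ be a non-decreasing sequence of convex domains of $\mathbb R^d$ and $\Omega=\bigcup_n\Omega_n$, or $\Omega_n=\Omega=\mathbb T^d$ for all $n$; if $\Omega$ is unbounded, assume moreover $m>1-\frac2{d+2}$. Let $\mu_n\in\mathcal P_2(\Omega_n)$ and $\mu\in\mathcal P_2(\Omega)$ with $W_2(\mu_n,\mu)\to0$, and for each $n$ let $\rho_n$ be a minimizer of the one-step JKO problem from $\mu_n$ on $\Omega_n$. Then there are a subsequence $(\rho_{n_k})_k$ and a minimizer $\rho$ of the one-step JKO problem from $\mu$ on $\Omega$ such that $W_2(\rho_{n_k},\rho)\to0$ as $k\to\infty$. -/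

import Mathlib

open MeasureTheory Filter Topology
open scoped ENNReal

namespace JKO

/-- The flat torus `ℝ^d / ℤ^d`, as the `ℓ²` product of `d` circles of length one. The distance is
`(∑ i, dist (x i) (y i) ^ 2) ^ (1 / 2)`, i.e. the quotient of the Euclidean distance. -/
abbrev Torus (d : ℕ) : Type := PiLp 2 (fun _ : Fin d => UnitAddCircle)

/-- Lebesgue measure on the torus (of total mass one). -/
noncomputable instance torusMeasureSpace (d : ℕ) : MeasureSpace (Torus d) where
  volume := (volume : Measure (Fin d → UnitAddCircle)).map (WithLp.toLp 2)

section

variable {X : Type*} [NormedAddCommGroup X]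

/-- `𝒫₂(Ω)`: the probability measures concentrated on `Ω` with finite second moment. -/
def P2 [MeasurableSpace X] (Ω : Set X) : Set (Measure X) :=
  {μ | IsProbabilityMeasure μ ∧ μ Ωᶜ = 0 ∧ ∫⁻ x, ‖x‖ₑ ^ 2 ∂μ < ∞}

/-- Transport plans between `μ` and `ν`. When `μ` and `ν` are concentrated on `Ω`, these are all
concentrated on `Ω × Ω`. -/
def transportPlans [MeasurableSpace X] (μ ν : Measure X) : Set (Measure (X × X)) :=
  {γ | IsProbabilityMeasure γ ∧ γ.map Prod.fst = μ ∧ γ.map Prod.snd = ν}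

/-- The Wasserstein distance of order two. -/
noncomputable def W2 [MeasurableSpace X] (μ ν : Measure X) : ℝ≥0∞ :=
  (⨅ γ ∈ transportPlans μ ν, ∫⁻ p, edist p.1 p.2 ^ 2 ∂γ) ^ (1 / 2 : ℝ)

/-- The energy density `f_m`. -/
noncomputable def energyDensity (m t : ℝ) : ℝ :=
  if m = 1 then t * Real.log t else t ^ m / (m - 1)

/-- The integral of a real function with values in the extended reals: integral of the positive
part minus integral of the negative part (the latter is finite wherever this is used below). -/
noncomputable def extIntegral [MeasurableSpace X] (ν : Measure X) (g : X → ℝ) : EReal :=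
  ((∫⁻ x, ENNReal.ofReal (g x) ∂ν : ℝ≥0∞) : EReal) -
    ((∫⁻ x, ENNReal.ofReal (-g x) ∂ν : ℝ≥0∞) : EReal)

variable [MeasureSpace X]

open Classical in
/-- The `m`-entropy of `ρ` on `Ω`: the integral over `Ω` of `f_m` of the density of the absolutely
continuous part of `ρ`, and `+∞` if `m ≥ 1` and `ρ` has a singular part. -/
noncomputable def entropy (m : ℝ) (Ω : Set X) (ρ : Measure X) : EReal :=
  if 1 ≤ m ∧ ¬ ρ ≪ volume then ⊤
  else extIntegral (volume.restrict Ω) (fun x => energyDensity m (ρ.rnDeriv volume x).toReal)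

/-- The functional minimized in one step of the scheme with time step `τ` starting from `μ`. -/
noncomputable def functional (m τ : ℝ) (Ω : Set X) (μ η : Measure X) : EReal :=
  entropy m Ω η + ((ENNReal.ofReal (1 / (2 * τ)) * W2 η μ ^ 2 : ℝ≥0∞) : EReal)

/-- `ρ` is a minimizer of the one-step problem from `μ` on `Ω`. -/
def IsMinimizer (m τ : ℝ) (Ω : Set X) (μ ρ : Measure X) : Prop :=
  ρ ∈ P2 Ω ∧ ∀ η ∈ P2 Ω, functional m τ Ω μ ρ ≤ functional m τ Ω μ η

end

/-- A convex domain: a convex subset of `ℝ^d` with non-empty interior. -/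
def IsConvexDomain {d : ℕ} (Ω : Set (EuclideanSpace ℝ (Fin d))) : Prop :=
  Convex ℝ Ω ∧ (interior Ω).Nonempty

end JKO

set_option linter.unusedSectionVars false

/-! The argument is the direct method, run along the minimizers `ρ_n` inside the closed convex set
`K`, the closure of the union `U` of the interiors of the domains. Closedness makes narrow limits
stay in `K`; the passage back to the union `Ω` of the domains is a separate step at the end. On the
torus `K` is the whole space and that step is void.

Compactness. Comparison with a fixed competitor on the first domain bounds entropy plus penalty. The
entropy may be unbounded below, so it is corrected by weights (`IsWeight`): `w` of growth smaller
than `‖x‖ ^ 2` and `h` integrable, with `f_m(t) + w t + h ≥ 0`. Constants do on a set of finite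
volume; on unbounded sets powers of `1 + ‖x‖` work exactly because `m > 1 - 2 / (d + 2)`. The
subquadratic growth lets the Wasserstein term absorb `∫ w` (`IsWeight.exists_bound`), which bounds
second moments. Almost optimal plans between `ρ_n` and `μ` are therefore tight; along a subsequence
they converge narrowly to a plan `γ` from some `ρ` to `μ`, the energies converge to some `E` and the
squared distances to some `b` (`exists_limit_plan`).

Lower semicontinuity. The weighted entropy is a supremum of affine functionals given by tangents of
the convex function `f_m`; this yields `weightedEntropy_le_of_tendsto`. Since `∫ w` converges along
the sequence, the energy of `ρ` is at most `E`, and the cost of `γ` is at most `b`.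

Minimality and strong convergence. Measures on `K` are approximated in energy and in `W2` by
measures on the domains (`exists_approx_of_convex`), so `E + b / (2 τ)` is at most the functional of
every competitor of finite entropy on `K`. Testing with `ρ` itself forces `b = W2 ρ μ ^ 2`: `ρ` is a
minimizer, `γ` is optimal, and no cost is lost in the limit. Convergence of the costs makes the
second moments of the `ρ_n` uniformly integrable, which upgrades narrow convergence to `W2`
convergence.

From `K` to `Ω`. For `m ≥ 1` the minimizer is absolutely continuous and the boundary of a convex set
is null. For `m < 1` a singular part could sit on the boundary. If `γ` joined boundary mass at `x`
to points `y ≠ x`, that mass could be moved to a diffuse law near `y` inside `K` at no greater cost,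
which strictly lowers the entropy. Hence boundary mass of `ρ` outside `U` does not move, and outside
`Ω` it would be mass of `μ`, which is zero there (`IsMinimizer.measure_compl_eq_zero`). -/

namespace JKO

/-! ### The Wasserstein distance: triangle inequality, moments and explicit plans. -/

section Wasserstein

variable {X : Type*} [NormedAddCommGroup X] [MeasurableSpace X]

/-- The quadratic cost of a plan. -/
noncomputable def cost (γ : Measure (X × X)) : ℝ≥0∞ := ∫⁻ p, edist p.1 p.2 ^ 2 ∂γ

/-- The second moment of a measure. -/
noncomputable def moment (μ : Measure X) : ℝ≥0∞ := ∫⁻ x, ‖x‖ₑ ^ 2 ∂μ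

theorem rpow_half_sq (x : ℝ≥0∞) : (x ^ (1 / 2 : ℝ)) ^ 2 = x := by
  rw [← ENNReal.rpow_natCast, ← ENNReal.rpow_mul]; norm_num

theorem sq_rpow_half (x : ℝ≥0∞) : (x ^ 2) ^ (1 / 2 : ℝ) = x := by
  rw [← ENNReal.rpow_natCast, ← ENNReal.rpow_mul]; norm_num

theorem W2_sq_eq (μ ν : Measure X) : W2 μ ν ^ 2 = ⨅ γ ∈ transportPlans μ ν, cost γ :=
  rpow_half_sq _

theorem W2_sq_le_cost {μ ν : Measure X} {γ : Measure (X × X)} (h : γ ∈ transportPlans μ ν) :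
    W2 μ ν ^ 2 ≤ cost γ := by
  rw [W2_sq_eq]; exact iInf₂_le γ h

theorem W2_le_of_sq_le {μ ν : Measure X} {c : ℝ≥0∞} (h : W2 μ ν ^ 2 ≤ c ^ 2) : W2 μ ν ≤ c := by
  have := ENNReal.rpow_le_rpow h (by norm_num : (0 : ℝ) ≤ 1 / 2)
  rwa [sq_rpow_half, sq_rpow_half] at this

theorem exists_plan_cost_lt {μ ν : Measure X} {c : ℝ≥0∞} (h : W2 μ ν ^ 2 < c) :
    ∃ γ ∈ transportPlans μ ν, cost γ < c := by
  rw [W2_sq_eq] at h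
  simpa only [iInf_lt_iff, exists_prop] using h

theorem edist_sq_le (x y : X) : edist x y ^ 2 ≤ 2 * ‖x‖ₑ ^ 2 + 2 * ‖y‖ₑ ^ 2 := by
  have h : edist x y ≤ ‖x‖ₑ + ‖y‖ₑ := by
    rw [edist_eq_enorm_sub]; exact enorm_sub_le
  calc edist x y ^ 2 ≤ (‖x‖ₑ + ‖y‖ₑ) ^ 2 := by gcongr
    _ ≤ 2 * ‖x‖ₑ ^ 2 + 2 * ‖y‖ₑ ^ 2 := by
      have := ENNReal.rpow_add_le_mul_rpow_add_rpow ‖x‖ₑ ‖y‖ₑ (p := 2) (by norm_num)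
      norm_num at this
      rwa [mul_add] at this

theorem enorm_sq_le (x y : X) : ‖x‖ₑ ^ 2 ≤ 2 * edist x y ^ 2 + 2 * ‖y‖ₑ ^ 2 := by
  have h := edist_sq_le (x - y) (-y)
  simpa [edist_eq_enorm_sub] using h

variable [BorelSpace X] [ProperSpace X]

theorem measurable_edist_sq : Measurable fun p : X × X => edist p.1 p.2 ^ 2 := by
  fun_prop

theorem lintegral_fst_of_plan {μ ν : Measure X} {γ : Measure (X × X)}
    (h : γ ∈ transportPlans μ ν) {f : X → ℝ≥0∞} (hf : Measurable f) :
    ∫⁻ p, f p.1 ∂γ = ∫⁻ x, f x ∂μ := by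
  rw [← h.2.1, lintegral_map hf measurable_fst]

theorem lintegral_snd_of_plan {μ ν : Measure X} {γ : Measure (X × X)}
    (h : γ ∈ transportPlans μ ν) {f : X → ℝ≥0∞} (hf : Measurable f) :
    ∫⁻ p, f p.2 ∂γ = ∫⁻ x, f x ∂ν := by
  rw [← h.2.2, lintegral_map hf measurable_snd]

theorem transportPlans_swap {μ ν : Measure X} {γ : Measure (X × X)}
    (h : γ ∈ transportPlans μ ν) :
    γ.map Prod.swap ∈ transportPlans ν μ ∧ cost (γ.map Prod.swap) = cost γ := by
  obtain ⟨h0, h1, h2⟩ := h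
  refine ⟨⟨Measure.isProbabilityMeasure_map measurable_swap.aemeasurable, ?_, ?_⟩, ?_⟩
  · rw [Measure.map_map measurable_fst measurable_swap]; exact h2
  · rw [Measure.map_map measurable_snd measurable_swap]; exact h1
  · rw [cost, lintegral_map measurable_edist_sq measurable_swap]
    simp [cost, edist_comm]

theorem W2_comm (μ ν : Measure X) : W2 μ ν = W2 ν μ := by
  have key : ∀ μ ν : Measure X, W2 μ ν ≤ W2 ν μ := by
    intro μ ν
    apply W2_le_of_sq_le
    rw [W2_sq_eq ν μ]
    refine le_iInf₂ fun γ hγ => ?_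
    rw [← (transportPlans_swap hγ).2]
    exact W2_sq_le_cost (transportPlans_swap hγ).1
  exact le_antisymm (key _ _) (key _ _)

/-- Gluing: disintegrate `γ₂` over its first marginal and draw the third point given the second
only. -/
theorem exists_glue {μ κ ν : Measure X} {γ₁ γ₂ : Measure (X × X)}
    (h₁ : γ₁ ∈ transportPlans μ κ) (h₂ : γ₂ ∈ transportPlans κ ν) :
    ∃ Γ : Measure ((X × X) × X), IsProbabilityMeasure Γ ∧ Γ.map Prod.fst = γ₁ ∧
      Γ.map (fun q => (q.1.2, q.2)) = γ₂ := by
  have := h₁.1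
  have := h₂.1
  let k : ProbabilityTheory.Kernel (X × X) X := γ₂.condKernel.comap Prod.snd measurable_snd
  refine ⟨Measure.compProd γ₁ k, inferInstance, Measure.fst_compProd γ₁ k, ?_⟩
  refine Measure.ext_of_lintegral _ fun f hf => ?_
  have hm : Measurable fun q : (X × X) × X => (q.1.2, q.2) := by fun_prop
  rw [lintegral_map hf hm,
    Measure.lintegral_compProd (f := fun q : (X × X) × X => f (q.1.2, q.2)) (hf.comp hm)]
  simp only [k, ProbabilityTheory.Kernel.comap_apply]
  have hmeas : Measurable fun y => ∫⁻ z, f (y, z) ∂(γ₂.condKernel y) :=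
    Measurable.lintegral_kernel_prod_right' hf
  rw [lintegral_snd_of_plan h₁ hmeas, ← Measure.lintegral_condKernel (ρ := γ₂) hf]
  congr 1
  exact h₂.2.1.symm

theorem W2_triangle (μ κ ν : Measure X) : W2 μ ν ≤ W2 μ κ + W2 κ ν := by
  by_cases hA : W2 μ κ = ∞
  · simp [hA]
  by_cases hB : W2 κ ν = ∞
  · simp [hB]
  refine ENNReal.le_of_forall_pos_le_add fun ε hε _ => ?_
  have hε' : ((ε / 2 : NNReal) : ℝ≥0∞) ≠ 0 := by simpa using hε.ne'
  have lt_sq : ∀ {a : ℝ≥0∞}, a ≠ ∞ → a ^ 2 < (a + ((ε / 2 : NNReal) : ℝ≥0∞)) ^ 2 := by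
    intro a ha
    exact ENNReal.pow_lt_pow_left (by norm_num) (ENNReal.lt_add_right ha hε')
  obtain ⟨γ₁, h₁, c₁⟩ := exists_plan_cost_lt (lt_sq hA)
  obtain ⟨γ₂, h₂, c₂⟩ := exists_plan_cost_lt (lt_sq hB)
  obtain ⟨Γ, hΓ, hΓ₁, hΓ₂⟩ := exists_glue h₁ h₂
  have hm : Measurable fun q : (X × X) × X => (q.1.1, q.2) := by fun_prop
  have hm₂ : Measurable fun q : (X × X) × X => (q.1.2, q.2) := by fun_prop
  have hplan : Γ.map (fun q => (q.1.1, q.2)) ∈ transportPlans μ ν := by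
    refine ⟨Measure.isProbabilityMeasure_map hm.aemeasurable, ?_, ?_⟩
    · rw [Measure.map_map measurable_fst hm, ← h₁.2.1, ← hΓ₁,
        Measure.map_map measurable_fst measurable_fst]; rfl
    · rw [Measure.map_map measurable_snd hm, ← h₂.2.2, ← hΓ₂,
        Measure.map_map measurable_snd hm₂]; rfl
  have key : (cost (Γ.map (fun q => (q.1.1, q.2)))) ^ (1 / 2 : ℝ) ≤
      cost γ₁ ^ (1 / 2 : ℝ) + cost γ₂ ^ (1 / 2 : ℝ) := by
    rw [← hΓ₁, ← hΓ₂]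
    simp only [cost]
    rw [lintegral_map measurable_edist_sq hm, lintegral_map measurable_edist_sq hm₂,
      lintegral_map measurable_edist_sq measurable_fst]
    -- Minkowski's inequality in `L²(Γ)` for the two consecutive displacements.
    have hLp := ENNReal.lintegral_Lp_add_le (μ := Γ) (p := 2)
      (f := fun q => edist q.1.1 q.1.2) (g := fun q => edist q.1.2 q.2)
      (by fun_prop) (by fun_prop) (by norm_num)
    simp only [Pi.add_apply, ENNReal.rpow_two] at hLp
    refine le_trans ?_ hLp
    gcongr
    exact edist_triangle _ _ _
  have rt : ∀ {c a : ℝ≥0∞}, c < a ^ 2 → c ^ (1 / 2 : ℝ) ≤ a := by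
    intro c a h
    have := ENNReal.rpow_le_rpow h.le (by norm_num : (0 : ℝ) ≤ 1 / 2)
    rwa [sq_rpow_half] at this
  calc W2 μ ν ≤ (cost (Γ.map (fun q => (q.1.1, q.2)))) ^ (1 / 2 : ℝ) :=
        ENNReal.rpow_le_rpow (iInf₂_le _ hplan) (by norm_num)
    _ ≤ _ := key
    _ ≤ (W2 μ κ + ((ε / 2 : NNReal) : ℝ≥0∞)) + (W2 κ ν + ((ε / 2 : NNReal) : ℝ≥0∞)) :=
        add_le_add (rt c₁) (rt c₂)
    _ = W2 μ κ + W2 κ ν + ε := by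
        have : (ε : ℝ≥0∞) = ((ε / 2 : NNReal) : ℝ≥0∞) + ((ε / 2 : NNReal) : ℝ≥0∞) := by
          rw [← ENNReal.coe_add, add_halves]
        rw [this]; ring

/-- Integrate `‖x‖² ≤ 2 d(x, y)² + 2 ‖y‖²` against each plan and take the infimum; an empty set of
plans gives the value `∞`. -/
theorem moment_le_of_W2 {μ ν : Measure X} : moment μ ≤ 2 * W2 μ ν ^ 2 + 2 * moment ν := by
  have h2 : (2 : ℝ≥0∞) ≠ ∞ := by norm_num
  rw [W2_sq_eq, ENNReal.mul_iInf_of_ne (by norm_num) h2, ENNReal.iInf_add]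
  refine le_iInf fun γ => ?_
  by_cases hγ : γ ∈ transportPlans μ ν
  · simp only [hγ, ciInf_pos]
    rw [moment, moment, ← lintegral_fst_of_plan hγ (by fun_prop),
      ← lintegral_snd_of_plan hγ (by fun_prop), cost, ← lintegral_const_mul _ (by fun_prop),
      ← lintegral_const_mul _ (by fun_prop), ← lintegral_add_left (by fun_prop)]
    exact lintegral_mono fun p => enorm_sq_le _ _
  · simp [hγ]

/-- A map moving one part of a measure yields a plan. -/
theorem W2_sq_add_map_le {α σ : Measure X} [IsProbabilityMeasure (α + σ)] {T : X → X}
    (hT : Measurable T) :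
    W2 (α + σ.map T) (α + σ) ^ 2 ≤ ∫⁻ x, edist (T x) x ^ 2 ∂σ := by
  have hd : Measurable fun x : X => (x, x) := by fun_prop
  have hg : Measurable fun x : X => (T x, x) := by fun_prop
  have hplan : α.map (fun x => (x, x)) + σ.map (fun x => (T x, x)) ∈
      transportPlans (α + σ.map T) (α + σ) := by
    refine ⟨⟨?_⟩, ?_, ?_⟩
    · rw [Measure.add_apply, Measure.map_apply hd .univ, Measure.map_apply hg .univ]
      simpa only [Measure.add_apply, Set.preimage_univ] using measure_univ (μ := α + σ)
    · rw [Measure.map_add _ _ measurable_fst, Measure.map_map measurable_fst hd,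
        Measure.map_map measurable_fst hg]
      congr 1
      exact Measure.map_id
    · rw [Measure.map_add _ _ measurable_snd, Measure.map_map measurable_snd hd,
        Measure.map_map measurable_snd hg]
      congr 1 <;> exact Measure.map_id
  refine (W2_sq_le_cost hplan).trans (le_of_eq ?_)
  rw [cost, lintegral_add_measure, lintegral_map measurable_edist_sq hd,
    lintegral_map measurable_edist_sq hg]
  simp

/-- Measures with a common part are close in the Wasserstein distance if the remaining parts are
small. -/
theorem W2_sq_add_add_le {θ α β : Measure X} [IsProbabilityMeasure (θ + α)]
    [IsFiniteMeasure β] (h : α Set.univ = β Set.univ) :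
    W2 (θ + α) (θ + β) ^ 2 ≤ 2 * moment α + 2 * moment β := by
  have hα : IsFiniteMeasure α := ⟨lt_of_le_of_lt (Measure.le_add_left le_rfl _)
    (measure_lt_top (θ + α) Set.univ)⟩
  have hd : Measurable fun x : X => (x, x) := by fun_prop
  set c := α Set.univ with hc
  have hc_top : c ≠ ∞ := measure_ne_top α _
  -- If `c = 0` the factor `c⁻¹ * c` is `0` instead of `1`, but then the measure itself vanishes.
  have key : ∀ m : Measure X, m Set.univ = c → (c⁻¹ * c) • m = m := by
    intro m hm
    by_cases h0 : c = 0
    · have : m = 0 := by rw [← Measure.measure_univ_eq_zero, hm, h0]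
      simp [this]
    · rw [ENNReal.inv_mul_cancel h0 hc_top, one_smul]
  have hfst : (α.prod β).map Prod.fst = c • α := by
    rw [Measure.map_fst_prod, ← h]
  have hsnd : (α.prod β).map Prod.snd = c • β := by
    rw [Measure.map_snd_prod]
  -- The plan leaves `θ` on the diagonal and couples `α` with `β` by their normalized product.
  have h1 : (θ.map (fun x => (x, x)) + c⁻¹ • α.prod β).map Prod.fst = θ + α := by
    rw [Measure.map_add _ _ measurable_fst, Measure.map_map measurable_fst hd,
      Measure.map_smul, hfst, smul_smul, key α rfl]
    congr 1
    exact Measure.map_id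
  have h2 : (θ.map (fun x => (x, x)) + c⁻¹ • α.prod β).map Prod.snd = θ + β := by
    rw [Measure.map_add _ _ measurable_snd, Measure.map_map measurable_snd hd,
      Measure.map_smul, hsnd, smul_smul, key β h.symm]
    congr 1
    exact Measure.map_id
  have h0 : IsProbabilityMeasure (θ.map (fun x => (x, x)) + c⁻¹ • α.prod β) := by
    constructor
    have := measure_univ (μ := θ + α)
    rw [← h1, Measure.map_apply measurable_fst .univ] at this
    simpa using this
  refine (W2_sq_le_cost ⟨h0, h1, h2⟩).trans ?_
  rw [cost, lintegral_add_measure, lintegral_map measurable_edist_sq hd, lintegral_smul_measure]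
  simp only [edist_self, ne_eq, OfNat.ofNat_ne_zero, not_false_eq_true, zero_pow,
    lintegral_const, zero_mul, zero_add]
  calc c⁻¹ • ∫⁻ p, edist p.1 p.2 ^ 2 ∂α.prod β
      ≤ c⁻¹ • ∫⁻ p, (2 * ‖p.1‖ₑ ^ 2 + 2 * ‖p.2‖ₑ ^ 2) ∂α.prod β := by
        gcongr; exact edist_sq_le _ _
    _ = c⁻¹ * (c * (2 * moment α + 2 * moment β)) := by
        rw [lintegral_add_left (by fun_prop), lintegral_const_mul _ (by fun_prop),
          lintegral_const_mul _ (by fun_prop)]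
        have e1 : ∫⁻ p, ‖p.1‖ₑ ^ 2 ∂α.prod β = c * moment α := by
          rw [← lintegral_map (f := fun x : X => ‖x‖ₑ ^ 2) (by fun_prop) measurable_fst, hfst,
            lintegral_smul_measure]; rfl
        have e2 : ∫⁻ p, ‖p.2‖ₑ ^ 2 ∂α.prod β = c * moment β := by
          rw [← lintegral_map (f := fun x : X => ‖x‖ₑ ^ 2) (by fun_prop) measurable_snd, hsnd,
            lintegral_smul_measure]; rfl
        rw [e1, e2, smul_eq_mul]; ring
    _ ≤ 2 * moment α + 2 * moment β := by
        rw [← mul_assoc]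
        exact mul_le_of_le_one_left zero_le (ENNReal.inv_mul_le_one c)

theorem W2_sq_le_moment {μ ν : Measure X} [IsProbabilityMeasure μ] [IsProbabilityMeasure ν] :
    W2 μ ν ^ 2 ≤ 2 * moment μ + 2 * moment ν := by
  have : IsProbabilityMeasure (0 + μ) := by rw [zero_add]; infer_instance
  simpa using W2_sq_add_add_le (θ := 0) (α := μ) (β := ν) (by simp)

end Wasserstein

/-! ### Narrow convergence with uniformly integrable second moments implies `W2` convergence. -/

section Convergence

variable {X : Type*} [NormedAddCommGroup X] [MeasurableSpace X] [BorelSpace X] [ProperSpace X]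

theorem map_eq_sum_dirac {N : ℕ} {k : X → ℕ} (hk : Measurable k) (hkN : ∀ x, k x ≤ N)
    (c : ℕ → X) (ν : Measure X) :
    ν.map (fun x => c (k x)) =
      ∑ i ∈ Finset.range (N + 1), ν (k ⁻¹' {i}) • Measure.dirac (c i) := by
  have hc : Measurable c := measurable_of_countable c
  refine Measure.ext_of_lintegral _ fun f hf => ?_
  have hck : Measurable fun x => c (k x) := hc.comp hk
  rw [lintegral_map hf hck, lintegral_finsetSum_measure,
    ← lintegral_map (f := fun i => f (c i)) (hf.comp hc) hk, lintegral_countable']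
  rw [tsum_eq_sum (s := Finset.range (N + 1))]
  · refine Finset.sum_congr rfl fun i _ => ?_
    rw [lintegral_smul_measure, lintegral_dirac' _ hf, Measure.map_apply hk (by simp),
      smul_eq_mul, mul_comm]
  · intro b hb
    have : k ⁻¹' {b} = ∅ := by
      ext x
      simp only [Set.mem_preimage, Set.mem_singleton_iff, Set.mem_empty_iff_false, iff_false]
      intro h
      exact hb (Finset.mem_range.2 (by have := hkN x; omega))
    rw [Measure.map_apply hk (by simp), this]
    simp

/-- Convergence of the weights of finitely supported measures implies convergence of the
measures. -/
theorem tendsto_W2_map_of_tendsto {N : ℕ} {k : X → ℕ} (hk : Measurable k) (hkN : ∀ x, k x ≤ N)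
    (c : ℕ → X) {μs : ℕ → Measure X} {μ : Measure X} [∀ n, IsProbabilityMeasure (μs n)]
    [IsProbabilityMeasure μ]
    (h : ∀ i, Tendsto (fun n => μs n (k ⁻¹' {i})) atTop (𝓝 (μ (k ⁻¹' {i})))) :
    Tendsto (fun n => W2 ((μs n).map fun x => c (k x)) (μ.map fun x => c (k x)) ^ 2)
      atTop (𝓝 0) := by
  have hck : Measurable fun x => c (k x) := (measurable_of_countable c).comp hk
  set s := Finset.range (N + 1) with hs
  have bound : ∀ n, W2 ((μs n).map fun x => c (k x)) (μ.map fun x => c (k x)) ^ 2 ≤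
      2 * (∑ i ∈ s, (μs n (k ⁻¹' {i}) - μ (k ⁻¹' {i})) * ‖c i‖ₑ ^ 2) +
      2 * (∑ i ∈ s, (μ (k ⁻¹' {i}) - μs n (k ⁻¹' {i})) * ‖c i‖ₑ ^ 2) := by
    intro n
    let a := fun i => μs n (k ⁻¹' {i})
    let b := fun i => μ (k ⁻¹' {i})
    -- The common part carries the minimum of the weights at each atom; only the positive parts of
    -- the differences have to travel.
    let θ : Measure X := ∑ i ∈ s, min (a i) (b i) • Measure.dirac (c i)
    let α : Measure X := ∑ i ∈ s, (a i - b i) • Measure.dirac (c i)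
    let β : Measure X := ∑ i ∈ s, (b i - a i) • Measure.dirac (c i)
    have hα : (μs n).map (fun x => c (k x)) = θ + α := by
      rw [map_eq_sum_dirac hk hkN, ← Finset.sum_add_distrib]
      refine Finset.sum_congr rfl fun i _ => ?_
      rw [← add_smul, add_comm, tsub_add_min]
    have hβ : μ.map (fun x => c (k x)) = θ + β := by
      rw [map_eq_sum_dirac hk hkN, ← Finset.sum_add_distrib]
      refine Finset.sum_congr rfl fun i _ => ?_
      rw [← add_smul, add_comm, min_comm, tsub_add_min]
    have p1 : IsProbabilityMeasure (θ + α) := by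
      rw [← hα]; exact Measure.isProbabilityMeasure_map hck.aemeasurable
    have p2 : IsProbabilityMeasure (θ + β) := by
      rw [← hβ]; exact Measure.isProbabilityMeasure_map hck.aemeasurable
    have f2 : IsFiniteMeasure β := ⟨lt_of_le_of_lt (Measure.le_add_left le_rfl _)
      (measure_lt_top (θ + β) Set.univ)⟩
    have hθ : θ Set.univ ≠ ∞ := ne_top_of_le_ne_top (measure_ne_top (θ + α) Set.univ)
      (Measure.le_add_right le_rfl _)
    have hu : α Set.univ = β Set.univ := by
      have e1 := measure_univ (μ := θ + α)
      have e2 := measure_univ (μ := θ + β)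
      rw [Measure.add_apply] at e1 e2
      exact (ENNReal.add_right_inj hθ).1 (e1.trans e2.symm)
    have hm : ∀ w : ℕ → ℝ≥0∞, moment (∑ i ∈ s, w i • Measure.dirac (c i)) =
        ∑ i ∈ s, w i * ‖c i‖ₑ ^ 2 := by
      intro w
      rw [moment, lintegral_finsetSum_measure]
      refine Finset.sum_congr rfl fun i _ => ?_
      rw [lintegral_smul_measure, lintegral_dirac' _ (by fun_prop), smul_eq_mul]
    rw [hα, hβ]
    refine (W2_sq_add_add_le hu).trans (le_of_eq ?_)
    rw [hm, hm]
  refine tendsto_of_tendsto_of_tendsto_of_le_of_le tendsto_const_nhds ?_ (fun _ => zero_le)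
    bound
  have hlim : ∀ i, Tendsto (fun n => (μs n (k ⁻¹' {i}) - μ (k ⁻¹' {i})) * ‖c i‖ₑ ^ 2) atTop
      (𝓝 0) := by
    intro i
    have := ENNReal.Tendsto.sub (h i) (tendsto_const_nhds (x := μ (k ⁻¹' {i})))
      (Or.inl (measure_ne_top _ _))
    have := ENNReal.Tendsto.mul_const (b := ‖c i‖ₑ ^ 2) this (Or.inr (by simp))
    simpa using this
  have hlim' : ∀ i, Tendsto (fun n => (μ (k ⁻¹' {i}) - μs n (k ⁻¹' {i})) * ‖c i‖ₑ ^ 2) atTop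
      (𝓝 0) := by
    intro i
    have := ENNReal.Tendsto.sub (tendsto_const_nhds (x := μ (k ⁻¹' {i}))) (h i)
      (Or.inl (measure_ne_top _ _))
    have := ENNReal.Tendsto.mul_const (b := ‖c i‖ₑ ^ 2) this (Or.inr (by simp))
    simpa using this
  have t1 := ENNReal.Tendsto.const_mul (a := 2) (tendsto_finsetSum s fun i _ => hlim i)
    (Or.inr (by norm_num))
  have t2 := ENNReal.Tendsto.const_mul (a := 2) (tendsto_finsetSum s fun i _ => hlim' i)
    (Or.inr (by norm_num))
  simpa using t1.add t2

theorem null_frontier_inter {ν : Measure X} {s t : Set X} (hs : ν (frontier s) = 0)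
    (ht : ν (frontier t) = 0) : ν (frontier (s ∩ t)) = 0 :=
  measure_mono_null (frontier_inter_subset s t) (measure_union_null
    (measure_mono_null Set.inter_subset_left hs) (measure_mono_null Set.inter_subset_right ht))

/-- A finite partition into sets with null boundary, which are small inside of a given ball. -/
theorem exists_discretization (ν : Measure X) [IsFiniteMeasure ν] (R : ℝ) {ε : ℝ} (hε : 0 < ε) :
    ∃ (N : ℕ) (k : X → ℕ) (c : ℕ → X), Measurable k ∧ (∀ x, k x ≤ N) ∧
      (∀ i, ν (frontier (k ⁻¹' {i})) = 0) ∧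
      ∀ x, dist (c (k x)) x ≤ ε ∨ (c (k x) = 0 ∧ x ∉ Metric.closedBall 0 R) := by
  classical
  let q := TopologicalSpace.denseSeq X
  -- The radii are chosen so that the boundaries of the balls are null, while radii above `ε / 2`
  -- still let balls around a dense sequence cover the space.
  have hr : ∀ i, ∃ r ∈ Set.Ioo (ε / 2) ε, ν (frontier (Metric.ball (q i) r)) = 0 := by
    intro i
    obtain ⟨r, hr, h⟩ := exists_null_frontier_thickening ν {q i} (half_lt_self hε)
    exact ⟨r, hr, by rwa [Metric.thickening_singleton] at h⟩
  choose r hr hν using hr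
  have hcover : ∀ x, ∃ i, x ∈ Metric.ball (q i) (r i) := by
    intro x
    obtain ⟨i, hi⟩ := (TopologicalSpace.denseRange_denseSeq X).exists_dist_lt x (half_pos hε)
    exact ⟨i, by rw [Metric.mem_ball]; exact hi.trans (hr i).1⟩
  obtain ⟨N, hN⟩ := (isCompact_closedBall (0 : X) R).elim_directed_cover
    (fun n => ⋃ i ∈ Finset.range n, Metric.ball (q i) (r i))
    (fun n => isOpen_biUnion fun i _ => Metric.isOpen_ball)
    (fun x _ => by
      obtain ⟨i, hi⟩ := hcover x
      refine Set.mem_iUnion.2 ⟨i + 1, Set.mem_biUnion (by simp) hi⟩)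
    (Monotone.directed_le fun a b hab => Set.biUnion_subset_biUnion_left
      (fun i hi => by simp only [SetLike.mem_coe, Finset.mem_range] at hi ⊢; omega))
  -- From index `N` on the sets are everything: the cell `N` collects the points missed by the first
  -- `N` balls, which lie outside the ball of radius `R`. It is sent to `0`.
  let B : ℕ → Set X := fun i => if i < N then Metric.ball (q i) (r i) else Set.univ
  have hB : ∀ i, MeasurableSet (B i) := by
    intro i
    by_cases h : i < N <;> simp [B, h, Metric.isOpen_ball.measurableSet]
  have hBf : ∀ i, ν (frontier (B i)) = 0 := by
    intro i
    by_cases h : i < N <;> simp [B, h, hν]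
  have hex : ∀ x, ∃ i, x ∈ B i := fun x => ⟨N, by simp [B]⟩
  -- Taking the first index turns the cover into a partition whose cells are finite intersections of
  -- the sets `B i` and their complements.
  refine ⟨N, fun x => Nat.find (hex x), fun i => if i < N then q i else 0,
    measurable_find hex hB, fun x => Nat.find_min' _ (by simp [B]), fun i => ?_, fun x => ?_⟩
  · have hfin : ∀ n, ν (frontier (⋂ j ∈ Finset.range n, (B j)ᶜ)) = 0 := by
      intro n
      induction n with
      | zero => simp
      | succ n ih =>
        rw [Finset.range_add_one, Finset.set_biInter_insert]
        exact null_frontier_inter (by rw [frontier_compl]; exact hBf n) ih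
    have : (fun x => Nat.find (hex x)) ⁻¹' {i} = B i ∩ ⋂ j ∈ Finset.range i, (B j)ᶜ := by
      ext x
      simp [Nat.find_eq_iff]
    rw [this]
    exact null_frontier_inter (hBf i) (hfin i)
  · have hx := Nat.find_spec (hex x)
    by_cases h : Nat.find (hex x) < N
    · left
      simp only [B, h, if_true] at hx ⊢
      rw [Metric.mem_ball, dist_comm] at hx
      exact (hx.trans (hr _).2).le
    · right
      refine ⟨by simp [h], fun hR => ?_⟩
      obtain ⟨i, hi, hxi⟩ := Set.mem_iUnion₂.1 (hN hR)
      rw [Finset.mem_range] at hi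
      exact Nat.find_min (hex x) (m := i) (by omega) (by simp only [B, hi, if_true]; exact hxi)

/-- Narrow convergence and uniform integrability of the second moments imply convergence in the
Wasserstein distance. -/
theorem tendsto_W2_of_tendsto {μs : ℕ → ProbabilityMeasure X} {μ : ProbabilityMeasure X}
    (h : Tendsto μs atTop (𝓝 μ))
    (tails : ∀ ε : ℝ≥0∞, 0 < ε → ∃ R : ℝ,
      (∀ᶠ n in atTop, ∫⁻ x in (Metric.closedBall 0 R)ᶜ, ‖x‖ₑ ^ 2 ∂(μs n : Measure X) ≤ ε) ∧
      ∫⁻ x in (Metric.closedBall 0 R)ᶜ, ‖x‖ₑ ^ 2 ∂(μ : Measure X) ≤ ε) :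
    Tendsto (fun n => W2 (μs n : Measure X) (μ : Measure X)) atTop (𝓝 0) := by
  rw [ENNReal.tendsto_nhds_zero]
  intro ε hε
  wlog hε_top : ε ≠ ∞ generalizing ε
  · filter_upwards [this 1 one_pos (by simp)] with n hn
    rw [not_not] at hε_top
    simp [hε_top]
  -- One third for each leg: discretize `μs n`, compare the two discretizations, discretize `μ`.
  set δ := ε / 3 with hδ
  have hδ0 : 0 < δ := ENNReal.div_pos hε.ne' (by norm_num)
  have hδ_top : δ ≠ ∞ := ENNReal.div_ne_top hε_top (by norm_num)
  have hδ1 : 0 < δ ^ 2 := pos_iff_ne_zero.2 (pow_ne_zero 2 hδ0.ne')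
  have hδ2 : 0 < δ ^ 2 / 2 := ENNReal.div_pos hδ1.ne' (by norm_num)
  obtain ⟨R, hR, hRμ⟩ := tails _ hδ2
  set η : ℝ := δ.toReal / 2 with hη
  have hη0 : 0 < η := half_pos (ENNReal.toReal_pos hδ0.ne' hδ_top)
  have hηδ : ENNReal.ofReal η ^ 2 ≤ δ ^ 2 / 2 := by
    have e : ENNReal.ofReal η = δ / 2 := by
      rw [hη, ENNReal.ofReal_div_of_pos (by norm_num), ENNReal.ofReal_toReal hδ_top]; simp
    rw [e, div_eq_mul_inv, div_eq_mul_inv, mul_pow]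
    gcongr
    rw [sq]
    exact mul_le_of_le_one_left zero_le (by norm_num)
  obtain ⟨N, k, c, hk, hkN, hkf, hkc⟩ := exists_discretization (μ : Measure X) R hη0
  have hck : Measurable fun x => c (k x) := (measurable_of_countable c).comp hk
  have approx : ∀ ν : ProbabilityMeasure X,
      ∫⁻ x in (Metric.closedBall 0 R)ᶜ, ‖x‖ₑ ^ 2 ∂(ν : Measure X) ≤ δ ^ 2 / 2 →
      W2 ((ν : Measure X).map fun x => c (k x)) (ν : Measure X) ≤ δ := by
    intro ν hν
    apply W2_le_of_sq_le
    have hz : IsProbabilityMeasure (0 + (ν : Measure X)) := by rw [zero_add]; infer_instance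
    have h1 := W2_sq_add_map_le (α := 0) (σ := (ν : Measure X)) hck
    rw [zero_add, zero_add] at h1
    refine h1.trans ?_
    calc ∫⁻ x, edist (c (k x)) x ^ 2 ∂(ν : Measure X)
        ≤ ∫⁻ x, (ENNReal.ofReal η ^ 2 +
            (Metric.closedBall (0 : X) R)ᶜ.indicator (fun x => ‖x‖ₑ ^ 2) x) ∂(ν : Measure X) := by
          refine lintegral_mono fun x => ?_
          -- Either the point moves by at most `η`, or it lies outside the ball and moves to `0`, at
          -- a cost `‖x‖²` counted in the tail.
          rcases hkc x with hx | ⟨hx0, hx⟩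
          · refine le_add_right ?_
            gcongr
            rw [edist_dist]
            exact ENNReal.ofReal_le_ofReal hx
          · refine le_add_left ?_
            simp only
            rw [Set.indicator_of_mem (by simpa using hx), hx0, edist_zero_left]
            exact le_rfl
      _ ≤ δ ^ 2 / 2 + δ ^ 2 / 2 := by
          rw [lintegral_add_left (by fun_prop), lintegral_const, measure_univ, mul_one,
            lintegral_indicator Metric.isClosed_closedBall.measurableSet.compl]
          exact add_le_add hηδ hν
      _ = δ ^ 2 := ENNReal.add_halves _
  have hweights : ∀ i, Tendsto (fun n => (μs n : Measure X) (k ⁻¹' {i})) atTop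
      (𝓝 ((μ : Measure X) (k ⁻¹' {i}))) := fun i =>
    ProbabilityMeasure.tendsto_measure_of_null_frontier_of_tendsto' h (hkf i)
  have hdisc := tendsto_W2_map_of_tendsto hk hkN c hweights
  rw [ENNReal.tendsto_nhds_zero] at hdisc
  filter_upwards [hdisc (δ ^ 2) hδ1, hR] with n hn hRn
  calc W2 (μs n : Measure X) (μ : Measure X)
      ≤ W2 (μs n : Measure X) ((μs n : Measure X).map fun x => c (k x)) +
        (W2 ((μs n : Measure X).map fun x => c (k x)) ((μ : Measure X).map fun x => c (k x)) +
          W2 ((μ : Measure X).map fun x => c (k x)) (μ : Measure X)) :=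
        (W2_triangle _ _ _).trans (by gcongr; exact W2_triangle _ _ _)
    _ ≤ δ + (δ + δ) := by
        refine add_le_add ?_ (add_le_add (W2_le_of_sq_le hn) (approx _ hRμ))
        rw [W2_comm]
        exact approx _ hRn
    _ = ε := by rw [← add_assoc, hδ, ENNReal.add_thirds]

end Convergence

/-! ### Tangents of the energy density. -/

section Density

variable {m : ℝ}

/-- The derivative of the energy density. -/
noncomputable def slope (m a : ℝ) : ℝ :=
  if m = 1 then Real.log a + 1 else m * a ^ (m - 1) / (m - 1)

theorem measurable_energyDensity (m : ℝ) : Measurable (energyDensity m) := by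
  unfold energyDensity
  by_cases h : m = 1
  · simp only [h, if_true]; fun_prop
  · simp only [h, if_false]; fun_prop

theorem measurable_slope (m : ℝ) : Measurable (slope m) := by
  unfold slope
  by_cases h : m = 1
  · simp only [h, if_true]; fun_prop
  · simp only [h, if_false]; fun_prop

theorem energyDensity_zero (hm : 0 < m) : energyDensity m 0 = 0 := by
  unfold energyDensity
  split_ifs <;> simp [Real.zero_rpow hm.ne']

theorem energyDensity_eq_tangent {a : ℝ} (ha : 0 < a) :
    energyDensity m a = -a ^ m + slope m a * a := by
  unfold energyDensity slope
  split_ifs with h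
  · subst h; rw [Real.rpow_one]; ring
  · have h1 : m - 1 ≠ 0 := sub_ne_zero.2 h
    rw [Real.rpow_sub_one ha.ne']
    field_simp
    ring

/-- Convexity of `f_m`. For `m = 1` it is `log u ≤ u - 1` at `u = a / t`; otherwise it is
Bernoulli's inequality for `1 + (t / a - 1)`, whose direction changes with the sign of `m - 1`, as
does the division by `m - 1`. -/
theorem tangent_le_energyDensity (hm : 0 < m) {a t : ℝ} (ha : 0 < a) (ht : 0 ≤ t) :
    -a ^ m + slope m a * t ≤ energyDensity m t := by
  have ham : 0 < a ^ m := Real.rpow_pos_of_pos ha m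
  unfold energyDensity slope
  split_ifs with h
  · subst h
    rw [Real.rpow_one]
    rcases ht.eq_or_lt with rfl | ht
    · simp [ha.le]
    · have h1 := Real.log_le_sub_one_of_pos (div_pos ha ht)
      rw [Real.log_div ha.ne' ht.ne'] at h1
      have h2 := mul_le_mul_of_nonneg_left h1 ht.le
      have h3 : t * (a / t - 1) = a - t := by field_simp
      rw [h3] at h2
      linarith
  · have h1 : m - 1 ≠ 0 := sub_ne_zero.2 h
    have hu : -1 ≤ t / a - 1 := by have := div_nonneg ht ha.le; linarith
    have e1 : t ^ m = a ^ m * (1 + (t / a - 1)) ^ m := by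
      rw [add_sub_cancel, Real.div_rpow ht ha.le, mul_div_cancel₀ _ ham.ne']
    have e2 : -a ^ m + m * a ^ (m - 1) / (m - 1) * t =
        a ^ m * (1 + m * (t / a - 1)) / (m - 1) := by
      rw [Real.rpow_sub_one ha.ne']
      field_simp
      ring
    rw [e1, e2]
    rcases lt_or_gt_of_ne h with h | h
    · have := rpow_one_add_le_one_add_mul_self hu hm.le h.le
      exact div_le_div_of_nonpos_of_le (by linarith) (by gcongr)
    · have := one_add_mul_self_le_rpow_one_add hu h.le
      have hpos : 0 < m - 1 := by linarith
      gcongr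

theorem slope_mono (hm : 0 < m) {a b : ℝ} (ha : 0 < a) (hab : a ≤ b) : slope m a ≤ slope m b := by
  unfold slope
  split_ifs with h
  · gcongr
  · rcases lt_or_gt_of_ne h with h | h
    · have := Real.rpow_le_rpow_of_nonpos ha hab (by linarith : m - 1 ≤ 0)
      exact div_le_div_of_nonpos_of_le (by linarith) (by gcongr)
    · have hpos : 0 < m - 1 := by linarith
      gcongr

theorem slope_nonpos (hm : 0 < m) (hm1 : m < 1) {a : ℝ} (ha : 0 < a) : slope m a ≤ 0 := by
  unfold slope
  rw [if_neg hm1.ne]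
  exact div_nonpos_of_nonneg_of_nonpos (by positivity) (by linarith)

theorem continuousOn_slope (m : ℝ) : ContinuousOn (slope m) (Set.Ioi 0) := by
  unfold slope
  by_cases h : m = 1
  · simp only [h, if_true]
    exact (Real.continuousOn_log.mono fun x hx => (ne_of_gt hx : x ≠ 0)).add continuousOn_const
  · simp only [h, if_false]
    exact (continuousOn_const.mul (continuousOn_id.rpow_const fun x hx =>
      Or.inl (ne_of_gt hx : x ≠ 0))).div_const _

/-- The slope at infinity decides the role of singular parts: here it is zero, so they contribute
nothing to the entropy; for `m ≥ 1` it is infinite, which excludes them. -/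
theorem tendsto_slope_of_lt_one (hm1 : m < 1) : Tendsto (slope m) atTop (𝓝 0) := by
  unfold slope
  simp only [hm1.ne, if_false]
  have := tendsto_rpow_neg_atTop (by linarith : 0 < 1 - m)
  simpa [neg_sub] using (this.const_mul m).div_const (m - 1)

theorem tendsto_slope_of_one_le (hm1 : 1 ≤ m) : Tendsto (slope m) atTop atTop := by
  unfold slope
  by_cases h : m = 1
  · simp only [h, if_true]
    exact tendsto_atTop_add_const_right _ _ Real.tendsto_log_atTop
  · simp only [h, if_false]
    have h1 : 1 < m := lt_of_le_of_ne hm1 (Ne.symm h)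
    have h2 := tendsto_rpow_atTop (by linarith : 0 < m - 1)
    have h3 : (fun a : ℝ => m * a ^ (m - 1) / (m - 1)) = fun a => m / (m - 1) * a ^ (m - 1) := by
      ext a; ring
    rw [h3]
    exact h2.const_mul_atTop (div_pos (by linarith) (by linarith))

/-- Truncation to the interval `[1 / T, T]`. -/
noncomputable def clamp (T t : ℝ) : ℝ := max (1 / T) (min t T)

theorem clamp_mem {T : ℝ} (hT : 1 ≤ T) (t : ℝ) : clamp T t ∈ Set.Icc (1 / T) T := by
  have h : 1 / T ≤ T := by
    rw [div_le_iff₀ (by linarith)]; nlinarith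
  exact ⟨le_max_left _ _, max_le h (min_le_right _ _)⟩

theorem clamp_pos {T : ℝ} (hT : 1 ≤ T) (t : ℝ) : 0 < clamp T t :=
  lt_of_lt_of_le (by positivity) (clamp_mem hT t).1

theorem continuous_clamp (T : ℝ) : Continuous (clamp T) := by unfold clamp; fun_prop

/-- The tangent at a truncation of `t` is, at `t`, above the tangent at `1`. -/
theorem tangent_one_le (hm : 0 < m) {T t : ℝ} (hT : 1 ≤ T) :
    -1 + slope m 1 * t ≤ -(clamp T t) ^ m + slope m (clamp T t) * t := by
  set a := clamp T t with ha
  have hapos : 0 < a := clamp_pos hT t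
  have h1 := tangent_le_energyDensity hm one_pos hapos.le
  rw [energyDensity_eq_tangent hapos, Real.one_rpow] at h1
  -- Truncation raises `t` only to a value at most `1` and lowers it only to a value at least `1`;
  -- in both cases monotonicity of the slope has the right sign.
  have key : slope m 1 * (t - a) ≤ slope m a * (t - a) := by
    have hT1 : 1 / T ≤ 1 := by rw [div_le_one (by linarith)]; exact hT
    rcases lt_trichotomy t a with h | h | h
    · have : a ≤ 1 := by
        rw [ha, clamp] at h ⊢
        refine max_le hT1 ?_
        by_contra hc
        rw [not_le, lt_min_iff] at hc
        rcases lt_max_iff.1 h with h | h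
        · linarith
        · exact absurd h (not_lt.2 (min_le_left _ _))
      exact mul_le_mul_of_nonpos_right (slope_mono hm hapos this) (by linarith)
    · rw [h, sub_self, mul_zero, mul_zero]
    · have : 1 ≤ a := by
        rw [ha, clamp] at h ⊢
        rw [max_lt_iff, min_lt_iff] at h
        rcases h.2 with h | h
        · exact absurd h (lt_irrefl _)
        · rw [min_eq_right h.le]; exact hT.trans (le_max_right _ _)
      exact mul_le_mul_of_nonneg_right (slope_mono hm one_pos this) (by linarith)
  linarith

theorem tendsto_tangent_clamp (hm : 0 < m) {t : ℝ} (ht : 0 ≤ t) :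
    Tendsto (fun T => -(clamp T t) ^ m + slope m (clamp T t) * t) atTop
      (𝓝 (energyDensity m t)) := by
  rcases ht.eq_or_lt with rfl | ht
  · rw [energyDensity_zero hm]
    have h1 : Tendsto (fun T : ℝ => (1 / T) ^ m) atTop (𝓝 0) := by
      have : Tendsto (fun T : ℝ => 1 / T) atTop (𝓝 0) := by simpa using tendsto_inv_atTop_zero
      simpa [Real.zero_rpow hm.ne'] using this.rpow_const (Or.inr hm.le)
    have h2 : ∀ᶠ T : ℝ in atTop, -(1 / T) ^ m = -(clamp T 0) ^ m + slope m (clamp T 0) * 0 := by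
      filter_upwards [eventually_ge_atTop 0] with T hT
      rw [clamp, min_eq_left hT, max_eq_left (by positivity)]; ring
    simpa using h1.neg.congr' h2
  · refine tendsto_const_nhds.congr' ?_
    filter_upwards [eventually_ge_atTop t, eventually_ge_atTop (1 / t)] with T h1 h2
    have h3 : clamp T t = t := by
      rw [clamp, min_eq_left h1, max_eq_right]
      rw [div_le_iff₀ (by linarith)]
      rw [div_le_iff₀ ht] at h2
      linarith
    rw [h3, energyDensity_eq_tangent ht]

end Density

/-! ### Compactly supported cutoff functions increasing to one. -/

section Cutoff

variable {X : Type*} [NormedAddCommGroup X]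

/-- Cutoff functions exhausting the space. -/
noncomputable def cutoff (n : ℕ) (x : X) : ℝ := max 0 (min 1 ((n : ℝ) + 1 - ‖x‖))

theorem continuous_cutoff (n : ℕ) : Continuous (cutoff n : X → ℝ) := by
  unfold cutoff; fun_prop

theorem hasCompactSupport_cutoff [ProperSpace X] (n : ℕ) : HasCompactSupport (cutoff n : X → ℝ) := by
  refine HasCompactSupport.intro (isCompact_closedBall (0 : X) ((n : ℝ) + 1)) fun x hx => ?_
  rw [Metric.mem_closedBall, dist_zero_right, not_le] at hx
  exact max_eq_left ((min_le_right _ _).trans (by linarith))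

theorem cutoff_nonneg (n : ℕ) (x : X) : 0 ≤ cutoff n x := le_max_left _ _

theorem cutoff_le_one (n : ℕ) (x : X) : cutoff n x ≤ 1 :=
  max_le zero_le_one (min_le_left _ _)

theorem cutoff_mono (x : X) : Monotone fun n : ℕ => cutoff n x := by
  intro a b hab
  simp only [cutoff]
  gcongr

theorem tendsto_cutoff (x : X) : Tendsto (fun n : ℕ => cutoff n x) atTop (𝓝 1) := by
  refine tendsto_const_nhds.congr' ?_
  filter_upwards [eventually_ge_atTop ⌈‖x‖⌉₊] with n hn
  have : ‖x‖ ≤ n := (Nat.le_ceil _).trans (by exact_mod_cast hn)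
  rw [cutoff, min_eq_left (by linarith), max_eq_right zero_le_one]

end Cutoff

/-! ### The weighted entropy and its affine minorants. -/

section WeightedEntropy

variable {X : Type*} [NormedAddCommGroup X] [MeasureSpace X]

/-- The density of the absolutely continuous part, as a real function. -/
noncomputable def dens (ρ : Measure X) (x : X) : ℝ := (ρ.rnDeriv volume x).toReal

theorem measurable_dens (ρ : Measure X) : Measurable (dens ρ) :=
  (Measure.measurable_rnDeriv _ _).ennreal_toReal

theorem dens_nonneg (ρ : Measure X) (x : X) : 0 ≤ dens ρ x := ENNReal.toReal_nonneg

/-- A pair of functions such that `f_m(t) + w t + h` is nonnegative on `K`. -/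
structure IsWeight (m : ℝ) (K : Set X) (w h : X → ℝ) : Prop where
  continuous : Continuous w
  nonneg : ∀ x, 0 ≤ w x
  measurable : Measurable h
  integrable : IntegrableOn h K
  h_nonneg : ∀ x, 0 ≤ h x
  le : ∀ x ∈ K, ∀ t, 0 ≤ t → 0 ≤ energyDensity m t + w x * t + h x
  growth : ∀ ε : ℝ, 0 < ε → ∃ C : ℝ, ∀ x, w x ≤ ε * ‖x‖ ^ 2 + C

open Classical in
/-- The entropy, with the weights added. -/
noncomputable def weightedEntropy (m : ℝ) (K : Set X) (w h : X → ℝ) (ρ : Measure X) : ℝ≥0∞ :=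
  if 1 ≤ m ∧ ¬ ρ ≪ volume then ⊤
  else (∫⁻ x in K, ENNReal.ofReal (energyDensity m (dens ρ x) + w x * dens ρ x + h x)) +
    ∫⁻ x, ENNReal.ofReal (w x) ∂ρ.singularPart volume

variable [BorelSpace X] [ProperSpace X] [IsFiniteMeasureOnCompacts (volume : Measure X)]

theorem singularPart_add_restrict_withDensity {K : Set X} (hK : MeasurableSet K) {ρ : Measure X}
    [IsFiniteMeasure ρ] (hρ : ρ Kᶜ = 0) :
    ρ.singularPart volume + (volume.restrict K).withDensity (ρ.rnDeriv volume) = ρ := by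
  rw [← restrict_withDensity hK]
  rw [Measure.restrict_eq_self_of_ae_mem]
  · exact ρ.singularPart_add_rnDeriv volume
  · rw [ae_iff]
    exact measure_mono_null subset_rfl
      (le_antisymm ((Measure.withDensity_rnDeriv_le ρ volume _).trans hρ.le) zero_le)

theorem dens_lt_top (ρ : Measure X) [IsFiniteMeasure ρ] {K : Set X} :
    ∀ᵐ x ∂volume.restrict K, ρ.rnDeriv volume x < ∞ :=
  ae_restrict_of_ae (ρ.rnDeriv_lt_top volume)

theorem integrable_mul_dens {K : Set X} (hK : MeasurableSet K) {ρ : Measure X}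
    [IsFiniteMeasure ρ] (hρ : ρ Kᶜ = 0) {φ : X → ℝ} (hφ : Integrable φ ρ) :
    IntegrableOn (fun x => φ x * dens ρ x) K ∧ Integrable φ (ρ.singularPart volume) := by
  rw [← singularPart_add_restrict_withDensity hK hρ, integrable_add_measure] at hφ
  refine ⟨?_, hφ.1⟩
  rw [integrable_withDensity_iff_integrable_smul' (Measure.measurable_rnDeriv _ _)
    (dens_lt_top ρ)] at hφ
  simpa [IntegrableOn, dens, mul_comm] using hφ.2

theorem integral_eq_add_dens {K : Set X} (hK : MeasurableSet K) {ρ : Measure X}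
    [IsFiniteMeasure ρ] (hρ : ρ Kᶜ = 0) {φ : X → ℝ} (hφ : Integrable φ ρ) :
    ∫ x, φ x ∂ρ = (∫ x in K, φ x * dens ρ x) + ∫ x, φ x ∂ρ.singularPart volume := by
  have h := hφ
  rw [← singularPart_add_restrict_withDensity hK hρ, integrable_add_measure] at h
  conv_lhs => rw [← singularPart_add_restrict_withDensity hK hρ]
  rw [integral_add_measure h.1 h.2, add_comm,
    integral_withDensity_eq_integral_toReal_smul (Measure.measurable_rnDeriv _ _) (dens_lt_top ρ)]
  simp [dens, mul_comm]

theorem integrable_dens {K : Set X} {ρ : Measure X} [IsFiniteMeasure ρ] :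
    IntegrableOn (dens ρ) K :=
  Measure.integrable_toReal_rnDeriv.integrableOn

variable {m : ℝ} {K : Set X} {w h : X → ℝ}

theorem IsWeight.integrable_of_moment (H : IsWeight m K w h) {ρ : Measure X} [IsFiniteMeasure ρ]
    (hρ : moment ρ < ∞) : Integrable w ρ := by
  obtain ⟨C, hC⟩ := H.growth 1 one_pos
  have h1 : Integrable (fun x : X => ‖x‖ ^ 2) ρ := by
    refine ⟨by fun_prop, ?_⟩
    rw [hasFiniteIntegral_iff_enorm]
    refine lt_of_le_of_lt (lintegral_mono fun x => ?_) hρ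
    simp
  refine (h1.add (integrable_const C)).mono' H.continuous.aestronglyMeasurable (ae_of_all _ ?_)
  intro x
  rw [Real.norm_of_nonneg (H.nonneg x)]
  simpa using hC x

theorem integrable_mul_of_cutoff {χ : X → ℝ} (hχ : Continuous χ) (hχc : HasCompactSupport χ)
    {g : X → ℝ} (hg : Measurable g) {B : ℝ} (hB : ∀ x, |g x| ≤ B) (ν : Measure X)
    [IsFiniteMeasureOnCompacts ν] : Integrable (fun x => χ x * g x) ν :=
  (hχ.integrable_of_hasCompactSupport hχc).mul_bdd (c := B) hg.aestronglyMeasurable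
    (ae_of_all _ hB)

theorem bounded_on_Icc_of_slope {δ T : ℝ} (hδ : 0 < δ) :
    ∃ B, ∀ a ∈ Set.Icc δ T, |slope m a| ≤ B := by
  obtain ⟨B, hB⟩ := isCompact_Icc.exists_bound_of_continuousOn
    ((continuousOn_slope m).mono fun a (ha : a ∈ Set.Icc δ T) => hδ.trans_le ha.1)
  exact ⟨B, hB⟩

theorem bounded_on_Icc_of_rpow (hm : 0 < m) {δ T : ℝ} (hδ : 0 < δ) :
    ∀ a ∈ Set.Icc δ T, |-a ^ m| ≤ T ^ m := by
  intro a ha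
  have h0 : 0 ≤ a := hδ.le.trans ha.1
  rw [abs_neg, abs_of_nonneg (Real.rpow_nonneg h0 m)]
  exact Real.rpow_le_rpow h0 ha.2 hm.le

/-- The affine minorant of the weighted entropy given by tangents at a function `a`, localized by
a cutoff function. -/
noncomputable def tangentFunctional (m : ℝ) (K : Set X) (w h χ a : X → ℝ) (ρ : Measure X) : ℝ :=
  (∫ x in K, χ x * (-(a x) ^ m + h x)) + ∫ x, χ x * (slope m (a x) + w x) ∂ρ

/-- On the density part, the tangent lies below `f_m`, and multiplying by `χ ≤ 1` only decreases the
nonnegative quantity `f_m(t) + w t + h`. On the singular part, which is absent for `m ≥ 1`, the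
slope is nonpositive for `m < 1`, leaving at most `w`. -/
theorem tangentFunctional_le (hm : 0 < m) (hK : MeasurableSet K) (H : IsWeight m K w h)
    {χ : X → ℝ} (hχ : Continuous χ) (hχc : HasCompactSupport χ) (hχ0 : ∀ x, 0 ≤ χ x)
    (hχ1 : ∀ x, χ x ≤ 1) {a : X → ℝ} (ha : Measurable a) {δ T : ℝ} (hδ : 0 < δ)
    (haI : ∀ x, a x ∈ Set.Icc δ T) {ρ : Measure X} [IsFiniteMeasure ρ] (hρ : ρ Kᶜ = 0)
    {L : ℝ} (hL0 : 0 ≤ L) (hL : weightedEntropy m K w h ρ ≤ ENNReal.ofReal L) :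
    tangentFunctional m K w h χ a ρ ≤ L := by
  obtain ⟨B, hB⟩ := bounded_on_Icc_of_slope (m := m) (T := T) hδ
  have hw : Continuous fun x => χ x * w x := hχ.mul H.continuous
  have hwc : HasCompactSupport fun x => χ x * w x := hχc.mul_right
  have hs : Measurable fun x => slope m (a x) := (measurable_slope m).comp ha
  have hp : ∀ (ν : Measure X) [IsFiniteMeasureOnCompacts ν],
      Integrable (fun x => χ x * (slope m (a x) + w x)) ν := by
    intro ν _
    simp only [mul_add]
    exact (integrable_mul_of_cutoff hχ hχc hs (fun x => hB _ (haI x)) ν).add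
      (hw.integrable_of_hasCompactSupport hwc)
  have hq : IntegrableOn (fun x => χ x * (-(a x) ^ m + h x)) K := by
    simp only [mul_add]
    refine (integrable_mul_of_cutoff hχ hχc (by fun_prop)
      (fun x => bounded_on_Icc_of_rpow hm hδ _ (haI x)) _).add ?_
    exact H.integrable.bdd_mul (c := 1) hχ.aestronglyMeasurable
      (ae_of_all _ fun x => by rw [Real.norm_of_nonneg (hχ0 x)]; exact hχ1 x)
  rw [tangentFunctional, integral_eq_add_dens hK hρ (hp ρ), ← add_assoc,
    ← integral_add hq (integrable_mul_dens hK hρ (hp ρ)).1]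
  have hne : ¬ (1 ≤ m ∧ ¬ ρ ≪ volume) := by
    intro hc
    rw [weightedEntropy, if_pos hc] at hL
    exact absurd (top_le_iff.1 hL) ENNReal.ofReal_ne_top
  rw [weightedEntropy, if_neg hne] at hL
  have hmeas : Measurable fun x => energyDensity m (dens ρ x) + w x * dens ρ x + h x :=
    ((((measurable_energyDensity m).comp (measurable_dens ρ)).add
      (H.continuous.measurable.mul (measurable_dens ρ))).add H.measurable)
  have hGfin : ∫⁻ x in K, ENNReal.ofReal (energyDensity m (dens ρ x) + w x * dens ρ x + h x) ≠ ∞ :=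
    ne_top_of_le_ne_top ENNReal.ofReal_ne_top (le_self_add.trans hL)
  have hSfin : ∫⁻ x, ENNReal.ofReal (w x) ∂ρ.singularPart volume ≠ ∞ :=
    ne_top_of_le_ne_top ENNReal.ofReal_ne_top (le_add_self.trans hL)
  have hG0 : 0 ≤ᵐ[volume.restrict K]
      fun x => energyDensity m (dens ρ x) + w x * dens ρ x + h x := by
    filter_upwards [ae_restrict_mem hK] with x hx using H.le x hx _ (dens_nonneg ρ x)
  have hGint : IntegrableOn (fun x => energyDensity m (dens ρ x) + w x * dens ρ x + h x) K :=
    (lintegral_ofReal_ne_top_iff_integrable hmeas.aestronglyMeasurable hG0).1 hGfin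
  have hSint : Integrable w (ρ.singularPart volume) :=
    (lintegral_ofReal_ne_top_iff_integrable H.continuous.aestronglyMeasurable
      (ae_of_all _ H.nonneg)).1 hSfin
  rw [← ofReal_integral_eq_lintegral_ofReal hGint hG0,
    ← ofReal_integral_eq_lintegral_ofReal hSint (ae_of_all _ H.nonneg),
    ← ENNReal.ofReal_add (integral_nonneg_of_ae hG0) (integral_nonneg H.nonneg),
    ENNReal.ofReal_le_ofReal_iff hL0] at hL
  refine le_trans (add_le_add ?_ ?_) hL
  · refine setIntegral_mono_on (hq.add (integrable_mul_dens hK hρ (hp ρ)).1) hGint hK ?_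
    intro x hx
    have h1 := tangent_le_energyDensity hm (hδ.trans_le (haI x).1) (dens_nonneg ρ x)
    have h2 := H.le x hx _ (dens_nonneg ρ x)
    have h3 := mul_le_mul_of_nonneg_left h1 (hχ0 x)
    have h4 := mul_le_mul_of_nonneg_right (hχ1 x) h2
    linarith
  · by_cases h1 : 1 ≤ m
    · have hac : ρ ≪ volume := by
        by_contra hc; exact hne ⟨h1, hc⟩
      rw [(Measure.singularPart_eq_zero _ _).2 hac]
      simp
    · refine integral_mono (hp _) hSint fun x => ?_
      have h2 := slope_nonpos hm (not_le.1 h1) (hδ.trans_le (haI x).1)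
      have h3 := H.nonneg x
      have h4 := hχ0 x
      have h5 := hχ1 x
      nlinarith

end WeightedEntropy

/-! ### Tangent functionals along narrowly convergent sequences. -/

section LowerSemicontinuity

variable {X : Type*} [NormedAddCommGroup X] [MeasureSpace X]
variable [BorelSpace X] [ProperSpace X] [IsFiniteMeasureOnCompacts (volume : Measure X)]
variable {m : ℝ} {K : Set X} {w h : X → ℝ}

/-- For continuous `a` the functional is a constant plus the integral of a bounded continuous
function, hence narrowly continuous. -/
theorem tangentFunctional_le_of_tendsto_of_continuous (hm : 0 < m) (hK : MeasurableSet K)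
    (H : IsWeight m K w h) {χ : X → ℝ} (hχ : Continuous χ) (hχc : HasCompactSupport χ)
    (hχ0 : ∀ x, 0 ≤ χ x) (hχ1 : ∀ x, χ x ≤ 1) {μs : ℕ → ProbabilityMeasure X}
    {μ : ProbabilityMeasure X} (hμs : Tendsto μs atTop (𝓝 μ))
    (hsupp : ∀ n, (μs n : Measure X) Kᶜ = 0) {L : ℝ} (hL0 : 0 ≤ L)
    (hL : ∀ᶠ n in atTop, weightedEntropy m K w h (μs n) ≤ ENNReal.ofReal L)
    {a : X → ℝ} (ha : Continuous a) {δ T : ℝ} (hδ : 0 < δ) (haI : ∀ x, a x ∈ Set.Icc δ T) :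
    tangentFunctional m K w h χ a (μ : Measure X) ≤ L := by
  have hs : Continuous fun x => slope m (a x) :=
    (continuousOn_slope m).comp_continuous ha fun x => hδ.trans_le (haI x).1
  have hφ : Continuous fun x => χ x * (slope m (a x) + w x) := hχ.mul (hs.add H.continuous)
  obtain ⟨C, hC⟩ := (hχc.mul_right (f' := fun x => slope m (a x) + w x)).exists_bound_of_continuous
    hφ
  let φ : BoundedContinuousFunction X ℝ := BoundedContinuousFunction.ofNormedAddCommGroup
    (fun x => χ x * (slope m (a x) + w x)) hφ C hC
  have hlim := (ProbabilityMeasure.tendsto_iff_forall_integral_tendsto.1 hμs φ).const_add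
    (∫ x in K, χ x * (-(a x) ^ m + h x))
  refine le_of_tendsto hlim ?_
  filter_upwards [hL] with n hn
  exact tangentFunctional_le hm hK H hχ hχc hχ0 hχ1 ha.measurable hδ haI (hsupp n) hL0 hn

/-- Bounded measurable functions are almost everywhere limits of continuous functions with the
same bounds. -/
theorem exists_continuous_seq_tendsto_ae (ν : Measure X) [IsFiniteMeasure ν] {a : X → ℝ}
    (ha : Measurable a) {δ T : ℝ} (haI : ∀ x, a x ∈ Set.Icc δ T) :
    ∃ g : ℕ → X → ℝ, (∀ j, Continuous (g j)) ∧ (∀ j x, g j x ∈ Set.Icc δ T) ∧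
      ∀ᵐ x ∂ν, Tendsto (fun j => g j x) atTop (𝓝 (a x)) := by
  rcases isEmpty_or_nonempty X with hX | ⟨⟨x₀⟩⟩
  · exact ⟨fun _ => a, fun _ => continuous_of_discreteTopology, fun _ => haI,
      ae_of_all _ fun x => tendsto_const_nhds⟩
  have hδT : δ ≤ T := (haI x₀).1.trans (haI x₀).2
  have hmem : MemLp a 1 ν := by
    refine MemLp.of_bound ha.aestronglyMeasurable (max |δ| |T|) (ae_of_all _ fun x => ?_)
    exact abs_le_max_abs_abs (haI x).1 (haI x).2
  have hg : ∀ j : ℕ, ∃ g : BoundedContinuousFunction X ℝ,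
      eLpNorm (a - ⇑g) 1 ν ≤ ((j : ℝ≥0∞) + 1)⁻¹ ∧ MemLp g 1 ν := fun j =>
    hmem.exists_boundedContinuous_eLpNorm_sub_le (by simp) (by simp)
  choose g hg hgm using hg
  have hlim : Tendsto (fun j => eLpNorm (⇑(g j) - a) 1 ν) atTop (𝓝 0) := by
    refine tendsto_of_tendsto_of_tendsto_of_le_of_le tendsto_const_nhds ?_ (fun _ => zero_le)
      (fun j => (eLpNorm_sub_comm _ _ _ _).le.trans (hg j))
    have := ENNReal.tendsto_inv_nat_nhds_zero.comp (tendsto_add_atTop_nat 1)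
    simpa [Function.comp_def] using this
  obtain ⟨ns, -, hns⟩ := (tendstoInMeasure_of_tendsto_eLpNorm one_ne_zero
    (fun j => (g j).continuous.aestronglyMeasurable) ha.aestronglyMeasurable
    hlim).exists_seq_tendsto_ae
  refine ⟨fun j x => max δ (min T (g (ns j) x)), fun j => ?_, fun j x =>
    ⟨le_max_left _ _, max_le hδT (min_le_left _ _)⟩, ?_⟩
  · exact continuous_const.max (continuous_const.min (g (ns j)).continuous)
  · filter_upwards [hns] with x hx
    have := (tendsto_const_nhds (x := δ)).max ((tendsto_const_nhds (x := T)).min hx)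
    rwa [min_eq_right (haI x).2, max_eq_right (haI x).1] at this

/-- Measurable `a` are needed to treat the density and the singular part of the limit separately.
They are reached from continuous ones by dominated convergence, for the limit measure only. -/
theorem tangentFunctional_le_of_tendsto (hm : 0 < m) (hK : MeasurableSet K)
    (H : IsWeight m K w h) {χ : X → ℝ} (hχ : Continuous χ) (hχc : HasCompactSupport χ)
    (hχ0 : ∀ x, 0 ≤ χ x) (hχ1 : ∀ x, χ x ≤ 1) {μs : ℕ → ProbabilityMeasure X}
    {μ : ProbabilityMeasure X} (hμs : Tendsto μs atTop (𝓝 μ))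
    (hsupp : ∀ n, (μs n : Measure X) Kᶜ = 0) {L : ℝ} (hL0 : 0 ≤ L)
    (hL : ∀ᶠ n in atTop, weightedEntropy m K w h (μs n) ≤ ENNReal.ofReal L)
    {a : X → ℝ} (ha : Measurable a) {δ T : ℝ} (hδ : 0 < δ) (haI : ∀ x, a x ∈ Set.Icc δ T) :
    tangentFunctional m K w h χ a (μ : Measure X) ≤ L := by
  have hfin : IsFiniteMeasure (volume.restrict (tsupport χ)) :=
    ⟨by rw [Measure.restrict_apply_univ]; exact IsCompact.measure_lt_top hχc⟩
  -- The approximation must hold for volume on the support of `χ` and for `μ` simultaneously, since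
  -- both integrals occur.
  obtain ⟨g, hgc, hgI, hg⟩ := exists_continuous_seq_tendsto_ae
    (volume.restrict (tsupport χ) + (μ : Measure X)) ha haI
  rw [ae_add_measure_iff, ae_restrict_iff' (isClosed_tsupport χ).measurableSet] at hg
  obtain ⟨B, hB⟩ := bounded_on_Icc_of_slope (m := m) (T := T) hδ
  have l1 : Tendsto (fun j => ∫ x in K, χ x * (-(g j x) ^ m + h x)) atTop
      (𝓝 (∫ x in K, χ x * (-(a x) ^ m + h x))) := by
    refine tendsto_integral_of_dominated_convergence (fun x => χ x * T ^ m + h x)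
      (fun j => ?_) ?_ (fun j => ae_of_all _ fun x => ?_) ?_
    · have := H.measurable
      have := (hgc j).measurable
      have := hχ.measurable
      exact Measurable.aestronglyMeasurable (by fun_prop)
    · exact ((hχ.mul_const _).integrable_of_hasCompactSupport hχc.mul_right).integrableOn.add
        H.integrable
    · have h1 := bounded_on_Icc_of_rpow hm hδ _ (hgI j x)
      rw [Real.norm_eq_abs, abs_mul, abs_of_nonneg (hχ0 x)]
      have h2 : |-(g j x) ^ m + h x| ≤ T ^ m + h x :=
        (abs_add_le _ _).trans (add_le_add h1 (abs_of_nonneg (H.h_nonneg x)).le)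
      have h3 := mul_le_mul_of_nonneg_left h2 (hχ0 x)
      have h4 := mul_le_of_le_one_left (H.h_nonneg x) (hχ1 x)
      linarith
    · filter_upwards [ae_restrict_of_ae hg.1] with x hx
      by_cases hxs : x ∈ tsupport χ
      · have := (hx hxs).rpow_const (p := m) (Or.inr hm.le)
        exact (this.neg.add_const _).const_mul _
      · simp [image_eq_zero_of_notMem_tsupport hxs]
  have l2 : Tendsto (fun j => ∫ x, χ x * (slope m (g j x) + w x) ∂(μ : Measure X)) atTop
      (𝓝 (∫ x, χ x * (slope m (a x) + w x) ∂(μ : Measure X))) := by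
    refine tendsto_integral_of_dominated_convergence (fun x => χ x * (B + w x))
      (fun j => ?_) ?_ (fun j => ae_of_all _ fun x => ?_) ?_
    · have := H.continuous.measurable
      have := (measurable_slope m).comp (hgc j).measurable
      have := hχ.measurable
      exact Measurable.aestronglyMeasurable (by fun_prop)
    · exact (hχ.mul (continuous_const.add H.continuous)).integrable_of_hasCompactSupport
        hχc.mul_right
    · have h1 := hB _ (hgI j x)
      rw [Real.norm_eq_abs, abs_mul, abs_of_nonneg (hχ0 x)]
      exact mul_le_mul_of_nonneg_left ((abs_add_le _ _).trans
        (add_le_add h1 (abs_of_nonneg (H.nonneg x)).le)) (hχ0 x)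
    · filter_upwards [hg.2] with x hx
      have hpos : 0 < a x := hδ.trans_le (haI x).1
      have := ((continuousOn_slope m).continuousAt (Ioi_mem_nhds hpos)).tendsto.comp hx
      exact (this.add_const _).const_mul _
  refine le_of_tendsto (l1.add l2) (Eventually.of_forall fun j => ?_)
  exact tangentFunctional_le_of_tendsto_of_continuous hm hK H hχ hχc hχ0 hχ1 hμs hsupp hL0 hL
    (hgc j) hδ (hgI j)

end LowerSemicontinuity

/-! ### Recovering the weighted entropy from its tangents. -/

section LowerSemicontinuity

variable {X : Type*} [NormedAddCommGroup X] [MeasureSpace X]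
variable [BorelSpace X] [ProperSpace X] [IsFiniteMeasureOnCompacts (volume : Measure X)]
variable {m : ℝ} {K : Set X} {w h : X → ℝ}

/-- The values of the tangent functional on truncations of the density of a measure. -/
theorem tangentFunctional_clamp (hm : 0 < m) (hK : MeasurableSet K)
    (H : IsWeight m K w h) {χ : X → ℝ} (hχ : Continuous χ) (hχc : HasCompactSupport χ)
    (hχ0 : ∀ x, 0 ≤ χ x) (hχ1 : ∀ x, χ x ≤ 1) {ρ : Measure X} [IsFiniteMeasure ρ]
    (hρ : ρ Kᶜ = 0) {L : ℝ}
    (hL : ∀ (a : X → ℝ) (δ T : ℝ), Measurable a → 0 < δ → (∀ x, a x ∈ Set.Icc δ T) →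
      tangentFunctional m K w h χ a ρ ≤ L) {T : ℝ} (hT : 1 ≤ T) :
    IntegrableOn (fun x => χ x * ((-(clamp T (dens ρ x)) ^ m +
        slope m (clamp T (dens ρ x)) * dens ρ x) + w x * dens ρ x + h x)) K ∧
    (∫ x in K, χ x * ((-(clamp T (dens ρ x)) ^ m +
        slope m (clamp T (dens ρ x)) * dens ρ x) + w x * dens ρ x + h x)) +
      (slope m T * ∫ x, χ x ∂ρ.singularPart volume) +
      ∫ x, χ x * w x ∂ρ.singularPart volume ≤ L := by
  classical
  set σ := ρ.singularPart volume with hσ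
  have hms := ρ.mutuallySingular_singularPart volume
  set N := hms.nullSet with hN
  have hNm : MeasurableSet N := hms.measurableSet_nullSet
  have hσN : ∀ᵐ x ∂σ, x ∉ N := by
    rw [ae_iff]
    simp only [not_not, Set.ofPred_mem_eq]
    exact hms.measure_nullSet
  have hvN : ∀ᵐ x ∂(volume.restrict K), x ∈ N := by
    refine ae_restrict_of_ae ?_
    rw [ae_iff]; exact hms.measure_compl_nullSet
  -- On `N`, which has full volume and no singular mass, take the truncated density; elsewhere take
  -- the largest admissible value `T`, to test the singular part with the slope at `T`.
  let a : X → ℝ := N.piecewise (fun x => clamp T (dens ρ x)) (fun _ => T)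
  have ha : Measurable a := Measurable.piecewise hNm
    ((continuous_clamp T).measurable.comp (measurable_dens ρ)) measurable_const
  have hδ : 0 < 1 / T := by positivity
  have haI : ∀ x, a x ∈ Set.Icc (1 / T) T := by
    intro x
    by_cases hx : x ∈ N
    · simp only [a, Set.piecewise_eq_of_mem _ _ _ hx]; exact clamp_mem hT _
    · simp only [a, Set.piecewise_eq_of_notMem _ _ _ hx]
      exact ⟨(clamp_mem hT 0).1.trans (clamp_mem hT 0).2, le_rfl⟩
  obtain ⟨B, hB⟩ := bounded_on_Icc_of_slope (m := m) (T := T) hδ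
  have hp : Integrable (fun x => χ x * (slope m (a x) + w x)) ρ := by
    simp only [mul_add]
    exact (integrable_mul_of_cutoff hχ hχc ((measurable_slope m).comp ha)
      (fun x => hB _ (haI x)) ρ).add
      ((hχ.mul H.continuous).integrable_of_hasCompactSupport hχc.mul_right)
  have hq : IntegrableOn (fun x => χ x * (-(a x) ^ m + h x)) K := by
    simp only [mul_add]
    refine (integrable_mul_of_cutoff hχ hχc (by fun_prop)
      (fun x => bounded_on_Icc_of_rpow hm hδ _ (haI x)) _).add ?_
    exact H.integrable.bdd_mul (c := 1) hχ.aestronglyMeasurable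
      (ae_of_all _ fun x => by rw [Real.norm_of_nonneg (hχ0 x)]; exact hχ1 x)
  have key := hL a _ T ha hδ haI
  have hpd := (integrable_mul_dens hK hρ hp).1
  rw [tangentFunctional, integral_eq_add_dens hK hρ hp, ← add_assoc,
    ← integral_add hq hpd] at key
  have e1 : (fun x => χ x * (-(a x) ^ m + h x) + χ x * (slope m (a x) + w x) * dens ρ x)
      =ᵐ[volume.restrict K] fun x => χ x * ((-(clamp T (dens ρ x)) ^ m +
        slope m (clamp T (dens ρ x)) * dens ρ x) + w x * dens ρ x + h x) := by
    filter_upwards [hvN] with x hx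
    simp only [a, Set.piecewise_eq_of_mem _ _ _ hx]
    ring
  have e2 : (fun x => χ x * (slope m (a x) + w x)) =ᵐ[σ]
      fun x => slope m T * χ x + χ x * w x := by
    filter_upwards [hσN] with x hx
    simp only [a, Set.piecewise_eq_of_notMem _ _ _ hx]
    ring
  have hw : Integrable (fun x => χ x * w x) σ :=
    (hχ.mul H.continuous).integrable_of_hasCompactSupport hχc.mul_right
  refine ⟨(hq.add hpd).congr e1, ?_⟩
  rw [integral_congr_ae e1, integral_congr_ae e2, integral_add
    ((hχ.integrable_of_hasCompactSupport hχc).const_mul _) hw,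
    integral_const_mul] at key
  linarith

/-- Let the truncation level `T` tend to infinity. The singular term is the slope at `T` times the
singular mass seen by `χ`: for `m ≥ 1` its boundedness kills that mass, for `m < 1` it tends to
zero. Fatou's lemma handles the density term. -/
theorem weightedEntropy_cutoff_le (hm : 0 < m) (hK : MeasurableSet K)
    (H : IsWeight m K w h) {χ : X → ℝ} (hχ : Continuous χ) (hχc : HasCompactSupport χ)
    (hχ0 : ∀ x, 0 ≤ χ x) (hχ1 : ∀ x, χ x ≤ 1) {ρ : Measure X} [IsFiniteMeasure ρ]
    (hρ : ρ Kᶜ = 0) {L : ℝ}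
    (hL : ∀ (a : X → ℝ) (δ T : ℝ), Measurable a → 0 < δ → (∀ x, a x ∈ Set.Icc δ T) →
      tangentFunctional m K w h χ a ρ ≤ L) :
    (1 ≤ m → ∫ x, χ x ∂ρ.singularPart volume = 0) ∧
    (∫⁻ x in K, ENNReal.ofReal
        (χ x * (energyDensity m (dens ρ x) + w x * dens ρ x + h x))) +
      ∫⁻ x, ENNReal.ofReal (χ x * w x) ∂ρ.singularPart volume ≤ ENNReal.ofReal L := by
  set σ := ρ.singularPart volume with hσ
  set s := ∫ x, χ x ∂σ with hs
  set W := ∫ x, χ x * w x ∂σ with hW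
  have hs0 : 0 ≤ s := integral_nonneg hχ0
  have hW0 : 0 ≤ W := integral_nonneg fun x => mul_nonneg (hχ0 x) (H.nonneg x)
  let F : ℝ → X → ℝ := fun T x => χ x * ((-(clamp T (dens ρ x)) ^ m +
        slope m (clamp T (dens ρ x)) * dens ρ x) + w x * dens ρ x + h x)
  -- Minus the tangent at `1`, times `χ`: an integrable function independent of `T` that makes all
  -- integrands nonnegative, as Fatou's lemma requires; it is subtracted again at the end.
  let p : X → ℝ := fun x => χ x * (1 - slope m 1 * dens ρ x)
  let G : X → ℝ := fun x => energyDensity m (dens ρ x) + w x * dens ρ x + h x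
  have hGm : Measurable G :=
    ((((measurable_energyDensity m).comp (measurable_dens ρ)).add
      (H.continuous.measurable.mul (measurable_dens ρ))).add H.measurable)
  have hd := measurable_dens ρ
  have hχm := hχ.measurable
  have hpint : IntegrableOn p K := by
    simp only [p, mul_sub, mul_one]
    refine (hχ.integrable_of_hasCompactSupport hχc).integrableOn.sub ?_
    exact (integrable_dens.const_mul _).bdd_mul (c := 1) hχ.aestronglyMeasurable
      (ae_of_all _ fun x => by rw [Real.norm_of_nonneg (hχ0 x)]; exact hχ1 x)
  set P := ∫ x in K, p x with hP
  have hF0 : ∀ T, 1 ≤ T → ∀ x ∈ K, 0 ≤ F T x + p x := by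
    intro T hT x hx
    have h1 := tangent_one_le (t := dens ρ x) hm hT
    have h2 : 0 ≤ w x * dens ρ x := mul_nonneg (H.nonneg x) (dens_nonneg ρ x)
    have h3 := H.h_nonneg x
    simp only [F, p, ← mul_add]
    exact mul_nonneg (hχ0 x) (by linarith)
  have hFle : ∀ T, 1 ≤ T → IntegrableOn (fun x => F T x + p x) K ∧
      ∫ x in K, (F T x + p x) ≤ L + P - W - slope m T * s := by
    intro T hT
    obtain ⟨h1, h2⟩ := tangentFunctional_clamp hm hK H hχ hχc hχ0 hχ1 hρ hL hT
    refine ⟨h1.add hpint, ?_⟩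
    rw [integral_add h1 hpint]
    linarith
  have hbound : ∀ T, 1 ≤ T → slope m T * s ≤ L + P - W := by
    intro T hT
    have h1 := (hFle T hT).2
    have h2 : 0 ≤ ∫ x in K, (F T x + p x) := setIntegral_nonneg hK (hF0 T hT)
    linarith
  have hs1 : 1 ≤ m → s = 0 := by
    intro h1
    by_contra hne
    have hpos : 0 < s := lt_of_le_of_ne hs0 (Ne.symm hne)
    obtain ⟨T, hT, hT1⟩ := (((tendsto_slope_of_one_le h1).atTop_mul_const hpos).eventually_gt_atTop
      (L + P - W)).and (eventually_ge_atTop 1) |>.exists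
    exact absurd (hbound T hT1) (not_le.2 hT)
  have hslope : Tendsto (fun T => slope m T * s) atTop (𝓝 0) := by
    by_cases h1 : 1 ≤ m
    · simp [hs1 h1]
    · simpa using (tendsto_slope_of_lt_one (not_le.1 h1)).mul_const s
  refine ⟨hs1, ?_⟩
  have hu : Tendsto (fun j : ℕ => L + P - W - slope m ((j : ℝ) + 1) * s) atTop
      (𝓝 (L + P - W)) := by
    have := (hslope.comp (tendsto_atTop_add_const_right atTop (1 : ℝ)
      tendsto_natCast_atTop_atTop)).const_sub (L + P - W)
    simpa using this
  have hLPW : 0 ≤ L + P - W := ge_of_tendsto' hu fun j => by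
    have hT : (1 : ℝ) ≤ (j : ℝ) + 1 := by simp
    have := hbound _ hT
    linarith
  have hlimF : ∀ x, Tendsto (fun j : ℕ => F ((j : ℝ) + 1) x + p x) atTop
      (𝓝 (χ x * G x + p x)) := by
    intro x
    have h1 := (tendsto_tangent_clamp hm (dens_nonneg ρ x)).comp
      (tendsto_atTop_add_const_right atTop (1 : ℝ) tendsto_natCast_atTop_atTop)
    exact (((h1.add_const _).add_const _).const_mul (χ x)).add_const _
  have hmeasF : ∀ j : ℕ, Measurable fun x => F ((j : ℝ) + 1) x + p x := by
    intro j
    have h1 : Measurable fun x => clamp ((j : ℝ) + 1) (dens ρ x) :=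
      (continuous_clamp _).measurable.comp hd
    have h2 : Measurable fun x => slope m (clamp ((j : ℝ) + 1) (dens ρ x)) :=
      (measurable_slope m).comp h1
    have h3 := H.continuous.measurable
    have h4 := H.measurable
    simp only [F, p]
    fun_prop
  have hfatou : ∫⁻ x in K, ENNReal.ofReal (χ x * G x + p x) ≤ ENNReal.ofReal (L + P - W) := by
    calc ∫⁻ x in K, ENNReal.ofReal (χ x * G x + p x)
        = ∫⁻ x in K, liminf (fun j : ℕ => ENNReal.ofReal (F ((j : ℝ) + 1) x + p x)) atTop := by
          refine lintegral_congr fun x => ?_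
          exact ((ENNReal.continuous_ofReal.tendsto _).comp (hlimF x)).liminf_eq.symm
      _ ≤ liminf (fun j : ℕ => ∫⁻ x in K, ENNReal.ofReal (F ((j : ℝ) + 1) x + p x)) atTop :=
          lintegral_liminf_le fun j => (hmeasF j).ennreal_ofReal
      _ ≤ liminf (fun j : ℕ => ENNReal.ofReal (L + P - W - slope m ((j : ℝ) + 1) * s)) atTop := by
          refine liminf_le_liminf (Eventually.of_forall fun j => ?_)
          have hT : (1 : ℝ) ≤ (j : ℝ) + 1 := by simp
          rw [← ofReal_integral_eq_lintegral_ofReal (hFle _ hT).1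
            (by filter_upwards [ae_restrict_mem hK] with x hx using hF0 _ hT x hx)]
          exact ENNReal.ofReal_le_ofReal (hFle _ hT).2
      _ = ENNReal.ofReal (L + P - W) :=
          ((ENNReal.continuous_ofReal.tendsto _).comp hu).liminf_eq
  have hw : Integrable (fun x => χ x * w x) σ :=
    (hχ.mul H.continuous).integrable_of_hasCompactSupport hχc.mul_right
  have hG0 : 0 ≤ᵐ[volume.restrict K] fun x => χ x * G x := by
    filter_upwards [ae_restrict_mem hK] with x hx
    exact mul_nonneg (hχ0 x) (H.le x hx _ (dens_nonneg ρ x))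
  have hGp0 : 0 ≤ᵐ[volume.restrict K] fun x => χ x * G x + p x := by
    filter_upwards [ae_restrict_mem hK] with x hx
    exact ge_of_tendsto' (hlimF x) fun j => hF0 _ (by simp) x hx
  have hGpm : Measurable fun x => χ x * G x + p x := by
    simp only [p]; fun_prop
  have hGpint : IntegrableOn (fun x => χ x * G x + p x) K :=
    (lintegral_ofReal_ne_top_iff_integrable hGpm.aestronglyMeasurable hGp0).1
      (ne_top_of_le_ne_top ENNReal.ofReal_ne_top hfatou)
  have hGint : IntegrableOn (fun x => χ x * G x) K := by
    have := hGpint.sub hpint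
    simpa [Pi.sub_def] using this
  rw [← ofReal_integral_eq_lintegral_ofReal hGpint hGp0,
    ENNReal.ofReal_le_ofReal_iff hLPW, integral_add hGint hpint] at hfatou
  rw [← ofReal_integral_eq_lintegral_ofReal hGint hG0,
    ← ofReal_integral_eq_lintegral_ofReal hw
      (ae_of_all _ fun x => mul_nonneg (hχ0 x) (H.nonneg x)),
    ← ENNReal.ofReal_add (integral_nonneg_of_ae hG0) hW0]
  exact ENNReal.ofReal_le_ofReal (by linarith)

theorem tendsto_lintegral_cutoff (ν : Measure X) {g : X → ℝ} (hg : Measurable g)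
    (h0 : ∀ᵐ x ∂ν, 0 ≤ g x) :
    Tendsto (fun n : ℕ => ∫⁻ x, ENNReal.ofReal (cutoff n x * g x) ∂ν) atTop
      (𝓝 (∫⁻ x, ENNReal.ofReal (g x) ∂ν)) := by
  refine lintegral_tendsto_of_tendsto_of_monotone (fun n => ?_) ?_ (ae_of_all _ fun x => ?_)
  · exact (((continuous_cutoff n).measurable.mul hg).ennreal_ofReal).aemeasurable
  · filter_upwards [h0] with x hx a b hab
    exact ENNReal.ofReal_le_ofReal (mul_le_mul_of_nonneg_right (cutoff_mono x hab) hx)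
  · refine (ENNReal.continuous_ofReal.tendsto _).comp ?_
    simpa using (tendsto_cutoff x).mul_const (g x)

/-- Lower semicontinuity of the weighted entropy under narrow convergence. -/
theorem weightedEntropy_le_of_tendsto (hm : 0 < m) (hK : MeasurableSet K)
    (H : IsWeight m K w h) {μs : ℕ → ProbabilityMeasure X}
    {μ : ProbabilityMeasure X} (hμs : Tendsto μs atTop (𝓝 μ))
    (hsupp : ∀ n, (μs n : Measure X) Kᶜ = 0) (hμ : (μ : Measure X) Kᶜ = 0) {L : ℝ} (hL0 : 0 ≤ L)
    (hL : ∀ᶠ n in atTop, weightedEntropy m K w h (μs n) ≤ ENNReal.ofReal L) :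
    weightedEntropy m K w h (μ : Measure X) ≤ ENNReal.ofReal L := by
  have key := fun n : ℕ => weightedEntropy_cutoff_le (χ := cutoff n) hm hK H (continuous_cutoff n)
    (hasCompactSupport_cutoff n) (cutoff_nonneg n) (cutoff_le_one n) hμ (L := L)
    (fun a δ T ha hδ haI => tangentFunctional_le_of_tendsto hm hK H (continuous_cutoff n)
      (hasCompactSupport_cutoff n) (cutoff_nonneg n) (cutoff_le_one n) hμs hsupp hL0 hL ha hδ haI)
  set σ := (μ : Measure X).singularPart volume with hσ
  have hac : 1 ≤ m → (μ : Measure X) ≪ volume := by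
    intro h1
    rw [← Measure.singularPart_eq_zero]
    have h2 := tendsto_lintegral_cutoff σ (g := fun _ => 1) measurable_const (ae_of_all _ fun _ =>
      zero_le_one)
    have h3 : ∀ n : ℕ, ∫⁻ x, ENNReal.ofReal (cutoff n x * 1) ∂σ = 0 := by
      intro n
      simp only [mul_one]
      rw [← ofReal_integral_eq_lintegral_ofReal
        ((continuous_cutoff n).integrable_of_hasCompactSupport (hasCompactSupport_cutoff n))
        (ae_of_all _ (cutoff_nonneg n)), (key n).1 h1, ENNReal.ofReal_zero]
    have h4 := tendsto_nhds_unique h2 (by simp only [h3]; exact tendsto_const_nhds)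
    simpa using h4
  rw [weightedEntropy, if_neg (fun hc => hc.2 (hac hc.1))]
  have t1 := tendsto_lintegral_cutoff (volume.restrict K)
    (g := fun x => energyDensity m (dens μ x) + w x * dens μ x + h x)
    ((((measurable_energyDensity m).comp (measurable_dens _)).add
      (H.continuous.measurable.mul (measurable_dens _))).add H.measurable)
    (by filter_upwards [ae_restrict_mem hK] with x hx using H.le x hx _ (dens_nonneg _ x))
  have t2 := tendsto_lintegral_cutoff σ (g := w) H.continuous.measurable (ae_of_all _ H.nonneg)
  exact le_of_tendsto' (t1.add t2) fun n => (key n).2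

end LowerSemicontinuity

/-! ### The entropy as a real integral, and its relation to the weighted entropy. -/

section EntropyFormula

variable {X : Type*} [NormedAddCommGroup X] [MeasureSpace X]
variable [BorelSpace X] [ProperSpace X] [IsFiniteMeasureOnCompacts (volume : Measure X)]
variable {m : ℝ} {K : Set X} {w h : X → ℝ}

theorem coe_ennreal_eq_coe_toReal {x : ℝ≥0∞} (hx : x ≠ ∞) : (x : EReal) = ((x.toReal : ℝ) : EReal) := by
  lift x to NNReal using hx
  rfl

theorem dens_eq_zero_of_compl {Ω : Set X} {ρ : Measure X} [IsFiniteMeasure ρ] (hρ : ρ Ωᶜ = 0) :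
    ∀ᵐ x ∂volume.restrict Ωᶜ, dens ρ x = 0 := by
  have h1 : ∫⁻ x in Ωᶜ, ρ.rnDeriv volume x = 0 :=
    le_antisymm ((Measure.setLIntegral_rnDeriv_le _).trans hρ.le) zero_le
  rw [lintegral_eq_zero_iff (Measure.measurable_rnDeriv _ _)] at h1
  filter_upwards [h1] with x hx
  simp [dens, hx]

/-- Null measurability is the right assumption here: a convex set need not be Borel, but its
boundary is null. -/
theorem setLIntegral_eq_of_compl {Ω : Set X} (hΩ : NullMeasurableSet Ω volume) {g : X → ℝ≥0∞}
    (hg : ∀ᵐ x ∂volume.restrict Ωᶜ, g x = 0) : ∫⁻ x in Ω, g x = ∫⁻ x, g x := by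
  obtain ⟨t, ht, hte⟩ := hΩ
  have h1 : (volume : Measure X).restrict Ω = volume.restrict t := Measure.restrict_congr_set hte
  have h2 : (volume : Measure X).restrict Ωᶜ = volume.restrict tᶜ :=
    Measure.restrict_congr_set hte.compl
  rw [h2] at hg
  rw [h1, ← lintegral_add_compl (μ := volume) g ht, lintegral_congr_ae hg]
  simp

theorem extIntegral_energyDensity_eq (hm : 0 < m) {Ω : Set X} (hΩ : NullMeasurableSet Ω volume)
    {ρ : Measure X} [IsFiniteMeasure ρ] (hρ : ρ Ωᶜ = 0) :
    extIntegral (volume.restrict Ω) (fun x => energyDensity m (ρ.rnDeriv volume x).toReal) =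
      extIntegral volume (fun x => energyDensity m (ρ.rnDeriv volume x).toReal) := by
  have h0 := dens_eq_zero_of_compl hρ
  rw [extIntegral, extIntegral, setLIntegral_eq_of_compl hΩ, setLIntegral_eq_of_compl hΩ]
  · filter_upwards [h0] with x hx
    rw [dens] at hx
    simp [hx, energyDensity_zero hm]
  · filter_upwards [h0] with x hx
    rw [dens] at hx
    simp [hx, energyDensity_zero hm]

/-- The entropy does not depend on the set on which a measure is considered. -/
theorem entropy_congr_set (hm : 0 < m) {Ω : Set X} (hΩ : NullMeasurableSet Ω volume)
    (hK : NullMeasurableSet K volume) {ρ : Measure X} [IsFiniteMeasure ρ] (hρ : ρ Ωᶜ = 0)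
    (hρK : ρ Kᶜ = 0) : entropy m Ω ρ = entropy m K ρ := by
  rw [entropy, entropy, extIntegral_energyDensity_eq hm hΩ hρ, extIntegral_energyDensity_eq hm hK hρK]

theorem entropy_eq_integral {ρ : Measure X} (hac : 1 ≤ m → ρ ≪ volume)
    (hint : IntegrableOn (fun x => energyDensity m (dens ρ x)) K) :
    entropy m K ρ = ((∫ x in K, energyDensity m (dens ρ x) : ℝ) : EReal) := by
  rw [entropy, if_neg (fun hc => hc.2 (hac hc.1)), extIntegral,
    integral_eq_lintegral_pos_part_sub_lintegral_neg_part hint,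
    coe_ennreal_eq_coe_toReal, coe_ennreal_eq_coe_toReal]
  · rfl
  · exact hint.neg.lintegral_lt_top.ne
  · exact hint.lintegral_lt_top.ne

theorem measurable_energyDensity_dens (m : ℝ) (ρ : Measure X) :
    Measurable fun x => energyDensity m (dens ρ x) :=
  (measurable_energyDensity m).comp (measurable_dens ρ)

/-- The negative part of `f_m` is at most `w` times the density plus `h`, both integrable. This
rules out `∞ - ∞` in the definition of the entropy. -/
theorem IsWeight.lintegral_neg_lt_top (hK : MeasurableSet K) (H : IsWeight m K w h) {ρ : Measure X}
    [IsFiniteMeasure ρ] (hρ : ρ Kᶜ = 0) (hmom : moment ρ < ∞) :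
    ∫⁻ x in K, ENNReal.ofReal (-energyDensity m (dens ρ x)) < ∞ := by
  have h1 := (integrable_mul_dens hK hρ (H.integrable_of_moment hmom)).1
  refine lt_of_le_of_lt ?_ (h1.add H.integrable).lintegral_lt_top
  refine setLIntegral_mono_ae' hK (ae_of_all _ fun x hx => ENNReal.ofReal_le_ofReal ?_)
  have := H.le x hx _ (dens_nonneg ρ x)
  simp only [Pi.add_apply]
  linarith

theorem IsWeight.integrable_energyDensity (hK : MeasurableSet K) (H : IsWeight m K w h)
    {ρ : Measure X} [IsFiniteMeasure ρ] (hρ : ρ Kᶜ = 0) (hmom : moment ρ < ∞)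
    (hfin : entropy m K ρ < ⊤) :
    (1 ≤ m → ρ ≪ volume) ∧ IntegrableOn (fun x => energyDensity m (dens ρ x)) K := by
  by_cases hc : 1 ≤ m ∧ ¬ ρ ≪ volume
  · rw [entropy, if_pos hc] at hfin
    exact absurd hfin (lt_irrefl _)
  refine ⟨fun h1 => by by_contra h2; exact hc ⟨h1, h2⟩, ?_⟩
  rw [entropy, if_neg hc, extIntegral] at hfin
  have hneg := H.lintegral_neg_lt_top hK hρ hmom
  have hpos : ∫⁻ x in K, ENNReal.ofReal (energyDensity m (dens ρ x)) ≠ ∞ := by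
    intro htop
    unfold dens at htop hneg
    rw [htop, coe_ennreal_eq_coe_toReal hneg.ne] at hfin
    simp at hfin
  refine ⟨(measurable_energyDensity_dens m ρ).aestronglyMeasurable, ?_⟩
  rw [hasFiniteIntegral_iff_enorm]
  have : ∀ x, ‖energyDensity m (dens ρ x)‖ₑ =
      ENNReal.ofReal (energyDensity m (dens ρ x)) + ENNReal.ofReal (-energyDensity m (dens ρ x)) := by
    intro x
    rw [Real.enorm_eq_ofReal_abs]
    rcases le_total 0 (energyDensity m (dens ρ x)) with h0 | h0
    · rw [abs_of_nonneg h0, ENNReal.ofReal_of_nonpos (neg_nonpos.2 h0), add_zero]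
    · rw [abs_of_nonpos h0, ENNReal.ofReal_of_nonpos h0, zero_add]
  simp only [this]
  rw [lintegral_add_left (measurable_energyDensity_dens m ρ).ennreal_ofReal]
  exact ENNReal.add_lt_top.2 ⟨hpos.lt_top, hneg⟩

/-- The weighted entropy is the entropy plus the integrals of the weights. -/
theorem IsWeight.weightedEntropy_eq (hK : MeasurableSet K) (H : IsWeight m K w h)
    {ρ : Measure X} [IsFiniteMeasure ρ] (hρ : ρ Kᶜ = 0) (hmom : moment ρ < ∞)
    (hac : 1 ≤ m → ρ ≪ volume) (hint : IntegrableOn (fun x => energyDensity m (dens ρ x)) K) :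
    weightedEntropy m K w h ρ = ENNReal.ofReal
      ((∫ x in K, energyDensity m (dens ρ x)) + (∫ x, w x ∂ρ) + ∫ x in K, h x) := by
  have hw := H.integrable_of_moment hmom
  obtain ⟨h1, h2⟩ := integrable_mul_dens hK hρ hw
  have h0 : 0 ≤ᵐ[volume.restrict K]
      fun x => energyDensity m (dens ρ x) + w x * dens ρ x + h x := by
    filter_upwards [ae_restrict_mem hK] with x hx using H.le x hx _ (dens_nonneg ρ x)
  have h3 : IntegrableOn (fun x => energyDensity m (dens ρ x) + w x * dens ρ x + h x) K :=
    (hint.add h1).add H.integrable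
  rw [weightedEntropy, if_neg (fun hc => hc.2 (hac hc.1)),
    ← ofReal_integral_eq_lintegral_ofReal h3 h0,
    ← ofReal_integral_eq_lintegral_ofReal h2 (ae_of_all _ H.nonneg),
    ← ENNReal.ofReal_add (integral_nonneg_of_ae h0) (integral_nonneg H.nonneg),
    integral_eq_add_dens hK hρ hw]
  congr 1
  have e := integral_add (hint.add h1) H.integrable
  have e' := integral_add hint h1
  simp only [Pi.add_apply] at e e' ⊢
  rw [e, e']
  ring

theorem IsWeight.add_nonneg (hK : MeasurableSet K) (H : IsWeight m K w h)
    {ρ : Measure X} [IsFiniteMeasure ρ] (hρ : ρ Kᶜ = 0) (hmom : moment ρ < ∞)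
    (hint : IntegrableOn (fun x => energyDensity m (dens ρ x)) K) :
    0 ≤ (∫ x in K, energyDensity m (dens ρ x)) + (∫ x, w x ∂ρ) + ∫ x in K, h x := by
  have hw := H.integrable_of_moment hmom
  obtain ⟨h1, h2⟩ := integrable_mul_dens hK hρ hw
  have h0 : 0 ≤ ∫ x in K, (energyDensity m (dens ρ x) + w x * dens ρ x + h x) :=
    setIntegral_nonneg hK fun x hx => H.le x hx _ (dens_nonneg ρ x)
  have e := integral_add (hint.add h1) H.integrable
  have e' := integral_add hint h1
  simp only [Pi.add_apply] at e e'
  rw [e, e'] at h0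
  rw [integral_eq_add_dens hK hρ hw]
  have : 0 ≤ ∫ x, w x ∂ρ.singularPart volume := integral_nonneg H.nonneg
  linarith

/-- Finiteness of the weighted entropy implies that of the entropy. -/
theorem IsWeight.integrable_of_weightedEntropy (hK : MeasurableSet K) (H : IsWeight m K w h)
    {ρ : Measure X} [IsFiniteMeasure ρ] (hρ : ρ Kᶜ = 0) (hmom : moment ρ < ∞)
    (hfin : weightedEntropy m K w h ρ ≠ ∞) :
    (1 ≤ m → ρ ≪ volume) ∧ IntegrableOn (fun x => energyDensity m (dens ρ x)) K := by
  by_cases hc : 1 ≤ m ∧ ¬ ρ ≪ volume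
  · rw [weightedEntropy, if_pos hc] at hfin
    exact absurd rfl hfin
  refine ⟨fun h1 => by by_contra h2; exact hc ⟨h1, h2⟩, ?_⟩
  rw [weightedEntropy, if_neg hc] at hfin
  have h1 := (integrable_mul_dens hK hρ (H.integrable_of_moment hmom)).1
  have h0 : 0 ≤ᵐ[volume.restrict K]
      fun x => energyDensity m (dens ρ x) + w x * dens ρ x + h x := by
    filter_upwards [ae_restrict_mem hK] with x hx using H.le x hx _ (dens_nonneg ρ x)
  have hmeas : Measurable fun x => energyDensity m (dens ρ x) + w x * dens ρ x + h x :=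
    (((measurable_energyDensity_dens m ρ).add
      (H.continuous.measurable.mul (measurable_dens ρ))).add H.measurable)
  have h2 : IntegrableOn (fun x => energyDensity m (dens ρ x) + w x * dens ρ x + h x) K :=
    (lintegral_ofReal_ne_top_iff_integrable hmeas.aestronglyMeasurable h0).1
      (ne_top_of_le_ne_top hfin le_self_add)
  refine ((h2.sub h1).sub H.integrable).congr (ae_of_all _ fun x => ?_)
  simp only [Pi.sub_apply]
  ring

end EntropyFormula

/-! ### Integrals of unbounded continuous functions under narrow convergence. -/

section NarrowConvergence

variable {Y : Type*} [NormedAddCommGroup Y] [MeasurableSpace Y] [BorelSpace Y] [ProperSpace Y]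

/-- Integrals of nonnegative continuous functions are lower semicontinuous. -/
theorem lintegral_le_liminf_of_tendsto {γs : ℕ → ProbabilityMeasure Y} {γ : ProbabilityMeasure Y}
    (h : Tendsto γs atTop (𝓝 γ)) {Q : Y → ℝ} (hQ : Continuous Q) (h0 : ∀ y, 0 ≤ Q y) :
    ∫⁻ y, ENNReal.ofReal (Q y) ∂(γ : Measure Y) ≤
      liminf (fun n => ∫⁻ y, ENNReal.ofReal (Q y) ∂(γs n : Measure Y)) atTop := by
  refine lintegral_le_liminf_lintegral_of_forall_isOpen_measure_le_liminf_measure hQ h0 ?_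
  intro G hG
  exact ProbabilityMeasure.le_liminf_measure_open_of_tendsto h hG

theorem integrable_cutoff_mul {Q : Y → ℝ} (hQ : Continuous Q) (n : ℕ) (ν : Measure Y)
    [IsFiniteMeasure ν] : Integrable (fun y => cutoff n y * Q y) ν := by
  exact ((continuous_cutoff n).mul hQ).integrable_of_hasCompactSupport
    (hasCompactSupport_cutoff n).mul_right

theorem tendsto_integral_cutoff {γs : ℕ → ProbabilityMeasure Y} {γ : ProbabilityMeasure Y}
    (h : Tendsto γs atTop (𝓝 γ)) {Q : Y → ℝ} (hQ : Continuous Q) (n : ℕ) :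
    Tendsto (fun j => ∫ y, cutoff n y * Q y ∂(γs j : Measure Y)) atTop
      (𝓝 (∫ y, cutoff n y * Q y ∂(γ : Measure Y))) := by
  have hc := (continuous_cutoff n).mul hQ
  obtain ⟨C, hC⟩ := (hasCompactSupport_cutoff n).mul_right.exists_bound_of_continuous hc
  exact ProbabilityMeasure.tendsto_iff_forall_integral_tendsto.1 h
    (BoundedContinuousFunction.ofNormedAddCommGroup (fun y => cutoff n y * Q y) hc C hC)

theorem tendsto_integral_cutoff_atTop {ν : Measure Y} {Q : Y → ℝ} (hQ : Integrable Q ν) :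
    Tendsto (fun n => ∫ y, cutoff n y * Q y ∂ν) atTop (𝓝 (∫ y, Q y ∂ν)) := by
  refine tendsto_integral_of_dominated_convergence (fun y => ‖Q y‖) (fun n => ?_) hQ.norm
    (fun n => ae_of_all _ fun y => ?_) (ae_of_all _ fun y => ?_)
  · exact (continuous_cutoff n).aestronglyMeasurable.mul hQ.1
  · rw [norm_mul, Real.norm_of_nonneg (cutoff_nonneg n y)]
    exact mul_le_of_le_one_left (norm_nonneg _) (cutoff_le_one n y)
  · simpa using (tendsto_cutoff y).mul_const (Q y)

theorem cutoff_eq_one {n : ℕ} {y : Y} (hy : ‖y‖ ≤ n) : cutoff n y = 1 := by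
  rw [cutoff, min_eq_left (by linarith), max_eq_right zero_le_one]

theorem cutoff_eq_zero {n : ℕ} {y : Y} (hy : (n : ℝ) + 1 ≤ ‖y‖) : cutoff n y = 0 :=
  max_eq_left ((min_le_right _ _).trans (by linarith))

/-- Convergence of the integrals implies uniform integrability. -/
theorem exists_tail_le {γs : ℕ → ProbabilityMeasure Y} {γ : ProbabilityMeasure Y}
    (h : Tendsto γs atTop (𝓝 γ)) {Q : Y → ℝ} (hQ : Continuous Q) (h0 : ∀ y, 0 ≤ Q y)
    (hint : ∀ n, Integrable Q (γs n : Measure Y)) (hγ : Integrable Q (γ : Measure Y))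
    (hlim : Tendsto (fun n => ∫ y, Q y ∂(γs n : Measure Y)) atTop
      (𝓝 (∫ y, Q y ∂(γ : Measure Y)))) {ε : ℝ} (hε : 0 < ε) :
    ∃ R : ℝ, (∀ᶠ n in atTop, ∫⁻ y in {y | R ≤ ‖y‖}, ENNReal.ofReal (Q y) ∂(γs n : Measure Y) ≤
      ENNReal.ofReal ε) ∧
      ∫⁻ y in {y | R ≤ ‖y‖}, ENNReal.ofReal (Q y) ∂(γ : Measure Y) ≤ ENNReal.ofReal ε := by
  -- The cutoff at level `N` captures the limit integral up to less than `ε`. Convergence of the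
  -- full and of the cut-off integrals carries this over to `γs n` for large `n`, and beyond radius
  -- `N + 1` the cutoff vanishes.
  have h1 := (tendsto_integral_cutoff_atTop hγ).const_sub (∫ y, Q y ∂(γ : Measure Y))
  rw [sub_self] at h1
  obtain ⟨N, hN⟩ := (h1.eventually_lt_const hε).exists
  have h2 := (hlim.sub (tendsto_integral_cutoff h hQ N)).eventually_lt_const hN
  have key : ∀ ν : ProbabilityMeasure Y, Integrable Q (ν : Measure Y) →
      (∫ y, Q y ∂(ν : Measure Y)) - ∫ y, cutoff N y * Q y ∂(ν : Measure Y) < ε →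
      ∫⁻ y in {y | (N : ℝ) + 1 ≤ ‖y‖}, ENNReal.ofReal (Q y) ∂(ν : Measure Y) ≤
        ENNReal.ofReal ε := by
    intro ν hν hlt
    have hm : MeasurableSet {y : Y | (N : ℝ) + 1 ≤ ‖y‖} :=
      (isClosed_le continuous_const continuous_norm).measurableSet
    have hd : Integrable (fun y => Q y - cutoff N y * Q y) (ν : Measure Y) :=
      hν.sub (integrable_cutoff_mul hQ N _)
    have hd0 : ∀ y, 0 ≤ Q y - cutoff N y * Q y := fun y => by
      have := mul_le_of_le_one_left (h0 y) (cutoff_le_one N y)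
      linarith
    rw [← integral_sub hν (integrable_cutoff_mul hQ N _)] at hlt
    calc ∫⁻ y in {y | (N : ℝ) + 1 ≤ ‖y‖}, ENNReal.ofReal (Q y) ∂(ν : Measure Y)
        = ∫⁻ y in {y | (N : ℝ) + 1 ≤ ‖y‖}, ENNReal.ofReal (Q y - cutoff N y * Q y)
            ∂(ν : Measure Y) := by
          refine setLIntegral_congr_fun hm fun y hy => ?_
          simp only [cutoff_eq_zero hy, zero_mul, sub_zero]
      _ ≤ ∫⁻ y, ENNReal.ofReal (Q y - cutoff N y * Q y) ∂(ν : Measure Y) :=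
          setLIntegral_le_lintegral _ _
      _ = ENNReal.ofReal (∫ y, (Q y - cutoff N y * Q y) ∂(ν : Measure Y)) :=
          (ofReal_integral_eq_lintegral_ofReal hd (ae_of_all _ hd0)).symm
      _ ≤ ENNReal.ofReal ε := ENNReal.ofReal_le_ofReal hlt.le
  refine ⟨N + 1, ?_, key γ hγ hN⟩
  filter_upwards [h2] with n hn using key _ (hint n) hn

/-- Under a bound on the second moments, integrals of functions of smaller growth converge. -/
theorem tendsto_integral_of_growth {γs : ℕ → ProbabilityMeasure Y} {γ : ProbabilityMeasure Y}
    (h : Tendsto γs atTop (𝓝 γ)) {w : Y → ℝ} (hw : Continuous w) (h0 : ∀ y, 0 ≤ w y)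
    (hgrowth : ∀ ε : ℝ, 0 < ε → ∃ C : ℝ, ∀ y, w y ≤ ε * ‖y‖ ^ 2 + C) {M : ℝ}
    (hint : ∀ n, Integrable (fun y => ‖y‖ ^ 2) (γs n : Measure Y))
    (hM : ∀ n, ∫ y, ‖y‖ ^ 2 ∂(γs n : Measure Y) ≤ M)
    (hγint : Integrable (fun y => ‖y‖ ^ 2) (γ : Measure Y))
    (hγM : ∫ y, ‖y‖ ^ 2 ∂(γ : Measure Y) ≤ M) :
    Tendsto (fun n => ∫ y, w y ∂(γs n : Measure Y)) atTop (𝓝 (∫ y, w y ∂(γ : Measure Y))) := by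
  have hM0 : 0 ≤ M := (integral_nonneg fun y => by positivity).trans hγM
  have approx : ∀ ε : ℝ, 0 < ε → ∃ N : ℕ, ∀ ν : ProbabilityMeasure Y,
      Integrable (fun y => ‖y‖ ^ 2) (ν : Measure Y) → ∫ y, ‖y‖ ^ 2 ∂(ν : Measure Y) ≤ M →
      dist (∫ y, w y ∂(ν : Measure Y)) (∫ y, cutoff N y * w y ∂(ν : Measure Y)) ≤ ε := by
    intro ε hε
    set δ := ε / (2 * (M + 1)) with hδ
    have hδ0 : 0 < δ := by positivity
    obtain ⟨C, hC⟩ := hgrowth δ hδ0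
    -- Beyond radius `N` the constant `C` is absorbed by `δ ‖y‖²`; the summand `1` ensures `‖y‖ ≤
    -- ‖y‖²` there.
    obtain ⟨N, hN⟩ := exists_nat_ge (|C| / δ + 1)
    refine ⟨N, fun ν hν hνM => ?_⟩
    have hwint : Integrable w (ν : Measure Y) := by
      refine ((hν.const_mul δ).add (integrable_const C)).mono' hw.aestronglyMeasurable
        (ae_of_all _ fun y => ?_)
      rw [Real.norm_of_nonneg (h0 y)]
      exact hC y
    have hci := integrable_cutoff_mul hw N (ν : Measure Y)
    have hle : ∀ y, w y - cutoff N y * w y ≤ 2 * δ * ‖y‖ ^ 2 := by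
      intro y
      rcases le_total ‖y‖ N with hy | hy
      · rw [cutoff_eq_one hy, one_mul, sub_self]; positivity
      · have h1 : 0 ≤ cutoff N y * w y := mul_nonneg (cutoff_nonneg N y) (h0 y)
        have h2 := hC y
        have hN1 : 1 ≤ (N : ℝ) := by
          have : 0 ≤ |C| / δ := by positivity
          linarith
        have h3 : |C| / δ ≤ ‖y‖ ^ 2 := by nlinarith
        rw [div_le_iff₀ hδ0] at h3
        have h4 := le_abs_self C
        linarith
    rw [Real.dist_eq, ← integral_sub hwint hci, abs_of_nonneg (integral_nonneg fun y => by
      have := mul_le_of_le_one_left (h0 y) (cutoff_le_one N y)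
      simp only [Pi.zero_apply]
      linarith)]
    calc ∫ y, (w y - cutoff N y * w y) ∂(ν : Measure Y)
        ≤ ∫ y, 2 * δ * ‖y‖ ^ 2 ∂(ν : Measure Y) :=
          integral_mono (hwint.sub hci) (hν.const_mul _) hle
      _ ≤ 2 * δ * M := by rw [integral_const_mul]; gcongr
      _ ≤ ε := by
          rw [hδ]
          have : 2 * (ε / (2 * (M + 1))) * M = ε * (M / (M + 1)) := by field_simp
          rw [this]
          exact mul_le_of_le_one_right hε.le (by rw [div_le_one (by linarith)]; linarith)
  rw [Metric.tendsto_atTop]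
  intro ε hε
  obtain ⟨N, hN⟩ := approx (ε / 4) (by linarith)
  obtain ⟨n₀, hn₀⟩ := Metric.tendsto_atTop.1 (tendsto_integral_cutoff h hw N) (ε / 4) (by linarith)
  refine ⟨n₀, fun n hn => ?_⟩
  have h1 := hN _ (hint n) (hM n)
  have h2 := hN _ hγint hγM
  rw [dist_comm] at h2
  have h3 := hn₀ n hn
  have h4 := dist_triangle4 (∫ y, w y ∂(γs n : Measure Y))
    (∫ y, cutoff N y * w y ∂(γs n : Measure Y)) (∫ y, cutoff N y * w y ∂(γ : Measure Y))
    (∫ y, w y ∂(γ : Measure Y))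
  linarith

end NarrowConvergence

/-! ### Real-valued forms of the functional, coercivity and tightness. -/

section Bounds

variable {X : Type*} [NormedAddCommGroup X] [MeasureSpace X]
variable [BorelSpace X] [ProperSpace X] [IsFiniteMeasureOnCompacts (volume : Measure X)]
variable {m τ : ℝ} {K : Set X} {w h : X → ℝ}

theorem P2_mono {Ω Ω' : Set X} (h : Ω ⊆ Ω') {μ : Measure X} (hμ : μ ∈ P2 Ω) : μ ∈ P2 Ω' :=
  ⟨hμ.1, measure_mono_null (Set.compl_subset_compl.2 h) hμ.2.1, hμ.2.2⟩

theorem W2_ne_top {Ω Ω' : Set X} {μ ν : Measure X} (hμ : μ ∈ P2 Ω) (hν : ν ∈ P2 Ω') :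
    W2 μ ν ≠ ∞ := by
  have := hμ.1
  have := hν.1
  intro htop
  have h1 := W2_sq_le_moment (μ := μ) (ν := ν)
  rw [htop] at h1
  have h2 : 2 * moment μ + 2 * moment ν < ∞ :=
    ENNReal.add_lt_top.2 ⟨ENNReal.mul_lt_top (by norm_num) hμ.2.2,
      ENNReal.mul_lt_top (by norm_num) hν.2.2⟩
  exact absurd (h1.trans_lt h2) (by simp)

theorem moment_eq_lintegral (μ : Measure X) : moment μ = ∫⁻ x, ENNReal.ofReal (‖x‖ ^ 2) ∂μ := by
  refine lintegral_congr fun x => ?_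
  rw [ENNReal.ofReal_pow (norm_nonneg x), ofReal_norm]

theorem integrable_norm_sq {μ : Measure X} (h : moment μ < ∞) :
    Integrable (fun x : X => ‖x‖ ^ 2) μ := by
  rw [moment_eq_lintegral] at h
  exact (lintegral_ofReal_ne_top_iff_integrable (by fun_prop)
    (ae_of_all _ fun x => by positivity)).1 h.ne

theorem moment_toReal {μ : Measure X} (h : moment μ < ∞) :
    (moment μ).toReal = ∫ x, ‖x‖ ^ 2 ∂μ := by
  rw [moment_eq_lintegral, ← ofReal_integral_eq_lintegral_ofReal (integrable_norm_sq h)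
    (ae_of_all _ fun x => by positivity), ENNReal.toReal_ofReal
    (integral_nonneg fun x => by positivity)]

theorem moment_toReal_le {Ω Ω' : Set X} {μ ν : Measure X} (hμ : μ ∈ P2 Ω) (hν : ν ∈ P2 Ω') :
    (moment μ).toReal ≤ 2 * (W2 μ ν).toReal ^ 2 + 2 * (moment ν).toReal := by
  have h1 := moment_le_of_W2 (μ := μ) (ν := ν)
  have hW : W2 μ ν ^ 2 ≠ ∞ := ENNReal.pow_ne_top (W2_ne_top hμ hν)
  have hA : 2 * W2 μ ν ^ 2 ≠ ∞ := ENNReal.mul_ne_top (by norm_num) hW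
  have hB : 2 * moment ν ≠ ∞ := ENNReal.mul_ne_top (by norm_num) hν.2.2.ne
  have h2 := ENNReal.toReal_mono (ENNReal.add_ne_top.2 ⟨hA, hB⟩) h1
  rw [ENNReal.toReal_add hA hB, ENNReal.toReal_mul, ENNReal.toReal_mul, ENNReal.toReal_pow] at h2
  simpa using h2

/-- The integral of the energy density. -/
noncomputable def energy (m : ℝ) (K : Set X) (ρ : Measure X) : ℝ :=
  ∫ x in K, energyDensity m (dens ρ x)

theorem IsWeight.entropy_eq_energy (hK : MeasurableSet K) (H : IsWeight m K w h) {ρ : Measure X}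
    (hρ : ρ ∈ P2 K) (hfin : entropy m K ρ < ⊤) : entropy m K ρ = (energy m K ρ : EReal) := by
  have := hρ.1
  obtain ⟨h1, h2⟩ := H.integrable_energyDensity hK hρ.2.1 hρ.2.2 hfin
  exact entropy_eq_integral h1 h2

theorem coe_penalty {μ η : Measure X} (hτ : 0 < τ) (hW : W2 η μ ≠ ∞) :
    ((ENNReal.ofReal (1 / (2 * τ)) * W2 η μ ^ 2 : ℝ≥0∞) : EReal) =
      ((1 / (2 * τ) * (W2 η μ).toReal ^ 2 : ℝ) : EReal) := by
  rw [coe_ennreal_eq_coe_toReal (ENNReal.mul_ne_top (by simp) (ENNReal.pow_ne_top hW)),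
    ENNReal.toReal_mul, ENNReal.toReal_ofReal (by positivity), ENNReal.toReal_pow]

theorem functional_eq {Ω : Set X} {μ η : Measure X} (hτ : 0 < τ) (hW : W2 η μ ≠ ∞) {e : ℝ}
    (he : entropy m Ω η = (e : EReal)) :
    functional m τ Ω μ η = ((e + 1 / (2 * τ) * (W2 η μ).toReal ^ 2 : ℝ) : EReal) := by
  rw [functional, he, coe_penalty hτ hW, EReal.coe_add]

/-- The inequality satisfied by a minimizer, in real numbers. -/
theorem IsMinimizer.le (hm : 0 < m) (hτ : 0 < τ) (hK : MeasurableSet K) (H : IsWeight m K w h)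
    {Ω : Set X} (hΩ : NullMeasurableSet Ω volume) (hΩK : Ω ⊆ K) {μ ρ η : Measure X}
    (hμ : μ ∈ P2 Ω) (hmin : IsMinimizer m τ Ω μ ρ) (hη : η ∈ P2 Ω) (hfin : entropy m K η < ⊤) :
    entropy m K ρ < ⊤ ∧ energy m K ρ + 1 / (2 * τ) * (W2 ρ μ).toReal ^ 2 ≤
      energy m K η + 1 / (2 * τ) * (W2 η μ).toReal ^ 2 := by
  have := hη.1
  have := hmin.1.1
  have hρK := P2_mono hΩK hmin.1
  have hηK := P2_mono hΩK hη
  have e1 := entropy_congr_set hm hΩ hK.nullMeasurableSet hη.2.1 hηK.2.1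
  have e2 := entropy_congr_set hm hΩ hK.nullMeasurableSet hmin.1.2.1 hρK.2.1
  have hle := hmin.2 η hη
  rw [functional_eq hτ (W2_ne_top hη hμ) (e1.trans (H.entropy_eq_energy hK hηK hfin))] at hle
  have hρfin : entropy m K ρ < ⊤ := by
    rw [lt_top_iff_ne_top]
    intro htop
    rw [functional, e2, htop, coe_penalty hτ (W2_ne_top hmin.1 hμ), EReal.top_add_coe] at hle
    exact absurd hle (not_le.2 (EReal.coe_lt_top _))
  refine ⟨hρfin, ?_⟩
  rw [functional_eq hτ (W2_ne_top hmin.1 hμ) (e2.trans (H.entropy_eq_energy hK hρK hρfin))] at hle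
  exact EReal.coe_le_coe_iff.1 hle

/-- Coercivity of the functional. -/
theorem IsWeight.exists_bound (hτ : 0 < τ) (hK : MeasurableSet K) (H : IsWeight m K w h)
    (B D : ℝ) : ∃ M A : ℝ, ∀ ρ μ : Measure X, ρ ∈ P2 K → μ ∈ P2 K → entropy m K ρ < ⊤ →
      energy m K ρ + 1 / (2 * τ) * (W2 ρ μ).toReal ^ 2 ≤ B → (moment μ).toReal ≤ D →
      (moment ρ).toReal ≤ M ∧ energy m K ρ + (∫ x, w x ∂ρ) + ∫ x in K, h x ≤ A := by
  have hc0 : 0 < 1 / (2 * τ) := by positivity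
  generalize 1 / (2 * τ) = c at hc0 ⊢
  -- With `v = W2 ρ μ ^ 2`, the moment of `ρ` is at most `2 v + 2 D`, so `∫ w` costs at most `c / 2
  -- * v` plus constants. Half of the penalty `c * v` survives and bounds `v`.
  obtain ⟨C, hC⟩ := H.growth (c / 4) (by positivity)
  obtain ⟨Hh, hHh⟩ : ∃ Hh, ∫ x in K, h x = Hh := ⟨_, rfl⟩
  rw [hHh]
  refine ⟨4 * (B + C + Hh + c / 2 * D) / c + 2 * D,
    B + (c / 4 * (4 * (B + C + Hh + c / 2 * D) / c + 2 * D) + C) + Hh, ?_⟩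
  intro ρ μ hρ hμ hfin hB hD
  have := hρ.1
  obtain ⟨-, hint⟩ := H.integrable_energyDensity hK hρ.2.1 hρ.2.2 hfin
  have h1 := H.add_nonneg hK hρ.2.1 hρ.2.2 hint
  have h2 := moment_toReal_le hρ hμ
  have hv0 : 0 ≤ (W2 ρ μ).toReal ^ 2 := by positivity
  have h3 : ∫ x, w x ∂ρ ≤ c / 4 * (moment ρ).toReal + C := by
    rw [moment_toReal hρ.2.2]
    have hi := (integrable_norm_sq hρ.2.2).const_mul (c / 4)
    calc ∫ x, w x ∂ρ ≤ ∫ x, (c / 4 * ‖x‖ ^ 2 + C) ∂ρ :=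
          integral_mono (H.integrable_of_moment hρ.2.2) (hi.add (integrable_const C)) hC
      _ = c / 4 * ∫ x, ‖x‖ ^ 2 ∂ρ + C := by
          rw [integral_add hi (integrable_const C), integral_const_mul]; simp
  change 0 ≤ energy m K ρ + _ + _ at h1
  rw [hHh] at h1
  generalize energy m K ρ = e at *
  generalize (moment ρ).toReal = p at *
  generalize (moment μ).toReal = q at *
  generalize (∫ x, w x ∂ρ) = r at *
  generalize (W2 ρ μ).toReal ^ 2 = v at *
  have h6 : c / 4 * p ≤ c / 4 * (2 * v + 2 * D) := by
    have : p ≤ 2 * v + 2 * D := by linarith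
    gcongr
  have hv : v ≤ 2 * (B + C + Hh + c / 2 * D) / c := by
    rw [le_div_iff₀ hc0]
    linarith
  have hM : p ≤ 4 * (B + C + Hh + c / 2 * D) / c + 2 * D := by
    have : 4 * (B + C + Hh + c / 2 * D) / c = 2 * (2 * (B + C + Hh + c / 2 * D) / c) := by ring
    linarith
  refine ⟨hM, ?_⟩
  have h4 : 0 ≤ c * v := mul_nonneg hc0.le hv0
  have h5 := mul_le_mul_of_nonneg_left hM (by positivity : 0 ≤ c / 4)
  linarith

/-- Plans with a common bound on the second moments form a relatively compact family. -/
theorem exists_isCompact_plans (Q : ℝ) : ∃ S : Set (ProbabilityMeasure (X × X)), IsCompact S ∧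
    ∀ γ : ProbabilityMeasure (X × X),
      ∫⁻ p, (‖p.1‖ₑ ^ 2 + ‖p.2‖ₑ ^ 2) ∂(γ : Measure (X × X)) ≤ ENNReal.ofReal Q → γ ∈ S := by
  -- Markov's inequality at level `n + 1`: outside the ball of radius `n + 1` one of the squared
  -- norms is at least `(n + 1)² ≥ n + 1`.
  let u : ℕ → NNReal := fun n => Q.toNNReal / ((n : NNReal) + 1)
  have hu : Tendsto u atTop (𝓝 0) := by
    rw [← NNReal.tendsto_coe]
    have h1 := (tendsto_one_div_add_atTop_nhds_zero_nat (𝕜 := ℝ)).const_mul (Q.toNNReal : ℝ)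
    rw [mul_zero] at h1
    refine h1.congr fun n => ?_
    simp only [u]
    push_cast
    ring
  refine ⟨_, isCompact_setOfPred_probabilityMeasure_mass_eq_compl_isCompact_le hu
    (fun n => isCompact_closedBall (0 : X × X) ((n : ℝ) + 1)) (Or.inl inferInstance), ?_⟩
  intro γ hγ n
  have hpos : ((n : ℝ≥0∞) + 1) ≠ 0 := by simp
  have hmark : ((n : ℝ≥0∞) + 1) * (γ : Measure (X × X)) (Metric.closedBall 0 ((n : ℝ) + 1))ᶜ ≤
      ENNReal.ofReal Q := by
    refine le_trans ?_ hγ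
    refine le_trans (mul_le_mul_right (measure_mono fun p hp => ?_) _)
      (mul_meas_ge_le_lintegral (by fun_prop) ((n : ℝ≥0∞) + 1))
    rw [Set.mem_compl_iff, Metric.mem_closedBall, dist_zero_right, not_le, Prod.norm_def,
      lt_max_iff] at hp
    have aux : ∀ x : X, (n : ℝ) + 1 < ‖x‖ → (n : ℝ≥0∞) + 1 ≤ ‖x‖ₑ ^ 2 := by
      intro x hx
      have e1 : (n : ℝ≥0∞) + 1 = ENNReal.ofReal ((n : ℝ) + 1) := by
        rw [ENNReal.ofReal_add (by positivity) zero_le_one]; simp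
      rw [e1, ← ofReal_norm, ← ENNReal.ofReal_pow (norm_nonneg x)]
      refine ENNReal.ofReal_le_ofReal ?_
      have : (0 : ℝ) ≤ n := by positivity
      nlinarith
    rcases hp with hp | hp
    · exact (aux _ hp).trans le_self_add
    · exact (aux _ hp).trans le_add_self
  have : (γ : Measure (X × X)) (Metric.closedBall 0 ((n : ℝ) + 1))ᶜ ≤ (u n : ℝ≥0∞) := by
    have e : (u n : ℝ≥0∞) = ENNReal.ofReal Q / ((n : ℝ≥0∞) + 1) := by
      simp only [u]
      rw [ENNReal.coe_div (by positivity)]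
      simp [ENNReal.ofReal]
    rw [e, ENNReal.le_div_iff_mul_le (Or.inl hpos) (Or.inl (by finiteness)), mul_comm]
    exact hmark
  rw [← ENNReal.coe_le_coe]
  simpa using this

end Bounds

/-! ### Limits of almost optimal plans. -/

section Limit

variable {X : Type*} [NormedAddCommGroup X] [MeasureSpace X]
variable [BorelSpace X] [ProperSpace X] [IsFiniteMeasureOnCompacts (volume : Measure X)]
variable {m τ : ℝ} {K : Set X} {w h : X → ℝ}

theorem W2_toReal_triangle {Ω₁ Ω₂ Ω₃ : Set X} {μ κ ν : Measure X} (hμ : μ ∈ P2 Ω₁)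
    (hκ : κ ∈ P2 Ω₂) (hν : ν ∈ P2 Ω₃) :
    (W2 μ ν).toReal ≤ (W2 μ κ).toReal + (W2 κ ν).toReal := by
  rw [← ENNReal.toReal_add (W2_ne_top hμ hκ) (W2_ne_top hκ hν)]
  exact ENNReal.toReal_mono (ENNReal.add_ne_top.2 ⟨W2_ne_top hμ hκ, W2_ne_top hκ hν⟩)
    (W2_triangle _ _ _)

theorem W2_toReal_comm (μ ν : Measure X) : (W2 μ ν).toReal = (W2 ν μ).toReal := by
  rw [W2_comm]

theorem cost_eq_lintegral (γ : Measure (X × X)) :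
    cost γ = ∫⁻ p, ENNReal.ofReal (dist p.1 p.2 ^ 2) ∂γ := by
  refine lintegral_congr fun p => ?_
  rw [ENNReal.ofReal_pow dist_nonneg, edist_dist]

/-- A function dominating the square of the norm of the first component. -/
noncomputable def dominant (p : X × X) : ℝ := 2 * dist p.1 p.2 ^ 2 + 2 * ‖p.2‖ ^ 2

theorem continuous_dominant : Continuous (dominant : X × X → ℝ) := by
  unfold dominant; fun_prop

theorem dominant_nonneg (p : X × X) : 0 ≤ dominant p := by
  unfold dominant; positivity

theorem enorm_sq_le_dominant (p : X × X) : ‖p.1‖ₑ ^ 2 ≤ ENNReal.ofReal (dominant p) := by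
  refine (enorm_sq_le p.1 p.2).trans (le_of_eq ?_)
  rw [dominant, ENNReal.ofReal_add (by positivity) (by positivity), ENNReal.ofReal_mul (by norm_num),
    ENNReal.ofReal_mul (by norm_num), ENNReal.ofReal_pow dist_nonneg,
    ENNReal.ofReal_pow (norm_nonneg _), edist_dist, ofReal_norm]
  simp

theorem lintegral_dominant {ρ μ : Measure X} {γ : Measure (X × X)}
    (hγ : γ ∈ transportPlans ρ μ) :
    ∫⁻ p, ENNReal.ofReal (dominant p) ∂γ = 2 * cost γ + 2 * moment μ := by
  rw [cost_eq_lintegral, moment_eq_lintegral, ← lintegral_snd_of_plan hγ (by fun_prop),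
    ← lintegral_const_mul _ (by fun_prop), ← lintegral_const_mul _ (by fun_prop),
    ← lintegral_add_left (by fun_prop)]
  refine lintegral_congr fun p => ?_
  rw [dominant, ENNReal.ofReal_add (by positivity) (by positivity), ENNReal.ofReal_mul (by norm_num),
    ENNReal.ofReal_mul (by norm_num)]
  simp

theorem integral_dominant {ρ μ : Measure X} {γ : Measure (X × X)}
    (hγ : γ ∈ transportPlans ρ μ) (hc : cost γ ≠ ∞) (hμ : moment μ ≠ ∞) :
    Integrable dominant γ ∧
      ∫ p, dominant p ∂γ = 2 * (cost γ).toReal + 2 * (moment μ).toReal := by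
  have h1 := lintegral_dominant hγ
  have hA : 2 * cost γ ≠ ∞ := ENNReal.mul_ne_top (by norm_num) hc
  have hB : 2 * moment μ ≠ ∞ := ENNReal.mul_ne_top (by norm_num) hμ
  refine ⟨(lintegral_ofReal_ne_top_iff_integrable continuous_dominant.aestronglyMeasurable
    (ae_of_all _ dominant_nonneg)).1 (by rw [h1]; exact ENNReal.add_ne_top.2 ⟨hA, hB⟩), ?_⟩
  rw [integral_eq_lintegral_of_nonneg_ae (ae_of_all _ dominant_nonneg)
    continuous_dominant.aestronglyMeasurable, h1, ENNReal.toReal_add hA hB]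
  simp

/-- Tails of the first marginal are read off on the plan, where `dominant` has an integral
determined by the cost and the fixed second marginal. Uniform integrability then follows from
convergence of the costs. -/
theorem moment_tail_le {ρ μ : Measure X} {γ : Measure (X × X)} (hγ : γ ∈ transportPlans ρ μ)
    (R : ℝ) : ∫⁻ x in (Metric.closedBall 0 R)ᶜ, ‖x‖ₑ ^ 2 ∂ρ ≤
      ∫⁻ p in {p | R ≤ ‖p‖}, ENNReal.ofReal (dominant p) ∂γ := by
  have hm : MeasurableSet (Metric.closedBall (0 : X) R)ᶜ :=
    Metric.isClosed_closedBall.measurableSet.compl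
  rw [← hγ.2.1, setLIntegral_map hm (by fun_prop) measurable_fst]
  refine (lintegral_mono fun p => enorm_sq_le_dominant p).trans ?_
  refine lintegral_mono_set fun p hp => ?_
  simp only [Set.mem_preimage, Set.mem_compl_iff, Metric.mem_closedBall, dist_zero_right,
    not_le] at hp
  exact hp.le.trans (norm_fst_le p)

/-- Narrow convergence of plans and convergence of the costs imply convergence of the first
marginals in the Wasserstein distance. -/
theorem tendsto_W2_of_tendsto_plans {μ : Measure X} (hμ : moment μ ≠ ∞)
    {γs : ℕ → ProbabilityMeasure (X × X)} {γ : ProbabilityMeasure (X × X)}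
    (hγs : Tendsto γs atTop (𝓝 γ)) {ρs : ℕ → ProbabilityMeasure X} {ρ : ProbabilityMeasure X}
    (hρs : Tendsto ρs atTop (𝓝 ρ))
    (hplans : ∀ n, (γs n : Measure (X × X)) ∈ transportPlans (ρs n : Measure X) μ)
    (hplan : (γ : Measure (X × X)) ∈ transportPlans (ρ : Measure X) μ)
    (hcs : ∀ n, cost (γs n : Measure (X × X)) ≠ ∞) (hc : cost (γ : Measure (X × X)) ≠ ∞)
    (hlim : Tendsto (fun n => (cost (γs n : Measure (X × X))).toReal) atTop
      (𝓝 (cost (γ : Measure (X × X))).toReal)) :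
    Tendsto (fun n => W2 (ρs n : Measure X) (ρ : Measure X)) atTop (𝓝 0) := by
  refine tendsto_W2_of_tendsto hρs fun ε hε => ?_
  obtain ⟨r, hr0, hr⟩ := ENNReal.lt_iff_exists_nnreal_btwn.1 hε
  have hr0' : (0 : ℝ) < r := by exact_mod_cast hr0
  have hQ : Tendsto (fun n => ∫ p, dominant p ∂(γs n : Measure (X × X))) atTop
      (𝓝 (∫ p, dominant p ∂(γ : Measure (X × X)))) := by
    rw [(integral_dominant hplan hc hμ).2]
    simp only [fun n => (integral_dominant (hplans n) (hcs n) hμ).2]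
    exact (hlim.const_mul 2).add_const _
  obtain ⟨R, hR1, hR2⟩ := exists_tail_le hγs continuous_dominant dominant_nonneg
    (fun n => (integral_dominant (hplans n) (hcs n) hμ).1) (integral_dominant hplan hc hμ).1 hQ hr0'
  rw [ENNReal.ofReal_coe_nnreal] at hR2
  simp only [ENNReal.ofReal_coe_nnreal] at hR1
  refine ⟨R, ?_, (moment_tail_le hplan R).trans (hR2.trans hr.le)⟩
  filter_upwards [hR1] with n hn
  exact (moment_tail_le (hplans n) R).trans (hn.trans hr.le)

/-- Compactness and lower semicontinuity along a sequence with bounded weighted entropies. -/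
theorem exists_limit_plan (hm : 0 < m) (hK : IsClosed K) (H : IsWeight m K w h) {μ : Measure X}
    (hμ : μ ∈ P2 K) {ρs : ℕ → Measure X} (hρs : ∀ n, ρs n ∈ P2 K)
    (hfin : ∀ n, entropy m K (ρs n) < ⊤) {M A : ℝ} (hM : ∀ n, (moment (ρs n)).toReal ≤ M)
    (hA : ∀ n, energy m K (ρs n) + (∫ x, w x ∂ρs n) + ∫ x in K, h x ≤ A) :
    ∃ (φ : ℕ → ℕ) (ρ : Measure X) (γ : Measure (X × X)) (E b : ℝ),
      StrictMono φ ∧ ρ ∈ P2 K ∧ γ ∈ transportPlans ρ μ ∧ entropy m K ρ < ⊤ ∧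
      Tendsto (fun n => energy m K (ρs (φ n))) atTop (𝓝 E) ∧ energy m K ρ ≤ E ∧
      Tendsto (fun n => (W2 (ρs (φ n)) μ).toReal ^ 2) atTop (𝓝 b) ∧
      cost γ ≤ ENNReal.ofReal b ∧
      (cost γ = ENNReal.ofReal b → Tendsto (fun n => W2 (ρs (φ n)) ρ) atTop (𝓝 0)) := by
  have hKm := hK.measurableSet
  have hprob : ∀ n, IsProbabilityMeasure (ρs n) := fun n => (hρs n).1
  have hμprob := hμ.1
  set Mμ := (moment μ).toReal with hMμ
  have hM0 : 0 ≤ M := ENNReal.toReal_nonneg.trans (hM 0)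
  have hMμ0 : 0 ≤ Mμ := ENNReal.toReal_nonneg
  -- Plans optimal up to `1 / (n + 1)` suffice; existence of optimal plans is not needed.
  have hplan : ∀ n : ℕ, ∃ γ ∈ transportPlans (ρs n) μ,
      cost γ < W2 (ρs n) μ ^ 2 + ((n : ℝ≥0∞) + 1)⁻¹ := fun n =>
    exists_plan_cost_lt (ENNReal.lt_add_right (ENNReal.pow_ne_top (W2_ne_top (hρs n) hμ)) (by simp))
  choose γ₀ hγ₀ hγcost using hplan
  have hcfin : ∀ n, cost (γ₀ n) ≠ ∞ := fun n => (hγcost n).ne_top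
  let γs : ℕ → ProbabilityMeasure (X × X) := fun n => ⟨γ₀ n, (hγ₀ n).1⟩
  let ρP : ℕ → ProbabilityMeasure X := fun n => ⟨ρs n, hprob n⟩
  obtain ⟨S, hS, hγS⟩ := exists_isCompact_plans (X := X) (M + Mμ)
  have hmemS : ∀ n, γs n ∈ S := by
    intro n
    refine hγS _ ?_
    change ∫⁻ p, (‖p.1‖ₑ ^ 2 + ‖p.2‖ₑ ^ 2) ∂(γ₀ n) ≤ _
    rw [lintegral_add_left (by fun_prop),
      lintegral_fst_of_plan (hγ₀ n) (f := fun x => ‖x‖ₑ ^ 2) (by fun_prop),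
      lintegral_snd_of_plan (hγ₀ n) (f := fun x => ‖x‖ₑ ^ 2) (by fun_prop),
      ENNReal.ofReal_add hM0 hMμ0]
    refine add_le_add ?_ ?_
    · rw [ENNReal.le_ofReal_iff_toReal_le (hρs n).2.2.ne hM0]; exact hM n
    · rw [ENNReal.le_ofReal_iff_toReal_le hμ.2.2.ne hMμ0]; rfl
  let G : ℕ → ℝ := fun n => energy m K (ρs n) + (∫ x, w x ∂ρs n) + ∫ x in K, h x
  have hint : ∀ n, (1 ≤ m → ρs n ≪ volume) ∧
      IntegrableOn (fun x => energyDensity m (dens (ρs n) x)) K := fun n =>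
    H.integrable_energyDensity hKm (hρs n).2.1 (hρs n).2.2 (hfin n)
  have hG0 : ∀ n, 0 ≤ G n := fun n => H.add_nonneg hKm (hρs n).2.1 (hρs n).2.2 (hint n).2
  let b : ℕ → ℝ := fun n => (cost (γ₀ n)).toReal
  have hbv : ∀ n : ℕ, b n ≤ (W2 (ρs n) μ).toReal ^ 2 + 1 / ((n : ℝ) + 1) := by
    intro n
    have h1 : W2 (ρs n) μ ^ 2 ≠ ∞ := ENNReal.pow_ne_top (W2_ne_top (hρs n) hμ)
    have h2 : ((n : ℝ≥0∞) + 1)⁻¹ ≠ ∞ := by simp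
    have h3 := ENNReal.toReal_mono (ENNReal.add_ne_top.2 ⟨h1, h2⟩) (hγcost n).le
    rw [ENNReal.toReal_add h1 h2, ENNReal.toReal_pow, ENNReal.toReal_inv,
      ENNReal.toReal_add (by simp) (by simp)] at h3
    simpa using h3
  have hvb : ∀ n, (W2 (ρs n) μ).toReal ^ 2 ≤ b n := by
    intro n
    rw [← ENNReal.toReal_pow]
    exact ENNReal.toReal_mono (hcfin n) (W2_sq_le_cost (hγ₀ n))
  have hbB : ∀ n, b n ∈ Set.Icc 0 (2 * M + 2 * Mμ + 1) := by
    intro n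
    refine ⟨ENNReal.toReal_nonneg, (hbv n).trans ?_⟩
    have h1 : 1 / ((n : ℝ) + 1) ≤ 1 := by
      rw [div_le_one (by positivity)]
      have : (0 : ℝ) ≤ n := by positivity
      linarith
    have hA : 2 * moment (ρs n) ≠ ∞ := ENNReal.mul_ne_top (by norm_num) (hρs n).2.2.ne
    have hB : 2 * moment μ ≠ ∞ := ENNReal.mul_ne_top (by norm_num) hμ.2.2.ne
    have h2 := ENNReal.toReal_mono (ENNReal.add_ne_top.2 ⟨hA, hB⟩)
      (W2_sq_le_moment (μ := ρs n) (ν := μ))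
    rw [ENNReal.toReal_add hA hB, ENNReal.toReal_mul, ENNReal.toReal_mul,
      ENNReal.toReal_pow] at h2
    have h3 := hM n
    simp only [ENNReal.toReal_ofNat] at h2
    linarith
  -- One extraction for plans, weighted energies and costs together; the `1` in the last interval is
  -- the error of almost optimality.
  obtain ⟨⟨γ, g, bl⟩, -, φ, hφ, hlim⟩ := (hS.prod ((isCompact_Icc (a := (0 : ℝ)) (b := A)).prod
    (isCompact_Icc (a := (0 : ℝ)) (b := 2 * M + 2 * Mμ + 1)))).tendsto_subseq
    (x := fun n => (γs n, G n, b n)) (fun n => ⟨hmemS n, ⟨hG0 n, hA n⟩, hbB n⟩)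
  rw [Prod.tendsto_iff] at hlim
  obtain ⟨hγlim, hlim2⟩ := hlim
  rw [Prod.tendsto_iff] at hlim2
  obtain ⟨hGlim, hblim⟩ := hlim2
  change Tendsto (fun n => γs (φ n)) atTop (𝓝 γ) at hγlim
  change Tendsto (fun n => G (φ n)) atTop (𝓝 g) at hGlim
  change Tendsto (fun n => b (φ n)) atTop (𝓝 bl) at hblim
  have hvlim : Tendsto (fun n => (W2 (ρs (φ n)) μ).toReal ^ 2) atTop (𝓝 bl) := by
    have h1 : Tendsto (fun n => b (φ n) - 1 / ((φ n : ℝ) + 1)) atTop (𝓝 (bl - 0)) :=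
      hblim.sub ((tendsto_one_div_add_atTop_nhds_zero_nat (𝕜 := ℝ)).comp hφ.tendsto_atTop)
    rw [sub_zero] at h1
    refine tendsto_of_tendsto_of_tendsto_of_le_of_le h1 hblim (fun n => ?_) (fun n => hvb _)
    have := hbv (φ n)
    simp only
    linarith
  let ρ : ProbabilityMeasure X := γ.map (measurable_fst.aemeasurable)
  have hρlim : Tendsto (fun n => ρP (φ n)) atTop (𝓝 ρ) := by
    have h1 := ProbabilityMeasure.tendsto_map_of_tendsto_of_continuous _ _ hγlim continuous_fst
    refine h1.congr fun n => Subtype.ext ?_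
    exact (hγ₀ (φ n)).2.1
  have hsnd : (γ : Measure (X × X)).map Prod.snd = μ := by
    have h1 := ProbabilityMeasure.tendsto_map_of_tendsto_of_continuous _ _ hγlim continuous_snd
    let μP : ProbabilityMeasure X := ⟨μ, hμprob⟩
    have h2 : Tendsto (fun _ : ℕ => μP) atTop
        (𝓝 (γ.map continuous_snd.measurable.aemeasurable)) := by
      refine h1.congr fun n => Subtype.ext ?_
      exact (hγ₀ (φ n)).2.2
    have h3 : γ.map continuous_snd.measurable.aemeasurable = μP :=
      tendsto_nhds_unique h2 tendsto_const_nhds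
    exact congrArg ProbabilityMeasure.toMeasure h3
  have hγplan : (γ : Measure (X × X)) ∈ transportPlans (ρ : Measure X) μ :=
    ⟨inferInstance, rfl, hsnd⟩
  have hρK : (ρ : Measure X) Kᶜ = 0 := by
    have h1 := ProbabilityMeasure.le_liminf_measure_open_of_tendsto hρlim hK.isOpen_compl
    have h2 : ∀ n, (ρP (φ n) : Measure X) Kᶜ = 0 := fun n => (hρs (φ n)).2.1
    simp only [h2, liminf_const] at h1
    exact le_antisymm h1 zero_le
  have hcost : cost (γ : Measure (X × X)) ≤ ENNReal.ofReal bl := by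
    rw [cost_eq_lintegral]
    refine (lintegral_le_liminf_of_tendsto hγlim (by fun_prop) fun p => by positivity).trans ?_
    refine le_of_eq (Tendsto.liminf_eq ?_)
    refine ((ENNReal.continuous_ofReal.tendsto _).comp hblim).congr fun n => ?_
    change ENNReal.ofReal (cost (γ₀ (φ n))).toReal = ∫⁻ p, _ ∂(γ₀ (φ n))
    rw [ENNReal.ofReal_toReal (hcfin _), cost_eq_lintegral]
  have hcostfin : cost (γ : Measure (X × X)) ≠ ∞ := ne_top_of_le_ne_top ENNReal.ofReal_ne_top hcost
  have hρmom : moment (ρ : Measure X) < ∞ := by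
    refine lt_of_le_of_lt (moment_le_of_W2 (ν := μ)) ?_
    have h1 : W2 (ρ : Measure X) μ ^ 2 < ∞ := (W2_sq_le_cost hγplan).trans_lt hcostfin.lt_top
    exact ENNReal.add_lt_top.2 ⟨ENNReal.mul_lt_top (by norm_num) h1,
      ENNReal.mul_lt_top (by norm_num) hμ.2.2⟩
  have hρ2 : (ρ : Measure X) ∈ P2 K := ⟨inferInstance, hρK, hρmom⟩
  have hwlim : Tendsto (fun n => ∫ x, w x ∂ρs (φ n)) atTop (𝓝 (∫ x, w x ∂(ρ : Measure X))) := by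
    refine tendsto_integral_of_growth (M := max M (moment (ρ : Measure X)).toReal) hρlim
      H.continuous H.nonneg H.growth (fun n => integrable_norm_sq (hρs (φ n)).2.2) (fun n => ?_)
      (integrable_norm_sq hρmom) ?_
    · change ∫ y, ‖y‖ ^ 2 ∂(ρs (φ n)) ≤ _
      rw [← moment_toReal (hρs (φ n)).2.2]
      exact (hM _).trans (le_max_left _ _)
    · rw [← moment_toReal hρmom]
      exact le_max_right _ _
  have hg0 : 0 ≤ g := ge_of_tendsto' hGlim fun n => hG0 _
  -- The weighted energies converge to `g` without being bounded by it, so semicontinuity is applied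
  -- with the bounds `g + 1 / (j + 1)`, valid eventually.
  have hlsc : weightedEntropy m K w h (ρ : Measure X) ≤ ENNReal.ofReal g := by
    have h1 : Tendsto (fun j : ℕ => ENNReal.ofReal (g + 1 / ((j : ℝ) + 1))) atTop
        (𝓝 (ENNReal.ofReal g)) := by
      have := (tendsto_one_div_add_atTop_nhds_zero_nat (𝕜 := ℝ)).const_add g
      rw [add_zero] at this
      exact (ENNReal.continuous_ofReal.tendsto _).comp this
    refine ge_of_tendsto' h1 fun j => ?_
    have hj : (0 : ℝ) < 1 / ((j : ℝ) + 1) := by positivity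
    refine weightedEntropy_le_of_tendsto hm hKm H hρlim (fun n => (hρs (φ n)).2.1) hρK
      (by positivity) ?_
    filter_upwards [hGlim.eventually_le_const (lt_add_of_pos_right g hj)] with n hn
    change weightedEntropy m K w h (ρs (φ n)) ≤ _
    rw [H.weightedEntropy_eq hKm (hρs (φ n)).2.1 (hρs (φ n)).2.2 (hint (φ n)).1 (hint (φ n)).2]
    exact ENNReal.ofReal_le_ofReal hn
  obtain ⟨hac, hρint⟩ := H.integrable_of_weightedEntropy hKm hρK hρmom
    (ne_top_of_le_ne_top ENNReal.ofReal_ne_top hlsc)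
  have hρfin : entropy m K (ρ : Measure X) < ⊤ := by
    rw [entropy_eq_integral hac hρint]; exact EReal.coe_lt_top _
  rw [H.weightedEntropy_eq hKm hρK hρmom hac hρint, ENNReal.ofReal_le_ofReal_iff hg0] at hlsc
  change energy m K (ρ : Measure X) + _ + _ ≤ g at hlsc
  refine ⟨φ, ρ, γ, g - (∫ x, w x ∂(ρ : Measure X)) - ∫ x in K, h x, bl, hφ, hρ2, hγplan, hρfin,
    ?_, by linarith, hvlim, hcost, fun hceq => ?_⟩
  · refine ((hGlim.sub hwlim).sub_const _).congr fun n => ?_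
    simp only [G]
    ring
  · clear_value ρ
    have hb0 : 0 ≤ bl := ge_of_tendsto' hblim fun n => ENNReal.toReal_nonneg
    have hclim : Tendsto (fun n => (cost ((γs (φ n) : ProbabilityMeasure (X × X)) :
        Measure (X × X))).toReal) atTop (𝓝 (cost (γ : Measure (X × X))).toReal) := by
      rw [hceq, ENNReal.toReal_ofReal hb0]
      exact hblim
    exact tendsto_W2_of_tendsto_plans (γs := fun n => γs (φ n)) (ρs := fun n => ρP (φ n))
      hμ.2.2.ne hγlim hρlim (fun n => hγ₀ (φ n)) hγplan (fun n => hcfin _) hcostfin hclim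

end Limit

/-! ### Passing to the limit in the minimality inequality. -/

section Limit

variable {X : Type*} [NormedAddCommGroup X] [MeasureSpace X]
variable [BorelSpace X] [ProperSpace X] [IsFiniteMeasureOnCompacts (volume : Measure X)]
variable {m τ : ℝ} {K : Set X} {w h : X → ℝ}

theorem tendsto_W2_toReal {Ω : ℕ → Set X} {Ω₁ Ω₂ : Set X} {μs : ℕ → Measure X} {μ η : Measure X}
    (hμs : ∀ n, μs n ∈ P2 (Ω n)) (hμ : μ ∈ P2 Ω₁) (hη : η ∈ P2 Ω₂)
    (h : Tendsto (fun n => (W2 (μs n) μ).toReal) atTop (𝓝 0)) :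
    Tendsto (fun n => (W2 η (μs n)).toReal) atTop (𝓝 (W2 η μ).toReal) := by
  rw [tendsto_iff_dist_tendsto_zero]
  refine squeeze_zero (fun _ => dist_nonneg) (fun n => ?_) h
  have h1 := W2_toReal_triangle hη hμ (hμs n)
  have h2 := W2_toReal_triangle hη (hμs n) hμ
  rw [W2_toReal_comm μ (μs n)] at h1
  rw [Real.dist_eq, abs_le]
  constructor <;> linarith

/-- A subsequence of a sequence of minimizers converges to a minimizer, provided that the measures
on the domains `Ω n` are dense in energy. -/
theorem exists_limit_minimizer (hm : 0 < m) (hτ : 0 < τ) (hK : IsClosed K)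
    (H : IsWeight m K w h) {Ω : ℕ → Set X} (hΩ : Monotone Ω) (hΩK : ∀ n, Ω n ⊆ K)
    (hΩm : ∀ n, NullMeasurableSet (Ω n) volume)
    (hdense : ∀ η ∈ P2 K, entropy m K η < ⊤ → ∀ ε : ℝ, 0 < ε → ∃ n, ∃ η' ∈ P2 (Ω n),
      entropy m K η' ≤ entropy m K η + ε ∧ W2 η' η ≤ ENNReal.ofReal ε)
    (hfin : ∃ η ∈ P2 (Ω 0), entropy m K η < ⊤) {μs ρs : ℕ → Measure X} {μ : Measure X}
    (hμs : ∀ n, μs n ∈ P2 (Ω n)) (hμ : μ ∈ P2 K)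
    (hW : Tendsto (fun n => W2 (μs n) μ) atTop (𝓝 0))
    (hmin : ∀ n, IsMinimizer m τ (Ω n) (μs n) (ρs n)) :
    ∃ (φ : ℕ → ℕ) (ρ : Measure X) (γ : Measure (X × X)), StrictMono φ ∧
      IsMinimizer m τ K μ ρ ∧ entropy m K ρ < ⊤ ∧ γ ∈ transportPlans ρ μ ∧
      cost γ = W2 ρ μ ^ 2 ∧ Tendsto (fun k => W2 (ρs (φ k)) ρ) atTop (𝓝 0) := by
  have hKm := hK.measurableSet
  set c := 1 / (2 * τ) with hc
  have hc0 : 0 < c := by positivity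
  have hρs : ∀ n, ρs n ∈ P2 K := fun n => P2_mono (hΩK n) (hmin n).1
  have hμsK : ∀ n, μs n ∈ P2 K := fun n => P2_mono (hΩK n) (hμs n)
  have hd : Tendsto (fun n => (W2 (μs n) μ).toReal) atTop (𝓝 0) := by
    have := (ENNReal.tendsto_toReal ENNReal.zero_ne_top).comp hW
    simpa [Function.comp_def] using this
  obtain ⟨D, hD⟩ := hd.bddAbove_range
  have hD' : ∀ n, (W2 (μs n) μ).toReal ≤ D := fun n => hD ⟨n, rfl⟩
  have hle : ∀ {k n : ℕ} {η : Measure X}, k ≤ n → η ∈ P2 (Ω k) → entropy m K η < ⊤ →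
      entropy m K (ρs n) < ⊤ ∧ energy m K (ρs n) + c * (W2 (ρs n) (μs n)).toReal ^ 2 ≤
        energy m K η + c * (W2 η (μs n)).toReal ^ 2 := fun hkn hη hηfin =>
    IsMinimizer.le hm hτ hKm H (hΩm _) (hΩK _) (hμs _) (hmin _) (P2_mono (hΩ hkn) hη) hηfin
  obtain ⟨η₀, hη₀, hη₀fin⟩ := hfin
  have hρfin : ∀ n, entropy m K (ρs n) < ⊤ := fun n => (hle (zero_le (a := n)) hη₀ hη₀fin).1
  -- The fixed competitor `η₀` lives on every domain, and `D` bounds the distances from `μs n` to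
  -- `μ`; the two constants are its value bound and the resulting moment bound for `μs n`.
  obtain ⟨M, A, hMA⟩ := H.exists_bound hτ hKm
    (energy m K η₀ + c * ((W2 η₀ μ).toReal + D) ^ 2) (2 * D ^ 2 + 2 * (moment μ).toReal)
  have hbound : ∀ n, (moment (ρs n)).toReal ≤ M ∧
      energy m K (ρs n) + (∫ x, w x ∂ρs n) + ∫ x in K, h x ≤ A := by
    intro n
    refine hMA _ _ (hρs n) (hμsK n) (hρfin n) ?_ ?_
    · refine (hle (zero_le (a := n)) hη₀ hη₀fin).2.trans ?_
      have h1 := W2_toReal_triangle hη₀ hμ (hμs n)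
      rw [W2_toReal_comm μ (μs n)] at h1
      have h2 := hD' n
      have h3 : (W2 η₀ (μs n)).toReal ≤ (W2 η₀ μ).toReal + D := by linarith
      gcongr
    · refine (moment_toReal_le (hμs n) hμ).trans ?_
      have := hD' n
      gcongr
  obtain ⟨φ, ρ, γ, E, b, hφ, hρ, hγ, hρfin', hElim, hρE, hvlim, hcb, hconv⟩ :=
    exists_limit_plan hm hK H hμ hρs hρfin (fun n => (hbound n).1) (fun n => (hbound n).2)
  have hb0 : 0 ≤ b := ge_of_tendsto' hvlim fun n => by positivity
  -- Replacing `μ` by `μs (φ n)` changes the distance by at most `W2 (μs (φ n)) μ`, which tends to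
  -- zero.
  have hvlim' : Tendsto (fun n => (W2 (ρs (φ n)) (μs (φ n))).toReal ^ 2) atTop (𝓝 b) := by
    have h1 : Tendsto (fun n => (W2 (ρs (φ n)) μ).toReal) atTop (𝓝 (Real.sqrt b)) := by
      refine ((Real.continuous_sqrt.tendsto _).comp hvlim).congr fun n => ?_
      exact Real.sqrt_sq ENNReal.toReal_nonneg
    have h2 : Tendsto (fun n => (W2 (ρs (φ n)) (μs (φ n))).toReal -
        (W2 (ρs (φ n)) μ).toReal) atTop (𝓝 0) := by
      refine squeeze_zero_norm (fun n => ?_) (hd.comp hφ.tendsto_atTop)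
      have h3 := W2_toReal_triangle (hρs (φ n)) hμ (hμs (φ n))
      have h4 := W2_toReal_triangle (hρs (φ n)) (hμs (φ n)) hμ
      rw [W2_toReal_comm μ (μs (φ n))] at h3
      rw [Real.norm_eq_abs, abs_le]
      simp only [Function.comp_apply]
      constructor <;> linarith
    have h3 := (h1.add h2).pow 2
    rw [add_zero, Real.sq_sqrt hb0] at h3
    refine h3.congr fun n => ?_
    ring
  -- A competitor on the `k`-th domain is admissible for all `n ≥ k`, so it can be kept fixed while
  -- `n` tends to infinity.
  have hlimle : ∀ {k : ℕ} {η : Measure X}, η ∈ P2 (Ω k) → entropy m K η < ⊤ →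
      E + c * b ≤ energy m K η + c * (W2 η μ).toReal ^ 2 := by
    intro k η hη hηfin
    refine le_of_tendsto_of_tendsto (hElim.add (hvlim'.const_mul c))
      ((((tendsto_W2_toReal hμs hμ hη hd).comp hφ.tendsto_atTop).pow 2).const_mul c |>.const_add
        (energy m K η)) ?_
    filter_upwards [hφ.tendsto_atTop.eventually_ge_atTop k] with n hn
    exact (hle hn hη hηfin).2
  have hlimle' : ∀ {η : Measure X}, η ∈ P2 K → entropy m K η < ⊤ →
      E + c * b ≤ energy m K η + c * (W2 η μ).toReal ^ 2 := by
    intro η hη hηfin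
    have hcont : Tendsto (fun ε : ℝ => (energy m K η + ε) + c * ((W2 η μ).toReal + ε) ^ 2)
        (𝓝[>] 0) (𝓝 ((energy m K η + 0) + c * ((W2 η μ).toReal + 0) ^ 2)) :=
      (Continuous.tendsto (by fun_prop) 0).mono_left nhdsWithin_le_nhds
    rw [add_zero, add_zero] at hcont
    refine ge_of_tendsto hcont ?_
    filter_upwards [self_mem_nhdsWithin] with ε (hε : 0 < ε)
    obtain ⟨k, η', hη', he, hw⟩ := hdense η hη hηfin ε hε
    rw [H.entropy_eq_energy hKm hη hηfin, ← EReal.coe_add] at he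
    have hη'fin : entropy m K η' < ⊤ := he.trans_lt (EReal.coe_lt_top _)
    rw [H.entropy_eq_energy hKm (P2_mono (hΩK k) hη') hη'fin, EReal.coe_le_coe_iff] at he
    refine (hlimle hη' hη'fin).trans ?_
    have h1 := W2_toReal_triangle hη' hη hμ
    have h2 : (W2 η' η).toReal ≤ ε := ENNReal.toReal_le_of_le_ofReal hε.le hw
    have h3 : (W2 η' μ).toReal ≤ (W2 η μ).toReal + ε := by linarith
    gcongr
  have hWb : (W2 ρ μ).toReal ^ 2 ≤ b := by
    rw [← ENNReal.toReal_pow]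
    exact ENNReal.toReal_le_of_le_ofReal hb0 ((W2_sq_le_cost hγ).trans hcb)
  -- Testing with `ρ` and using that its energy is at most `E` gives `b ≤ W2 ρ μ ^ 2`. This one
  -- comparison makes `γ` optimal and excludes loss of cost.
  have hbW : b = (W2 ρ μ).toReal ^ 2 := by
    refine le_antisymm ?_ hWb
    have h1 := hlimle' hρ hρfin'
    exact le_of_mul_le_mul_left (by linarith) hc0
  have hW2b : W2 ρ μ ^ 2 = ENNReal.ofReal b := by
    rw [hbW, ENNReal.ofReal_pow ENNReal.toReal_nonneg, ENNReal.ofReal_toReal (W2_ne_top hρ hμ)]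
  have hcost : cost γ = ENNReal.ofReal b := le_antisymm hcb (hW2b ▸ W2_sq_le_cost hγ)
  refine ⟨φ, ρ, γ, hφ, ⟨hρ, fun η hη => ?_⟩, hρfin', hγ, hcost.trans hW2b.symm, hconv hcost⟩
  rw [functional_eq hτ (W2_ne_top hρ hμ) (H.entropy_eq_energy hKm hρ hρfin')]
  by_cases hηfin : entropy m K η < ⊤
  · rw [functional_eq hτ (W2_ne_top hη hμ) (H.entropy_eq_energy hKm hη hηfin),
      EReal.coe_le_coe_iff]
    have h1 := hlimle' hη hηfin
    rw [hbW] at h1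
    linarith
  · rw [functional, not_lt_top_iff.1 hηfin, coe_penalty hτ (W2_ne_top hη hμ), EReal.top_add_coe]
    exact le_top

end Limit

/-! ### Construction of the weights. -/

section Weights

/-- The negative part is of sublinear order `p < 1`: for `m < 1` this is an equality with `p = m`,
for `m = 1` it is `log (1 / t) ≤ t ^ (-(1 - p)) / (1 - p)`, and for `m > 1` the density is
nonnegative. -/
theorem neg_rpow_le_energyDensity {m p t : ℝ} (hp0 : 0 < p) (hp1 : p < 1)
    (hmp : m < 1 → p = m) (ht : 0 ≤ t) : -(1 / (1 - p) * t ^ p) ≤ energyDensity m t := by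
  have h1p : 0 < 1 - p := by linarith
  have h0 : 0 ≤ 1 / (1 - p) * t ^ p := by positivity
  unfold energyDensity
  split_ifs with h
  · rcases ht.eq_or_lt with rfl | ht
    · simp [Real.zero_rpow hp0.ne']
    · have h1 := Real.log_le_rpow_div (inv_nonneg.2 ht.le) h1p
      rw [Real.log_inv, Real.inv_rpow ht.le, ← Real.rpow_neg ht.le] at h1
      have h2 := mul_le_mul_of_nonneg_left h1 ht.le
      have h3 : t * (t ^ (-(1 - p)) / (1 - p)) = 1 / (1 - p) * t ^ p := by
        have : t ^ p = t * t ^ (-(1 - p)) := by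
          rw [← Real.rpow_one_add' ht.le (by linarith)]; congr 1; ring
        rw [this]; ring
      rw [h3] at h2
      linarith
  · rcases lt_or_gt_of_ne h with h | h
    · rw [hmp h]
      have h1 : m - 1 ≠ 0 := by linarith
      have h2 : 1 - m ≠ 0 := by linarith
      refine le_of_eq ?_
      field_simp
      ring
    · have : 0 ≤ t ^ m / (m - 1) := div_nonneg (Real.rpow_nonneg ht m) (by linarith)
      linarith

/-- Weighted arithmetic-geometric mean inequality for `w * t` and `w ^ (-(p / (1 - p)))` with
weights `p` and `1 - p`; the powers of `w` cancel. -/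
theorem rpow_le_mul_add {p t w : ℝ} (hp0 : 0 < p) (hp1 : p < 1) (ht : 0 ≤ t) (hw : 0 < w) :
    t ^ p ≤ w * t + w ^ (-(p / (1 - p))) := by
  have h1p : 0 < 1 - p := by linarith
  have hq : 0 < w ^ (-(p / (1 - p))) := Real.rpow_pos_of_pos hw _
  have h := Real.geom_mean_le_arith_mean2_weighted hp0.le h1p.le (mul_nonneg hw.le ht) hq.le
    (by ring)
  rw [← Real.rpow_mul hw.le, Real.mul_rpow hw.le ht] at h
  have e : -(p / (1 - p)) * (1 - p) = -p := by field_simp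
  rw [e, Real.rpow_neg hw.le] at h
  have e2 : w ^ p * t ^ p * (w ^ p)⁻¹ = t ^ p := by
    have := (Real.rpow_pos_of_pos hw p).ne'
    field_simp
  rw [e2] at h
  have h1 : p * (w * t) ≤ w * t := mul_le_of_le_one_left (by positivity) hp1.le
  have h2 : (1 - p) * w ^ (-(p / (1 - p))) ≤ w ^ (-(p / (1 - p))) :=
    mul_le_of_le_one_left hq.le (by linarith)
  linarith

theorem energyDensity_add_nonneg {m p t w : ℝ} (hp0 : 0 < p) (hp1 : p < 1)
    (hmp : m < 1 → p = m) (ht : 0 ≤ t) (hw : 0 < w) :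
    0 ≤ energyDensity m t + 1 / (1 - p) * w * t + 1 / (1 - p) * w ^ (-(p / (1 - p))) := by
  have h1 := neg_rpow_le_energyDensity hp0 hp1 hmp ht
  have h1p : 0 < 1 / (1 - p) := one_div_pos.2 (by linarith)
  have h2 := mul_le_mul_of_nonneg_left (rpow_le_mul_add hp0 hp1 ht hw) h1p.le
  rw [mul_add] at h2
  linarith

/-- Constant weights on a set of finite volume. -/
theorem exists_isWeight_of_volume_lt_top {X : Type*} [NormedAddCommGroup X] [MeasureSpace X]
    {m : ℝ} (hm : 0 < m) {K : Set X} (hK : volume K < ∞) :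
    ∃ w h : X → ℝ, IsWeight m K w h := by
  obtain ⟨p, hp0, hp1, hmp⟩ : ∃ p : ℝ, 0 < p ∧ p < 1 ∧ (m < 1 → p = m) := by
    by_cases h : m < 1
    · exact ⟨m, hm, h, fun _ => rfl⟩
    · exact ⟨1 / 2, by norm_num, by norm_num, fun h' => absurd h' h⟩
  have h1p : 0 < 1 / (1 - p) := one_div_pos.2 (by linarith)
  refine ⟨fun _ => 1 / (1 - p), fun _ => 1 / (1 - p), continuous_const, fun _ => h1p.le,
    measurable_const, integrableOn_const hK.ne, fun _ => h1p.le, fun x _ t ht => ?_,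
    fun ε hε => ⟨1 / (1 - p), fun x => ?_⟩⟩
  · simpa using energyDensity_add_nonneg hp0 hp1 hmp ht one_pos
  · have : 0 ≤ ε * ‖x‖ ^ 2 := by positivity
    linarith

/-- Weights of polynomial growth. -/
theorem exists_isWeight_of_lt {d : ℕ} (hd : 1 ≤ d) {m : ℝ} (hm : 1 - 2 / ((d : ℝ) + 2) < m)
    (K : Set (EuclideanSpace ℝ (Fin d))) :
    ∃ w h : EuclideanSpace ℝ (Fin d) → ℝ, IsWeight m K w h := by
  have hd0 : (1 : ℝ) ≤ d := by exact_mod_cast hd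
  have hcrit : 1 - 2 / ((d : ℝ) + 2) = d / (d + 2) := by field_simp; ring
  rw [hcrit] at hm
  have hc0 : 0 < (d : ℝ) / (d + 2) := by positivity
  have hc1 : (d : ℝ) / (d + 2) < 1 := by rw [div_lt_one (by positivity)]; linarith
  obtain ⟨p, hpc, hp1, hmp⟩ : ∃ p : ℝ, (d : ℝ) / (d + 2) < p ∧ p < 1 ∧ (m < 1 → p = m) := by
    by_cases h : m < 1
    · exact ⟨m, hm, h, fun _ => rfl⟩
    · obtain ⟨p, h1, h2⟩ := exists_between hc1
      exact ⟨p, h1, h2, fun h' => absurd h' h⟩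
  have hp0 : 0 < p := hc0.trans hpc
  have h1p : 0 < 1 - p := by linarith
  set C := 1 / (1 - p) with hC
  have hC0 : 0 < C := one_div_pos.2 h1p
  set q := p / (1 - p) with hq
  have hq0 : 0 < q := div_pos hp0 h1p
  -- An exponent `a` is needed with `a * q > d`, so that `h` is integrable, and `a < 2`, so that `w`
  -- is subquadratic. Such `a` exists exactly when `p > d / (d + 2)`.
  have hdq : (d : ℝ) / q < 2 := by
    rw [div_lt_iff₀ hq0, hq, mul_div_assoc', lt_div_iff₀ h1p]
    rw [div_lt_iff₀ (by positivity)] at hpc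
    linarith
  obtain ⟨a, ha1, ha2⟩ := exists_between hdq
  have ha0 : 0 < a := lt_of_le_of_lt (by positivity) ha1
  have hbase : ∀ x : EuclideanSpace ℝ (Fin d), 0 < 1 + ‖x‖ := fun x => by positivity
  have hW : ∀ x : EuclideanSpace ℝ (Fin d), 0 < (1 + ‖x‖) ^ a := fun x =>
    Real.rpow_pos_of_pos (hbase x) a
  refine ⟨fun x => C * (1 + ‖x‖) ^ a, fun x => C * ((1 + ‖x‖) ^ a) ^ (-q), ?_, fun x => ?_, ?_, ?_,
    fun x => ?_, fun x _ t ht => ?_, fun ε hε => ?_⟩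
  · exact continuous_const.mul ((continuous_const.add continuous_norm).rpow_const
      fun x => Or.inl (hbase x).ne')
  · exact mul_nonneg hC0.le (hW x).le
  · fun_prop
  · have h1 : (Module.finrank ℝ (EuclideanSpace ℝ (Fin d)) : ℝ) < a * q := by
      rw [finrank_euclideanSpace_fin]
      rwa [div_lt_iff₀ hq0] at ha1
    refine Integrable.integrableOn (((integrable_one_add_norm h1).const_mul C).congr
      (ae_of_all _ fun x => ?_))
    simp only
    rw [← Real.rpow_mul (hbase x).le]
    ring_nf
  · exact mul_nonneg hC0.le (Real.rpow_nonneg (hW x).le _)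
  · exact energyDensity_add_nonneg hp0 hp1 hmp ht (hW x)
  · set δ := ε / (2 * C) with hδ
    have hδ0 : 0 < δ := by positivity
    refine ⟨ε + C * δ ^ (-(a / 2 / (1 - a / 2))), fun x => ?_⟩
    -- Subquadratic growth by the same inequality, with exponent `a / 2` applied to `(1 + ‖x‖)²`.
    have h1 := rpow_le_mul_add (p := a / 2) (by linarith) (by linarith)
      (sq_nonneg (1 + ‖x‖)) hδ0
    have h2 : ((1 + ‖x‖) ^ 2) ^ (a / 2) = (1 + ‖x‖) ^ a := by
      rw [← Real.rpow_natCast, ← Real.rpow_mul (hbase x).le]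
      congr 1
      push_cast
      ring
    rw [h2] at h1
    have h3 := mul_le_mul_of_nonneg_left h1 hC0.le
    have h4 : C * (δ * (1 + ‖x‖) ^ 2) = ε / 2 * (1 + ‖x‖) ^ 2 := by
      rw [hδ]; field_simp
    rw [mul_add, h4] at h3
    have h5 : ε / 2 * (1 + ‖x‖) ^ 2 ≤ ε * ‖x‖ ^ 2 + ε := by
      nlinarith [sq_nonneg (1 - ‖x‖), mul_nonneg hε.le (sq_nonneg (1 - ‖x‖))]
    linarith

end Weights

/-! ### Approximation in energy by restriction and normalization. -/

section Approximation

variable {X : Type*} [NormedAddCommGroup X] [MeasureSpace X]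
variable [BorelSpace X] [ProperSpace X] [IsFiniteMeasureOnCompacts (volume : Measure X)]
variable {m : ℝ} {K : Set X} {w h : X → ℝ}

theorem energyDensity_nonpos (hm1 : m < 1) {t : ℝ} (ht : 0 ≤ t) : energyDensity m t ≤ 0 := by
  rw [energyDensity, if_neg hm1.ne]
  exact div_nonpos_of_nonneg_of_nonpos (Real.rpow_nonneg ht m) (by linarith)

theorem energyDensity_anti (hm : 0 < m) (hm1 : m < 1) {s t : ℝ} (hs : 0 ≤ s) (hst : s ≤ t) :
    energyDensity m t ≤ energyDensity m s := by
  rw [energyDensity, energyDensity, if_neg hm1.ne, if_neg hm1.ne]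
  exact div_le_div_of_nonpos_of_le (by linarith) (Real.rpow_le_rpow hs hst hm.le)

theorem entropy_of_lt_one (hm1 : m < 1) (ρ : Measure X) : entropy m K ρ =
    0 - ((∫⁻ x in K, ENNReal.ofReal (-energyDensity m (dens ρ x)) : ℝ≥0∞) : EReal) := by
  have h0 : ∀ x, ENNReal.ofReal (energyDensity m (dens ρ x)) = 0 := fun x =>
    ENNReal.ofReal_of_nonpos (energyDensity_nonpos hm1 (dens_nonneg ρ x))
  unfold dens at h0
  rw [entropy, if_neg (fun hc => absurd hc.1 (not_le.2 hm1)), extIntegral]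
  simp only [h0, lintegral_zero]
  rfl

/-- For `m < 1` the density `f_m` is nonincreasing and singular parts are not counted. -/
theorem entropy_le_of_dens_le (hm : 0 < m) (hm1 : m < 1) {ρ η : Measure X}
    (h : ∀ᵐ x ∂volume, dens ρ x ≤ dens η x) : entropy m K η ≤ entropy m K ρ := by
  rw [entropy_of_lt_one hm1, entropy_of_lt_one hm1]
  refine EReal.sub_le_sub le_rfl ?_
  rw [EReal.coe_ennreal_le_coe_ennreal_iff]
  refine lintegral_mono_ae ?_
  filter_upwards [ae_restrict_of_ae h] with x hx
  exact ENNReal.ofReal_le_ofReal (neg_le_neg (energyDensity_anti hm hm1 (dens_nonneg ρ x) hx))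

theorem dens_add (α β : Measure X) [IsFiniteMeasure α] [IsFiniteMeasure β] :
    ∀ᵐ x ∂volume, dens (α + β) x = dens α x + dens β x := by
  filter_upwards [Measure.rnDeriv_add α β volume, α.rnDeriv_lt_top volume,
    β.rnDeriv_lt_top volume] with x hx h1 h2
  rw [dens, hx, Pi.add_apply, ENNReal.toReal_add h1.ne h2.ne]
  rfl

theorem dens_smul_restrict (η : Measure X) [IsFiniteMeasure η] {c : ℝ≥0∞} (hc : c ≠ ∞) {s : Set X}
    (hs : MeasurableSet s) :
    ∀ᵐ x ∂volume, dens (c • η.restrict s) x = s.indicator (fun x => c.toReal * dens η x) x := by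
  filter_upwards [Measure.rnDeriv_smul_left_of_ne_top (η.restrict s) volume hc,
    Measure.rnDeriv_restrict η volume hs] with x hx h1
  rw [dens, hx, Pi.smul_apply, h1]
  by_cases h : x ∈ s <;> simp [h, dens]

/-- The correction term in the scaling of the energy density. -/
noncomputable def scalingTerm (m a : ℝ) : ℝ := if m = 1 then a * Real.log a else 0

theorem energyDensity_mul {a t : ℝ} (ha : 0 < a) (ht : 0 ≤ t) :
    energyDensity m (a * t) = a ^ m * energyDensity m t + scalingTerm m a * t := by
  unfold energyDensity scalingTerm
  split_ifs with h
  · subst h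
    rw [Real.rpow_one]
    rcases ht.eq_or_lt with rfl | ht
    · simp
    · rw [Real.log_mul ha.ne' ht.ne']; ring
  · rw [Real.mul_rpow ha.le ht]; ring

theorem continuousAt_scalingTerm (m : ℝ) : ContinuousAt (scalingTerm m) 1 := by
  unfold scalingTerm
  by_cases h : m = 1
  · simp only [h, if_true]
    exact continuousAt_id.mul (Real.continuousAt_log one_ne_zero)
  · simp only [h, if_false]
    exact continuousAt_const

theorem scalingTerm_one (m : ℝ) : scalingTerm m 1 = 0 := by simp [scalingTerm]

theorem tendsto_setIntegral_indicator {U : ℕ → Set X} (hU : Monotone U)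
    (hUm : ∀ n, MeasurableSet (U n)) {g : X → ℝ} (hg : IntegrableOn g K)
    (hg0 : ∀ᵐ x ∂volume, x ∉ ⋃ n, U n → g x = 0) :
    Tendsto (fun n => ∫ x in K, (U n).indicator g x) atTop (𝓝 (∫ x in K, g x)) := by
  refine tendsto_integral_of_dominated_convergence (fun x => ‖g x‖)
    (fun n => hg.aestronglyMeasurable.indicator (hUm n)) hg.norm
    (fun n => ae_of_all _ fun x => norm_indicator_le_norm_self _ _) ?_
  filter_upwards [ae_restrict_of_ae hg0] with x hx
  have h1 := hU.tendsto_indicator U g x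
  by_cases hxU : x ∈ ⋃ n, U n
  · rw [Set.indicator_of_mem hxU] at h1
    exact h1.mono_right (pure_le_nhds _)
  · rw [Set.indicator_of_notMem hxU] at h1
    rw [hx hxU]
    exact h1.mono_right (pure_le_nhds _)

/-- A measure on a union of open sets is approximated in energy by measures on these sets. -/
theorem exists_approx_of_iUnion (hm : 0 < m) (hK : MeasurableSet K) (H : IsWeight m K w h)
    {U : ℕ → Set X} (hU : Monotone U) (hUm : ∀ n, MeasurableSet (U n)) (hUK : ∀ n, U n ⊆ K)
    {η : Measure X} (hη : η ∈ P2 (⋃ n, U n)) (hfin : entropy m K η < ⊤) {ε : ℝ} (hε : 0 < ε) :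
    ∃ n, ∃ η' ∈ P2 (U n), entropy m K η' ≤ entropy m K η + ε ∧ W2 η' η ≤ ENNReal.ofReal ε := by
  have := hη.1
  have hηK : η ∈ P2 K := P2_mono (Set.iUnion_subset hUK) hη
  obtain ⟨hac, hint⟩ := H.integrable_energyDensity hK hηK.2.1 hηK.2.2 hfin
  have hUum : MeasurableSet (⋃ n, U n) := MeasurableSet.iUnion hUm
  have hU1 : η (⋃ n, U n) = 1 := (prob_compl_eq_zero_iff hUum).1 hη.2.1
  have hc : Tendsto (fun n => η (U n)) atTop (𝓝 1) := by
    rw [← hU1]; exact tendsto_measure_iUnion_atTop hU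
  have hcc : Tendsto (fun n => η (U n)ᶜ) atTop (𝓝 0) := by
    have h1 : Tendsto (fun n => 1 - η (U n)) atTop (𝓝 (1 - 1)) :=
      ENNReal.Tendsto.sub tendsto_const_nhds hc (Or.inl (by simp))
    rw [tsub_self] at h1
    exact h1.congr fun n => (prob_compl_eq_one_sub (hUm n)).symm
  have hci : Tendsto (fun n => (η (U n))⁻¹) atTop (𝓝 1) := by
    have := (continuous_inv.tendsto (1 : ℝ≥0∞)).comp hc
    simpa [Function.comp_def] using this
  have ha : Tendsto (fun n => ((η (U n))⁻¹).toReal) atTop (𝓝 1) := by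
    have := (ENNReal.tendsto_toReal ENNReal.one_ne_top).comp hci
    simpa [Function.comp_def] using this
  have hpos : ∀ᶠ n in atTop, 0 < η (U n) := hc.eventually_const_lt one_pos
  have hdens0 : ∀ᵐ x ∂volume, x ∉ ⋃ n, U n → dens η x = 0 := by
    have h1 := dens_eq_zero_of_compl hη.2.1
    rw [ae_restrict_iff' hUum.compl] at h1
    filter_upwards [h1] with x hx using hx
  -- The energy of the normalized restriction, expanded by `energyDensity_mul`; the normalizing
  -- factor tends to one, the integrals exhaust those over `K`.
  have hE : Tendsto (fun n => ((η (U n))⁻¹).toReal ^ m *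
      (∫ x in K, (U n).indicator (fun x => energyDensity m (dens η x)) x) +
      scalingTerm m ((η (U n))⁻¹).toReal * ∫ x in K, (U n).indicator (dens η) x) atTop
      (𝓝 (energy m K η)) := by
    have t1 := tendsto_setIntegral_indicator hU hUm hint (by
      filter_upwards [hdens0] with x hx hxU
      rw [hx hxU, energyDensity_zero hm])
    have t2 := tendsto_setIntegral_indicator (K := K) hU hUm (integrable_dens (ρ := η)) hdens0
    have t3 := ha.rpow_const (p := m) (Or.inr hm.le)
    have t4 := (continuousAt_scalingTerm m).tendsto.comp ha
    rw [Real.one_rpow] at t3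
    rw [scalingTerm_one] at t4
    have := (t3.mul t1).add (t4.mul t2)
    simpa [energy] using this
  have hmomc : Tendsto (fun n => moment (η.restrict (U n)ᶜ)) atTop (𝓝 0) :=
    tendsto_setLIntegral_zero hη.2.2.ne hcc
  have hW : Tendsto (fun n => 2 * (((η (U n))⁻¹ - 1) * moment η) +
      2 * moment (η.restrict (U n)ᶜ)) atTop (𝓝 0) := by
    have h1 : Tendsto (fun n => (η (U n))⁻¹ - 1) atTop (𝓝 (1 - 1)) :=
      ENNReal.Tendsto.sub hci tendsto_const_nhds (Or.inl (by simp))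
    rw [tsub_self] at h1
    have h2 := ENNReal.Tendsto.mul_const (b := moment η) h1 (Or.inr hη.2.2.ne)
    rw [zero_mul] at h2
    have h3 := (ENNReal.Tendsto.const_mul (a := 2) h2 (Or.inr (by norm_num))).add
      (ENNReal.Tendsto.const_mul (a := 2) hmomc (Or.inr (by norm_num)))
    simpa using h3
  have hε2 : 0 < ENNReal.ofReal ε ^ 2 :=
    pos_iff_ne_zero.2 (pow_ne_zero 2 (ENNReal.ofReal_pos.2 hε).ne')
  obtain ⟨n, hn0, hnE, hnW⟩ := (hpos.and ((hE.eventually_lt_const (lt_add_of_pos_right _ hε)).and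
    (hW.eventually_lt_const hε2))).exists
  have hle1 : η (U n) ≤ 1 := prob_le_one
  have hc_top : (η (U n))⁻¹ ≠ ∞ := ENNReal.inv_ne_top.2 hn0.ne'
  have hge1 : 1 ≤ (η (U n))⁻¹ := ENNReal.one_le_inv.2 hle1
  have ha0 : 0 < ((η (U n))⁻¹).toReal :=
    ENNReal.toReal_pos (ne_of_gt (lt_of_lt_of_le one_pos hge1)) hc_top
  set c := (η (U n))⁻¹ with hcdef
  have hmass : c * η (U n) = 1 := ENNReal.inv_mul_cancel hn0.ne' (measure_ne_top _ _)
  have hprob : IsProbabilityMeasure (c • η.restrict (U n)) := ⟨by simpa using hmass⟩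
  have hmomle : moment (η.restrict (U n)) ≤ moment η := lintegral_mono' Measure.restrict_le_self le_rfl
  have hη' : c • η.restrict (U n) ∈ P2 (U n) := by
    refine ⟨hprob, ?_, ?_⟩
    · simp [Measure.restrict_apply (hUm n).compl]
    · rw [lintegral_smul_measure]
      exact ENNReal.mul_lt_top hc_top.lt_top (hmomle.trans_lt hη.2.2)
  refine ⟨n, _, hη', ?_, ?_⟩
  · have hd : ∀ᵐ x ∂volume.restrict K, energyDensity m (dens (c • η.restrict (U n)) x) =
        c.toReal ^ m * (U n).indicator (fun x => energyDensity m (dens η x)) x +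
        scalingTerm m c.toReal * (U n).indicator (dens η) x := by
      filter_upwards [ae_restrict_of_ae (dens_smul_restrict η hc_top (hUm n))] with x hx
      rw [hx]
      by_cases hxU : x ∈ U n
      · simp only [Set.indicator_of_mem hxU]
        exact energyDensity_mul ha0 (dens_nonneg η x)
      · simp [Set.indicator_of_notMem hxU, energyDensity_zero hm]
    have i1 : IntegrableOn (fun x => c.toReal ^ m *
        (U n).indicator (fun x => energyDensity m (dens η x)) x) K :=
      (hint.indicator (hUm n)).const_mul _
    have i2 : IntegrableOn (fun x => scalingTerm m c.toReal * (U n).indicator (dens η) x) K :=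
      (integrable_dens.indicator (hUm n)).const_mul _
    have hint' : IntegrableOn (fun x => energyDensity m (dens (c • η.restrict (U n)) x)) K :=
      (i1.add i2).congr (hd.mono fun x hx => hx.symm)
    have hac' : 1 ≤ m → c • η.restrict (U n) ≪ volume := fun h1 =>
      (Measure.smul_absolutelyContinuous).trans
        ((Measure.restrict_le_self.absolutelyContinuous).trans (hac h1))
    rw [entropy_eq_integral hac' hint', H.entropy_eq_energy hK hηK hfin, ← EReal.coe_add,
      EReal.coe_le_coe_iff, integral_congr_ae hd, integral_add i1 i2, integral_const_mul,
      integral_const_mul]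
    exact hnE.le
  · refine W2_le_of_sq_le (le_trans ?_ hnW.le)
    -- The restriction is common to both measures; only the excess `c - 1` of it and the lost mass
    -- outside `U n` are transported.
    have e1 : η.restrict (U n) + (c - 1) • η.restrict (U n) = c • η.restrict (U n) := by
      nth_rewrite 1 [← one_smul ℝ≥0∞ (η.restrict (U n))]
      rw [← add_smul, add_tsub_cancel_of_le hge1]
    have e2 : η.restrict (U n) + η.restrict (U n)ᶜ = η := Measure.restrict_add_restrict_compl (hUm n)
    have hp1 : IsProbabilityMeasure (η.restrict (U n) + (c - 1) • η.restrict (U n)) := by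
      rw [e1]; exact hprob
    have hmass' : ((c - 1) • η.restrict (U n)) Set.univ = (η.restrict (U n)ᶜ) Set.univ := by
      rw [Measure.smul_apply, Measure.restrict_apply_univ, Measure.restrict_apply_univ, smul_eq_mul,
        prob_compl_eq_one_sub (hUm n), ENNReal.sub_mul (fun _ _ => measure_ne_top _ _), hmass,
        one_mul]
    have key := W2_sq_add_add_le (θ := η.restrict (U n)) hmass'
    rw [e1, e2] at key
    refine key.trans ?_
    gcongr
    rw [moment, lintegral_smul_measure, smul_eq_mul]
    gcongr
    exact hmomle

/-- Normalized volume on a bounded set has finite entropy. -/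
theorem exists_finite_entropy (hm : 0 < m) {B : Set X} (hB : MeasurableSet B)
    (hBb : Bornology.IsBounded B) (hB0 : volume B ≠ 0) :
    ∃ η ∈ P2 B, entropy m K η < ⊤ := by
  have hBtop : volume B ≠ ∞ := hBb.measure_lt_top.ne
  set c := (volume B)⁻¹ with hc
  have hctop : c ≠ ∞ := ENNReal.inv_ne_top.2 hB0
  have hfinB : IsFiniteMeasure (volume.restrict B) := ⟨by simpa using hBtop.lt_top⟩
  have hprob : IsProbabilityMeasure (c • (volume : Measure X).restrict B) :=
    ⟨by simpa using ENNReal.inv_mul_cancel hB0 hBtop⟩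
  refine ⟨c • (volume : Measure X).restrict B, ⟨hprob, ?_, ?_⟩, ?_⟩
  · simp [Measure.restrict_apply hB.compl]
  · obtain ⟨R, hR⟩ := hBb.exists_norm_le
    rw [lintegral_smul_measure]
    refine ENNReal.mul_lt_top hctop.lt_top ?_
    refine lt_of_le_of_lt (setLIntegral_mono_ae' hB (g := fun _ => ENNReal.ofReal R ^ 2)
      (ae_of_all _ fun x hx => ?_)) ?_
    · rw [← ofReal_norm]
      gcongr
      exact hR x hx
    · rw [setLIntegral_const]
      exact ENNReal.mul_lt_top (by simp) hBtop.lt_top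
  · have hd : ∀ᵐ x ∂volume, dens (c • (volume : Measure X).restrict B) x =
        B.indicator (fun _ => c.toReal) x := by
      filter_upwards [Measure.rnDeriv_smul_left_of_ne_top (volume.restrict B)
        (volume : Measure X) hctop, Measure.rnDeriv_restrict_self volume hB] with x h1 h2
      rw [dens, h1, Pi.smul_apply, h2]
      by_cases h : x ∈ B <;> simp [h]
    have hint : IntegrableOn (fun x => energyDensity m
        (dens (c • (volume : Measure X).restrict B) x)) K := by
      have h1 : Integrable (B.indicator fun _ => energyDensity m c.toReal) (volume : Measure X) :=
        (integrable_indicator_iff hB).2 (integrableOn_const hBtop)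
      refine h1.integrableOn.congr (ae_restrict_of_ae ?_)
      filter_upwards [hd] with x hx
      rw [hx]
      by_cases h : x ∈ B <;> simp [h, energyDensity_zero hm]
    rw [entropy_eq_integral (fun _ => Measure.smul_absolutelyContinuous.trans
      Measure.restrict_le_self.absolutelyContinuous) hint]
    exact EReal.coe_lt_top _

end Approximation

/-! ### Approximation of measures on the closure of a convex open set. -/

section Convex

variable {E : Type*} [NormedAddCommGroup E] [NormedSpace ℝ E] [FiniteDimensional ℝ E]
variable [ProperSpace E] [MeasureSpace E] [BorelSpace E] [(volume : Measure E).IsAddHaarMeasure]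
variable {m τ : ℝ} {U : Set E} {w h : E → ℝ}

theorem volume_closure_diff (hU : IsOpen U) (hUc : Convex ℝ U) :
    volume (closure U \ U) = 0 := by
  have := hUc.addHaar_frontier volume
  rwa [frontier, hU.interior_eq] at this

theorem measure_compl_eq_zero (hU : IsOpen U) (hUc : Convex ℝ U) {η : Measure E}
    (hη : η ≪ volume) (hK : η (closure U)ᶜ = 0) : η Uᶜ = 0 := by
  refine measure_mono_null (t := (closure U)ᶜ ∪ (closure U \ U)) (fun x hx => ?_)
    (measure_union_null hK (hη (volume_closure_diff hU hUc)))
  by_cases h : x ∈ closure U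
  · exact Or.inr ⟨h, hx⟩
  · exact Or.inl h

/-- The contraction by the factor `1 - s` towards `b`. -/
def contract (s : ℝ) (b x : E) : E := (1 - s) • x + s • b

theorem continuous_contract (s : ℝ) (b : E) : Continuous (contract s b) := by
  unfold contract; fun_prop

theorem enorm_contract_sub {s : ℝ} (b x : E) :
    edist (contract s b x) x = ‖s‖ₑ * ‖b - x‖ₑ := by
  rw [edist_eq_enorm_sub, ← enorm_smul]
  congr 1
  unfold contract
  module

theorem absolutelyContinuous_of_entropy_lt_top {K : Set E} (hm : 1 ≤ m) {η : Measure E}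
    (h : entropy m K η < ⊤) : η ≪ volume := by
  by_contra hc
  rw [entropy, if_pos ⟨hm, hc⟩] at h
  exact lt_irrefl _ h

/-- Measures on the closure of a convex open set are approximated in energy by measures on this
set. -/
theorem exists_approx_of_closure (hm : 0 < m) (hU : IsOpen U) (hUc : Convex ℝ U)
    (hUn : U.Nonempty) {η : Measure E} (hη : η ∈ P2 (closure U))
    (hfin : entropy m (closure U) η < ⊤) {ε : ℝ} (hε : 0 < ε) :
    ∃ η' ∈ P2 U, entropy m (closure U) η' ≤ entropy m (closure U) η ∧
      W2 η' η ≤ ENNReal.ofReal ε := by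
  have := hη.1
  obtain ⟨b, hb⟩ := hUn
  -- Only the singular part is contracted into `U`; the density part already lives there because the
  -- boundary is null.
  set α := volume.withDensity (η.rnDeriv volume) with hα
  set σ := η.singularPart volume with hσ
  have hsum : α + σ = η := by rw [add_comm]; exact Measure.singularPart_add_rnDeriv η volume
  have hαη : α ≤ η := Measure.withDensity_rnDeriv_le η volume
  have hση : σ ≤ η := Measure.singularPart_le η volume
  have hαfin : IsFiniteMeasure α := isFiniteMeasure_of_le η hαη
  have hσfin : IsFiniteMeasure σ := isFiniteMeasure_of_le η hση
  have hprob : IsProbabilityMeasure (α + σ) := by rwa [hsum]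
  set C := ∫⁻ x, ‖b - x‖ₑ ^ 2 ∂η with hC
  have hCtop : C ≠ ∞ := by
    have h1 : C ≤ ∫⁻ x, (2 * ‖b‖ₑ ^ 2 + 2 * ‖x‖ₑ ^ 2) ∂η := lintegral_mono fun x => by
      have := edist_sq_le b x
      rwa [edist_eq_enorm_sub] at this
    refine ne_top_of_le_ne_top ?_ h1
    rw [lintegral_add_left (by fun_prop), lintegral_const, lintegral_const_mul _ (by fun_prop)]
    exact ENNReal.add_ne_top.2 ⟨by finiteness, ENNReal.mul_ne_top (by norm_num) hη.2.2.ne⟩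
  obtain ⟨s, hs0, hs1, hsC⟩ : ∃ s : ℝ, 0 < s ∧ s ≤ 1 ∧ ‖s‖ₑ ^ 2 * C ≤ ENNReal.ofReal ε ^ 2 := by
    have hC0 : 0 ≤ C.toReal := ENNReal.toReal_nonneg
    -- Since `s ≤ 1`, `s² C ≤ s (C + 1) ≤ ε²`; the added `1` avoids division by zero.
    refine ⟨min 1 (ε ^ 2 / (C.toReal + 1)), by positivity, min_le_left _ _, ?_⟩
    set s := min 1 (ε ^ 2 / (C.toReal + 1)) with hs
    have hs0 : 0 < s := by positivity
    have hs1 : s ≤ 1 := min_le_left _ _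
    have hs2 : s * (C.toReal + 1) ≤ ε ^ 2 := (le_div_iff₀ (by positivity)).1 (min_le_right _ _)
    rw [Real.enorm_of_nonneg hs0.le, ← ENNReal.ofReal_toReal hCtop, ← ENNReal.ofReal_pow hs0.le,
      ← ENNReal.ofReal_pow hε.le, ← ENNReal.ofReal_mul (by positivity)]
    refine ENNReal.ofReal_le_ofReal ?_
    nlinarith
  set T := contract s b with hT
  have hTm : Measurable T := (continuous_contract s b).measurable
  have hW : W2 (α + σ.map T) η ^ 2 ≤ ENNReal.ofReal ε ^ 2 := by
    have h1 := W2_sq_add_map_le (α := α) (σ := σ) hTm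
    rw [hsum] at h1
    refine h1.trans (le_trans ?_ hsC)
    rw [hC, ← lintegral_const_mul _ (by fun_prop)]
    refine lintegral_mono' hση fun x => ?_
    rw [hT, enorm_contract_sub, mul_pow]
  have hprob' : IsProbabilityMeasure (α + σ.map T) := ⟨by
    rw [Measure.add_apply, Measure.map_apply hTm .univ, Set.preimage_univ, ← Measure.add_apply]
    exact measure_univ⟩
  have hσK : σ (closure U)ᶜ = 0 := le_antisymm ((hση _).trans hη.2.1.le) zero_le
  have hαK : α (closure U)ᶜ = 0 := le_antisymm ((hαη _).trans hη.2.1.le) zero_le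
  have hmem : α + σ.map T ∈ P2 U := by
    refine ⟨hprob', ?_, ?_⟩
    · rw [Measure.add_apply, measure_compl_eq_zero hU hUc (withDensity_absolutelyContinuous _ _) hαK,
        Measure.map_apply hTm hU.measurableSet.compl, zero_add]
      refine measure_mono_null (t := (closure U)ᶜ) (fun x hx hxK => hx ?_) hσK
      have := hUc.combo_closure_interior_mem_interior hxK (hU.interior_eq.symm ▸ hb)
        (sub_nonneg.2 hs1) hs0 (by ring)
      exact interior_subset this
    · refine (moment_le_of_W2 (ν := η)).trans_lt (ENNReal.add_lt_top.2 ⟨?_, ?_⟩)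
      · exact ENNReal.mul_lt_top (by norm_num) (hW.trans_lt (by finiteness))
      · exact ENNReal.mul_lt_top (by norm_num) hη.2.2
  -- For `m ≥ 1` there is no singular part and nothing has moved. For `m < 1` the density can only
  -- have grown, which does not raise the entropy.
  rcases le_or_gt 1 m with h1 | h1
  · have hac := absolutelyContinuous_of_entropy_lt_top h1 hfin
    have hσ0 : σ = 0 := Measure.singularPart_eq_zero_of_ac hac
    have hη' : α + σ.map T = η := by rw [hσ0, Measure.map_zero, ← hsum, hσ0]
    exact ⟨_, hmem, (congrArg _ hη').le, W2_le_of_sq_le hW⟩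
  · refine ⟨_, hmem, entropy_le_of_dens_le hm h1 ?_, W2_le_of_sq_le hW⟩
    filter_upwards [dens_add α (σ.map T),
      Measure.rnDeriv_withDensity volume (Measure.measurable_rnDeriv η volume)] with x h2 h3
    rw [h2]
    have : dens α x = dens η x := by rw [dens, h3, dens]
    rw [this]
    exact le_add_of_nonneg_right (dens_nonneg _ _)

theorem exists_approx_of_convex (hm : 0 < m) {Ω : ℕ → Set E} (hΩ : Monotone Ω)
    (hΩc : ∀ n, Convex ℝ (Ω n)) (hΩn : ∀ n, (interior (Ω n)).Nonempty)
    (H : IsWeight m (closure (⋃ n, interior (Ω n))) w h) {η : Measure E}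
    (hη : η ∈ P2 (closure (⋃ n, interior (Ω n))))
    (hfin : entropy m (closure (⋃ n, interior (Ω n))) η < ⊤) {ε : ℝ} (hε : 0 < ε) :
    ∃ n, ∃ η' ∈ P2 (Ω n), entropy m (closure (⋃ n, interior (Ω n))) η' ≤
      entropy m (closure (⋃ n, interior (Ω n))) η + ε ∧ W2 η' η ≤ ENNReal.ofReal ε := by
  have hmono : Monotone fun n => interior (Ω n) := fun i j hij => interior_mono (hΩ hij)
  have hU : IsOpen (⋃ n, interior (Ω n)) := isOpen_iUnion fun n => isOpen_interior
  have hUc : Convex ℝ (⋃ n, interior (Ω n)) :=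
    hmono.directed_le.convex_iUnion fun n => (hΩc n).interior
  obtain ⟨η₁, hη₁, hE₁, hW₁⟩ := exists_approx_of_closure hm hU hUc
    ((hΩn 0).mono (Set.subset_iUnion (fun n => interior (Ω n)) 0)) hη hfin (half_pos hε)
  obtain ⟨n, η₂, hη₂, hE₂, hW₂⟩ := exists_approx_of_iUnion hm isClosed_closure.measurableSet H hmono
    (fun n => isOpen_interior.measurableSet)
    (fun n => (Set.subset_iUnion (fun n => interior (Ω n)) n).trans subset_closure) hη₁
    (hE₁.trans_lt hfin) (half_pos hε)
  refine ⟨n, η₂, P2_mono interior_subset hη₂, hE₂.trans ?_, ?_⟩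
  · exact add_le_add hE₁ (EReal.coe_le_coe_iff.2 (half_le_self hε.le))
  · refine (W2_triangle _ η₁ _).trans ((add_le_add hW₂ hW₁).trans ?_)
    rw [← ENNReal.ofReal_add (half_pos hε).le (half_pos hε).le, add_halves]

end Convex

/-! ### Minimizers on the closure do not charge the boundary outside the domain. -/

section Boundary

variable {E : Type*} [NormedAddCommGroup E] [NormedSpace ℝ E] [FiniteDimensional ℝ E]
variable [ProperSpace E] [MeasureSpace E] [BorelSpace E] [(volume : Measure E).IsAddHaarMeasure]
variable {m τ : ℝ} {U K : Set E} {w h : E → ℝ}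

theorem exists_uniform (hU : IsOpen U) (hUn : U.Nonempty) :
    ∃ (β : Measure E) (R : ℝ), IsProbabilityMeasure β ∧ β ≪ volume ∧
      (∀ᵐ x ∂β, x ∈ U ∧ ‖x‖ ≤ R) := by
  obtain ⟨b, hb⟩ := hUn
  obtain ⟨r, hr, hrU⟩ := Metric.isOpen_iff.1 hU b hb
  have hB0 : volume (Metric.ball b r) ≠ 0 := (Metric.measure_ball_pos volume b hr).ne'
  have hBtop : volume (Metric.ball b r) ≠ ∞ := measure_ball_lt_top.ne
  obtain ⟨R, hR⟩ := (Metric.isBounded_ball (x := b) (r := r)).exists_norm_le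
  refine ⟨(volume (Metric.ball b r))⁻¹ • volume.restrict (Metric.ball b r), R, ⟨?_⟩, ?_, ?_⟩
  · simpa using ENNReal.inv_mul_cancel hB0 hBtop
  · exact Measure.smul_absolutelyContinuous.trans Measure.restrict_le_self.absolutelyContinuous
  · refine Measure.ae_smul_measure ?_ _
    filter_upwards [ae_restrict_mem measurableSet_ball] with x hx using ⟨hrU hx, hR x hx⟩

/-- The law of `(1 - s) y + s b` for independent `y` and `b`. -/
noncomputable def mix (s : ℝ) (κ β : Measure E) : Measure E :=
  (κ.prod β).map fun p => contract s p.2 p.1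

theorem measurable_mix (s : ℝ) : Measurable fun p : E × E => contract s p.2 p.1 := by
  unfold contract; fun_prop

/-- By Fubini: for each fixed `y` the law is the image of `β` under a nondegenerate affine map, and
such maps preserve null sets. -/
theorem mix_absolutelyContinuous {s : ℝ} (hs : s ≠ 0) {κ β : Measure E} [SFinite κ] [SFinite β]
    (hβ : β ≪ volume) : mix s κ β ≪ volume := by
  refine Measure.AbsolutelyContinuous.mk fun A hA hA0 => ?_
  rw [mix, Measure.map_apply (measurable_mix s) hA, Measure.prod_apply (measurable_mix s hA)]
  refine (lintegral_congr fun y => ?_).trans lintegral_zero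
  refine hβ ?_
  have h1 : Prod.mk y ⁻¹' ((fun p : E × E => contract s p.2 p.1) ⁻¹' A) =
      (fun b : E => s • b) ⁻¹' ((fun z : E => (1 - s) • y + z) ⁻¹' A) := rfl
  rw [h1, Measure.addHaar_preimage_smul volume hs, measure_preimage_add, hA0, mul_zero]

/-- If `m < 1`, adding an absolutely continuous part strictly decreases the energy. -/
theorem eq_zero_of_energy_le (hm : 0 < m) (hm1 : m < 1) {ρ ρ' ν : Measure E}
    [IsFiniteMeasure ν] (hd : ∀ᵐ x ∂volume, dens ρ' x = dens ρ x + dens ν x) (hν : ν ≪ volume)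
    (hνK : ν Kᶜ = 0)
    (hint : IntegrableOn (fun x => energyDensity m (dens ρ x)) K)
    (hint' : IntegrableOn (fun x => energyDensity m (dens ρ' x)) K)
    (hle : energy m K ρ ≤ energy m K ρ') : ν = 0 := by
  have h1 : ∀ᵐ x ∂volume.restrict K, energyDensity m (dens ρ' x) ≤ energyDensity m (dens ρ x) := by
    filter_upwards [ae_restrict_of_ae hd] with x hx
    rw [hx]
    exact energyDensity_anti hm hm1 (dens_nonneg ρ x) (le_add_of_nonneg_right (dens_nonneg ν x))
  have h2 : energy m K ρ' = energy m K ρ := le_antisymm (integral_mono_ae hint' hint h1) hle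
  have h3 := (integral_eq_iff_of_ae_le hint' hint h1).1 h2
  have h4 : ∀ᵐ x ∂volume.restrict K, ν.rnDeriv volume x = 0 := by
    filter_upwards [h3, ae_restrict_of_ae hd, ae_restrict_of_ae (ν.rnDeriv_lt_top volume)]
      with x hx hdx htop
    rw [hdx, energyDensity, energyDensity, if_neg hm1.ne, if_neg hm1.ne,
      div_left_inj' (by linarith)] at hx
    have h5 := (Real.rpow_left_inj (add_nonneg (dens_nonneg ρ x) (dens_nonneg ν x))
      (dens_nonneg ρ x) hm.ne').1 hx
    have h6 : dens ν x = 0 := by linarith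
    exact ((ENNReal.toReal_eq_zero_iff _).1 h6).resolve_right htop.ne
  have h7 : ν K = 0 := by
    have := Measure.setLIntegral_rnDeriv hν K
    rw [← this, lintegral_congr_ae h4, lintegral_zero]
  rw [← Measure.measure_univ_eq_zero, ← Set.union_compl_self K]
  exact measure_union_null h7 hνK

/-- The mass of this set is redistributed: a pair `(x, y)` becomes `((1 - s) y + s b, y)` with `b`
uniform in a ball of `U`. The cost does not increase for small `s`, no density is lost since the
boundary is null, and the added density would strictly lower the entropy. -/
theorem plan_eq_zero_of_boundary (hm : 0 < m) (hm1 : m < 1) (hτ : 0 < τ) (hU : IsOpen U)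
    (hUc : Convex ℝ U) (hUn : U.Nonempty) (H : IsWeight m (closure U) w h) {μ ρ : Measure E}
    (hμ : μ ∈ P2 (closure U)) (hmin : IsMinimizer m τ (closure U) μ ρ)
    (hfin : entropy m (closure U) ρ < ⊤) {γ : Measure (E × E)} (hγ : γ ∈ transportPlans ρ μ)
    (hcost : cost γ = W2 ρ μ ^ 2) {δ R : ℝ} (hδ : 0 < δ) (hR : 0 ≤ R) :
    γ {p | p.1 ∉ U ∧ δ ≤ dist p.1 p.2 ∧ ‖p.2‖ ≤ R} = 0 := by
  have hρprob := hmin.1.1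
  have hμprob := hμ.1
  have hγprob := hγ.1
  set D := {p : E × E | p.1 ∉ U ∧ δ ≤ dist p.1 p.2 ∧ ‖p.2‖ ≤ R} with hD
  have hDm : MeasurableSet D := by
    refine (measurable_fst hU.measurableSet.compl).inter (MeasurableSet.inter ?_ ?_)
    · exact measurableSet_le measurable_const (measurable_fst.dist measurable_snd)
    · exact measurableSet_le measurable_snd.norm measurable_const
  obtain ⟨β, R', hβ, hβac, hβU⟩ := exists_uniform hU hUn
  -- The new displacement is `s ‖b - y‖ ≤ s (|R'| + R) ≤ δ`, no longer than the old one; this is why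
  -- `y` is kept bounded and away from `x`.
  obtain ⟨s, hs0, hs1, hsδ⟩ : ∃ s : ℝ, 0 < s ∧ s ≤ 1 ∧ s * (|R'| + R) ≤ δ := by
    refine ⟨min 1 (δ / (|R'| + R + 1)), by positivity, min_le_left _ _, ?_⟩
    have h1 := (le_div_iff₀ (by positivity)).1 (min_le_right 1 (δ / (|R'| + R + 1)))
    have h2 : 0 < min 1 (δ / (|R'| + R + 1)) := by positivity
    nlinarith
  set κ := (γ.restrict D).map Prod.snd with hκ
  set ν := mix s κ β with hν
  have hνac : ν ≪ volume := mix_absolutelyContinuous hs0.ne' hβac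
  have hκμ : κ ≤ μ := by
    rw [← hγ.2.2]; exact Measure.map_mono Measure.restrict_le_self measurable_snd
  have hκU : κ Set.univ = γ D := by
    rw [hκ, Measure.map_apply measurable_snd .univ, Set.preimage_univ, Measure.restrict_apply_univ]
  have hνU : ν Set.univ = γ D := by
    rw [hν, mix, Measure.map_apply (measurable_mix s) .univ, Set.preimage_univ,
      Measure.prod_apply .univ]
    simp [hκU]
  have hνfin : IsFiniteMeasure ν := ⟨by rw [hνU]; exact measure_lt_top _ _⟩
  have hνK : ν (closure U)ᶜ = 0 := by
    rw [hν, mix, Measure.map_apply (measurable_mix s) isClosed_closure.measurableSet.compl]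
    have h1 : ∀ᵐ p ∂κ.prod β, p.1 ∈ closure U ∧ p.2 ∈ U := by
      have hy : ∀ᵐ y ∂κ, y ∈ closure U :=
        le_antisymm ((hκμ _).trans hμ.2.1.le) zero_le
      have hy1 := Measure.quasiMeasurePreserving_fst (μ := κ) (ν := β) |>.ae hy
      have hb1 := Measure.quasiMeasurePreserving_snd (μ := κ) (ν := β) |>.ae hβU
      filter_upwards [hy1, hb1] with p h1 h2 using ⟨h1, h2.1⟩
    refine measure_mono_null (t := {p | ¬ (p.1 ∈ closure U ∧ p.2 ∈ U)}) (fun p hp hc => hp ?_) h1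
    exact hUc.closure hc.1 (subset_closure hc.2) (sub_nonneg.2 hs1) hs0.le (by ring)
  set ρ₁ := (γ.restrict Dᶜ).map Prod.fst with hρ₁
  set ρ₂ := (γ.restrict D).map Prod.fst with hρ₂
  have hρsum : ρ = ρ₁ + ρ₂ := by
    rw [hρ₁, hρ₂, ← Measure.map_add _ _ measurable_fst, Measure.restrict_compl_add_restrict hDm,
      hγ.2.1]
  have hρ₂K : ρ₂ (closure U \ U)ᶜ = 0 := by
    refine measure_mono_null (t := (closure U)ᶜ ∪ U) (fun x hx => ?_) (measure_union_null ?_ ?_)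
    · by_contra hc
      simp only [Set.mem_union, Set.mem_compl_iff, not_or, not_not] at hc
      exact hx hc
    · refine le_antisymm (le_trans ?_ hmin.1.2.1.le) zero_le
      rw [hρsum]
      exact Measure.le_add_left le_rfl _
    · rw [hρ₂, Measure.map_apply measurable_fst hU.measurableSet,
        Measure.restrict_apply (measurable_fst hU.measurableSet)]
      convert measure_empty (μ := γ)
      ext p
      simp only [Set.mem_inter_iff, Set.mem_preimage, Set.mem_empty_iff_false, iff_false, not_and]
      exact fun h1 h2 => h2.1 h1
  have hd₂ : ∀ᵐ x ∂volume, dens ρ₂ x = 0 := by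
    have h1 := dens_eq_zero_of_compl hρ₂K
    rw [ae_restrict_iff' ((isClosed_closure.measurableSet.diff hU.measurableSet).compl)] at h1
    have h2 : ∀ᵐ x ∂volume, x ∈ (closure U \ U)ᶜ := by
      rw [ae_iff]
      exact measure_mono_null (fun x hx => not_not.1 hx) (volume_closure_diff hU hUc)
    filter_upwards [h1, h2] with x h1 h2 using h1 h2
  have hd : ∀ᵐ x ∂volume, dens (ρ₁ + ν) x = dens ρ x + dens ν x := by
    rw [hρsum]
    filter_upwards [dens_add ρ₁ ρ₂, dens_add ρ₁ ν, hd₂] with x h1 h2 h3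
    rw [h1, h2, h3, add_zero]
  have hf : Measurable fun q : (E × E) × E => (contract s q.2 q.1.2, q.1.2) := by
    unfold contract; fun_prop
  -- The second coordinate is kept, so the second marginal stays `μ`.
  set γ' := γ.restrict Dᶜ + ((γ.restrict D).prod β).map
    (fun q => (contract s q.2 q.1.2, q.1.2)) with hγ'
  have hγ'plan : γ' ∈ transportPlans (ρ₁ + ν) μ := by
    refine ⟨⟨?_⟩, ?_, ?_⟩
    · rw [hγ', Measure.add_apply, Measure.map_apply hf .univ, Set.preimage_univ,
        Measure.prod_apply .univ]
      simp only [Set.preimage_univ, measure_univ, lintegral_const, one_mul,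
        Measure.restrict_apply_univ]
      rw [add_comm, measure_add_measure_compl hDm, measure_univ]
    · rw [hγ', Measure.map_add _ _ measurable_fst, Measure.map_map measurable_fst hf, hν, mix, hκ]
      congr 1
      have h1 : ((γ.restrict D).map Prod.snd).prod β =
          ((γ.restrict D).prod β).map (Prod.map Prod.snd id) := by
        rw [← Measure.map_prod_map _ _ measurable_snd measurable_id, Measure.map_id]
      rw [h1, Measure.map_map (measurable_mix s) (by fun_prop)]
      rfl
    · rw [hγ', Measure.map_add _ _ measurable_snd, Measure.map_map measurable_snd hf]
      have h1 : (((γ.restrict D).prod β).map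
          (Prod.snd ∘ fun q : (E × E) × E => (contract s q.2 q.1.2, q.1.2))) =
          (γ.restrict D).map Prod.snd := by
        have h2 : (Prod.snd ∘ fun q : (E × E) × E => (contract s q.2 q.1.2, q.1.2)) =
            Prod.snd ∘ Prod.fst := rfl
        rw [h2, ← Measure.map_map measurable_snd measurable_fst, Measure.map_fst_prod,
          measure_univ, one_smul]
      rw [h1, ← Measure.map_add _ _ measurable_snd, Measure.restrict_compl_add_restrict hDm,
        hγ.2.2]
  have hcost' : cost γ' ≤ cost γ := by
    rw [cost, hγ', lintegral_add_measure, lintegral_map measurable_edist_sq hf, cost,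
      ← lintegral_add_compl (μ := γ) _ hDm, add_comm]
    gcongr
    have h1 : ∀ᵐ q ∂(γ.restrict D).prod β,
        edist (contract s q.2 q.1.2) q.1.2 ^ 2 ≤ edist q.1.1 q.1.2 ^ 2 := by
      have hy1 := Measure.quasiMeasurePreserving_fst (μ := γ.restrict D) (ν := β) |>.ae
        (ae_restrict_mem hDm)
      have hb1 := Measure.quasiMeasurePreserving_snd (μ := γ.restrict D) (ν := β) |>.ae hβU
      filter_upwards [hy1, hb1] with q h1 h2
      gcongr
      rw [edist_dist (q.1.1), enorm_contract_sub, Real.enorm_of_nonneg hs0.le, ← ofReal_norm,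
        ← ENNReal.ofReal_mul hs0.le]
      refine ENNReal.ofReal_le_ofReal (le_trans ?_ (hsδ.trans h1.2.1))
      gcongr
      exact (norm_sub_le _ _).trans (add_le_add (h2.2.trans (le_abs_self _)) h1.2.2)
    refine (lintegral_mono_ae h1).trans (le_of_eq ?_)
    have h2 : (γ.restrict D) = ((γ.restrict D).prod β).map Prod.fst := by
      rw [Measure.map_fst_prod, measure_univ, one_smul]
    conv_rhs => rw [h2]
    rw [lintegral_map measurable_edist_sq measurable_fst]
  have hW : W2 (ρ₁ + ν) μ ^ 2 ≤ W2 ρ μ ^ 2 := (W2_sq_le_cost hγ'plan).trans (hcost'.trans hcost.le)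
  have hWfin : W2 ρ μ ≠ ∞ := W2_ne_top hmin.1 hμ
  have hmem : ρ₁ + ν ∈ P2 (closure U) := by
    refine ⟨?_, ?_, ?_⟩
    · rw [← hγ'plan.2.1]
      have := hγ'plan.1
      exact Measure.isProbabilityMeasure_map (by fun_prop)
    · have h1 : ρ₁ (closure U)ᶜ ≤ ρ (closure U)ᶜ := by
        rw [hρsum]; exact Measure.le_add_right le_rfl _
      rw [Measure.add_apply, hνK, add_zero]
      exact le_antisymm (h1.trans hmin.1.2.1.le) zero_le
    · refine (moment_le_of_W2 (ν := μ)).trans_lt (ENNReal.add_lt_top.2 ⟨?_, ?_⟩)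
      · exact ENNReal.mul_lt_top (by norm_num) (hW.trans_lt (ENNReal.pow_lt_top hWfin.lt_top))
      · exact ENNReal.mul_lt_top (by norm_num) hμ.2.2
  have hprob' := hmem.1
  have hKm : MeasurableSet (closure U) := isClosed_closure.measurableSet
  have hfin' : entropy m (closure U) (ρ₁ + ν) < ⊤ := by
    refine (entropy_le_of_dens_le hm hm1 ?_).trans_lt hfin
    filter_upwards [hd] with x hx
    rw [hx]
    exact le_add_of_nonneg_right (dens_nonneg ν x)
  have hle := (hmin.le hm hτ hKm H hKm.nullMeasurableSet subset_rfl hμ hmem hfin').2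
  have hWr : (W2 (ρ₁ + ν) μ).toReal ^ 2 ≤ (W2 ρ μ).toReal ^ 2 := by
    rw [← ENNReal.toReal_pow, ← ENNReal.toReal_pow]
    exact ENNReal.toReal_mono (ENNReal.pow_ne_top hWfin) hW
  have hE : energy m (closure U) ρ ≤ energy m (closure U) (ρ₁ + ν) := by
    have : 1 / (2 * τ) * (W2 (ρ₁ + ν) μ).toReal ^ 2 ≤ 1 / (2 * τ) * (W2 ρ μ).toReal ^ 2 := by
      gcongr
    linarith
  have hν0 := eq_zero_of_energy_le hm hm1 hd hνac hνK
    (H.integrable_energyDensity hKm hmin.1.2.1 hmin.1.2.2 hfin).2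
    (H.integrable_energyDensity hKm hmem.2.1 hmem.2.2 hfin').2 hE
  rw [← hνU, hν0]
  simp

/-- A minimizer on a closed convex set does not charge the part of the boundary which `μ` does not
charge. -/
theorem IsMinimizer.measure_compl_eq_zero (hm : 0 < m) (hτ : 0 < τ) (hU : IsOpen U)
    (hUc : Convex ℝ U) (hUn : U.Nonempty) (H : IsWeight m (closure U) w h) {Ω : Set E}
    (hUΩ : U ⊆ Ω) (hΩK : Ω ⊆ closure U) {μ ρ : Measure E}
    (hμ : μ ∈ P2 Ω) (hmin : IsMinimizer m τ (closure U) μ ρ)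
    (hfin : entropy m (closure U) ρ < ⊤) {γ : Measure (E × E)} (hγ : γ ∈ transportPlans ρ μ)
    (hcost : cost γ = W2 ρ μ ^ 2) : ρ Ωᶜ = 0 := by
  rcases le_or_gt 1 m with h1 | h1
  · exact measure_mono_null (Set.compl_subset_compl.2 hUΩ) (JKO.measure_compl_eq_zero hU hUc
      (absolutelyContinuous_of_entropy_lt_top h1 hfin) hmin.1.2.1)
  have hbd : γ (⋃ n : ℕ, {p : E × E | p.1 ∉ U ∧ 1 / ((n : ℝ) + 1) ≤ dist p.1 p.2 ∧
      ‖p.2‖ ≤ n}) = 0 :=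
    measure_iUnion_null fun n => plan_eq_zero_of_boundary hm h1 hτ hU hUc hUn H
      (P2_mono hΩK hμ) hmin hfin hγ hcost (by positivity) (by positivity)
  -- `Ω` need not be measurable, so its complement is enlarged to a measurable `μ`-null set. On the
  -- diagonal the second coordinate falls into it; off the diagonal `hbd` applies.
  have hN : MeasurableSet (toMeasurable μ Ωᶜ) := measurableSet_toMeasurable _ _
  have hN0 : γ (Prod.snd ⁻¹' toMeasurable μ Ωᶜ) = 0 := by
    rw [← Measure.map_apply measurable_snd hN, hγ.2.2, measure_toMeasurable, hμ.2.1]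
  refine measure_mono_null (t := toMeasurable μ Ωᶜ ∩ Uᶜ)
    (fun x hx => ⟨subset_toMeasurable μ _ hx, fun h => hx (hUΩ h)⟩) ?_
  rw [← hγ.2.1, Measure.map_apply measurable_fst (hN.inter hU.measurableSet.compl)]
  refine measure_mono_null (fun p hp => ?_) (measure_union_null hbd hN0)
  by_cases hpe : p.1 = p.2
  · right
    rw [Set.mem_preimage, ← hpe]
    exact hp.1
  · left
    obtain ⟨n₁, hn₁⟩ := exists_nat_one_div_lt (dist_pos.2 hpe)
    obtain ⟨n₂, hn₂⟩ := exists_nat_ge ‖p.2‖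
    refine Set.mem_iUnion.2 ⟨max n₁ n₂, hp.2, ?_, hn₂.trans (by exact_mod_cast le_max_right _ _)⟩
    refine le_trans (Nat.one_div_le_one_div (le_max_left _ _)) hn₁.le

/-- Such a minimizer is also a minimizer on the convex set between an open set and its closure. -/
theorem IsMinimizer.of_closure (hm : 0 < m) (hτ : 0 < τ) (hU : IsOpen U)
    (hUc : Convex ℝ U) (hUn : U.Nonempty) (H : IsWeight m (closure U) w h) {Ω : Set E}
    (hΩ : Convex ℝ Ω) (hUΩ : U ⊆ Ω) (hΩK : Ω ⊆ closure U) {μ ρ : Measure E}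
    (hμ : μ ∈ P2 Ω) (hmin : IsMinimizer m τ (closure U) μ ρ)
    (hfin : entropy m (closure U) ρ < ⊤) {γ : Measure (E × E)} (hγ : γ ∈ transportPlans ρ μ)
    (hcost : cost γ = W2 ρ μ ^ 2) : IsMinimizer m τ Ω μ ρ := by
  have hρ : ρ ∈ P2 Ω := ⟨hmin.1.1,
    hmin.measure_compl_eq_zero hm hτ hU hUc hUn H hUΩ hΩK hμ hfin hγ hcost, hmin.1.2.2⟩
  have key : ∀ η ∈ P2 Ω, functional m τ Ω μ η = functional m τ (closure U) μ η := by
    intro η hη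
    have := hη.1
    rw [functional, functional, entropy_congr_set hm (hΩ.nullMeasurableSet volume)
      isClosed_closure.measurableSet.nullMeasurableSet hη.2.1 (P2_mono hΩK hη).2.1]
  refine ⟨hρ, fun η hη => ?_⟩
  rw [key ρ hρ, key η hη]
  exact hmin.2 η (P2_mono hΩK hη)

end Boundary

/-! ### The two settings: convex domains and compact groups such as the torus. -/

section Domains

variable {m τ : ℝ}

/-- The union of the interiors serves as `U`: each domain lies in the closure of its own interior,
so the union of the domains is squeezed between `U` and its closure. -/
theorem exists_limit_minimizer_of_convex {d : ℕ} (hd : 1 ≤ d) (hm : 0 < m) (hτ : 0 < τ)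
    {Ω : ℕ → Set (EuclideanSpace ℝ (Fin d))}
    {μs ρs : ℕ → Measure (EuclideanSpace ℝ (Fin d))} {μ : Measure (EuclideanSpace ℝ (Fin d))}
    (hΩ : Monotone Ω) (hΩd : ∀ n, IsConvexDomain (Ω n))
    (hunb : ¬ Bornology.IsBounded (⋃ n, Ω n) → 1 - 2 / ((d : ℝ) + 2) < m)
    (hμs : ∀ n, μs n ∈ P2 (Ω n)) (hμ : μ ∈ P2 (⋃ n, Ω n))
    (hW : Tendsto (fun n => W2 (μs n) μ) atTop (𝓝 0))
    (hmin : ∀ n, IsMinimizer m τ (Ω n) (μs n) (ρs n)) :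
    ∃ (φ : ℕ → ℕ) (ρ : Measure (EuclideanSpace ℝ (Fin d))),
      StrictMono φ ∧ IsMinimizer m τ (⋃ n, Ω n) μ ρ ∧
        Tendsto (fun k => W2 (ρs (φ k)) ρ) atTop (𝓝 0) := by
  set U := ⋃ n, interior (Ω n) with hUdef
  have hmono : Monotone fun n => interior (Ω n) := fun i j hij => interior_mono (hΩ hij)
  have hU : IsOpen U := isOpen_iUnion fun n => isOpen_interior
  have hUc : Convex ℝ U := hmono.directed_le.convex_iUnion fun n => (hΩd n).1.interior
  have hUn : U.Nonempty := (hΩd 0).2.mono (Set.subset_iUnion (fun n => interior (Ω n)) 0)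
  have hUΩ : U ⊆ ⋃ n, Ω n := Set.iUnion_mono fun n => interior_subset
  have hnK : ∀ n, Ω n ⊆ closure U := fun n => by
    refine subset_closure.trans ?_
    rw [← (hΩd n).1.closure_interior_eq_closure_of_nonempty_interior (hΩd n).2]
    exact closure_mono (Set.subset_iUnion (fun n => interior (Ω n)) n)
  have hΩK : ⋃ n, Ω n ⊆ closure U := Set.iUnion_subset hnK
  obtain ⟨w, h, H⟩ : ∃ w h, IsWeight m (closure U) w h := by
    by_cases hb : Bornology.IsBounded (⋃ n, Ω n)
    · exact exists_isWeight_of_volume_lt_top hm (hb.subset hUΩ).closure.measure_lt_top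
    · exact exists_isWeight_of_lt hd (hunb hb) _
  have hfin : ∃ η ∈ P2 (Ω 0), entropy m (closure U) η < ⊤ := by
    obtain ⟨b, hb⟩ := (hΩd 0).2
    obtain ⟨r, hr, hrU⟩ := Metric.isOpen_iff.1 isOpen_interior b hb
    obtain ⟨η, hη, hE⟩ := exists_finite_entropy (K := closure U) hm measurableSet_ball
      (Metric.isBounded_ball (x := b) (r := r)) (Metric.measure_ball_pos volume b hr).ne'
    exact ⟨η, P2_mono (hrU.trans interior_subset) hη, hE⟩
  obtain ⟨φ, ρ, γ, hφ, hρ, hρfin, hγ, hcost, hlim⟩ := exists_limit_minimizer hm hτ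
    isClosed_closure H hΩ hnK (fun n => (hΩd n).1.nullMeasurableSet volume)
    (fun η hη hE ε hε => exists_approx_of_convex hm hΩ (fun n => (hΩd n).1) (fun n => (hΩd n).2)
      H hη hE hε) hfin hμs (P2_mono hΩK hμ) hW hmin
  exact ⟨φ, ρ, hφ, hρ.of_closure hm hτ hU hUc hUn H
    (hΩ.directed_le.convex_iUnion fun n => (hΩd n).1) hUΩ hΩK hμ hρfin hγ hcost, hlim⟩

theorem W2_self {X : Type*} [NormedAddCommGroup X] [MeasurableSpace X] [BorelSpace X]
    [ProperSpace X] {η : Measure X} (hη : IsProbabilityMeasure η) : W2 η η = 0 := by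
  have hp : IsProbabilityMeasure (η + 0) := by rwa [add_zero]
  have h := W2_sq_add_map_le (α := η) (σ := 0) measurable_id
  simp only [Measure.map_zero, add_zero, lintegral_zero_measure] at h
  exact pow_eq_zero_iff two_ne_zero |>.1 (le_antisymm h zero_le)

/-- The domain is constant and closed, so constant weights suffice and the approximation hypothesis
holds with the competitor itself. -/
theorem exists_limit_minimizer_of_compact {X : Type*} [NormedAddCommGroup X] [MeasureSpace X]
    [BorelSpace X] [CompactSpace X] [IsFiniteMeasure (volume : Measure X)] [NeZero (volume : Measure X)]
    (hm : 0 < m) (hτ : 0 < τ) {μs ρs : ℕ → Measure X} {μ : Measure X}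
    (hμs : ∀ n, μs n ∈ P2 Set.univ) (hμ : μ ∈ P2 Set.univ)
    (hW : Tendsto (fun n => W2 (μs n) μ) atTop (𝓝 0))
    (hmin : ∀ n, IsMinimizer m τ Set.univ (μs n) (ρs n)) :
    ∃ (φ : ℕ → ℕ) (ρ : Measure X), StrictMono φ ∧ IsMinimizer m τ Set.univ μ ρ ∧
      Tendsto (fun k => W2 (ρs (φ k)) ρ) atTop (𝓝 0) := by
  obtain ⟨w, h, H⟩ := exists_isWeight_of_volume_lt_top hm (K := (Set.univ : Set X))
    (measure_lt_top volume _)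
  obtain ⟨φ, ρ, γ, hφ, hρ, -, -, -, hlim⟩ := exists_limit_minimizer hm hτ isClosed_univ H
    (Ω := fun _ => Set.univ) monotone_const (fun _ => subset_rfl) (fun _ => .univ)
    (fun η hη hE ε hε => ⟨0, η, hη, le_add_of_nonneg_right (EReal.coe_nonneg.2 hε.le),
      (W2_self hη.1).trans_le zero_le⟩)
    (exists_finite_entropy hm .univ isCompact_univ.isBounded (NeZero.ne _)) hμs hμ hW hmin
  exact ⟨φ, ρ, hφ, hρ, hlim⟩

instance (d : ℕ) : CompactSpace (Torus d) :=
  (PiLp.homeomorph 2 (fun _ : Fin d => UnitAddCircle)).symm.compactSpace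

instance (d : ℕ) : IsFiniteMeasure (volume : Measure (Torus d)) := Measure.isFiniteMeasure_map _ _

instance (d : ℕ) : NeZero (volume : Measure (Torus d)) := ⟨fun h => by
  have h1 : (volume : Measure (Torus d)) Set.univ = 0 := by rw [h]; rfl
  have h2 : (volume : Measure (Torus d)) Set.univ =
      (volume : Measure (Fin d → UnitAddCircle)) Set.univ := by
    refine (Measure.map_apply (WithLp.measurable_toLp 2 _) .univ).trans ?_
    rw [Set.preimage_univ]
  rw [h2, volume_pi, Measure.pi_univ] at h1
  simp at h1⟩

end Domains

end JKO

theorem mainTheorem8 (d : ℕ) (hd : 1 ≤ d) (m τ : ℝ) (hm0 : 0 < m)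
    (hm : 1 - 2 / (d : ℝ) < m) (hτ : 0 < τ) :
    (∀ (Ω : ℕ → Set (EuclideanSpace ℝ (Fin d)))
        (μs ρs : ℕ → Measure (EuclideanSpace ℝ (Fin d))) (μ : Measure (EuclideanSpace ℝ (Fin d))),
        Monotone Ω →
        (∀ n, JKO.IsConvexDomain (Ω n)) →
        (¬ Bornology.IsBounded (⋃ n, Ω n) → 1 - 2 / ((d : ℝ) + 2) < m) →
        (∀ n, μs n ∈ JKO.P2 (Ω n)) →
        μ ∈ JKO.P2 (⋃ n, Ω n) →
        Tendsto (fun n => JKO.W2 (μs n) μ) atTop (𝓝 0) →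
        (∀ n, JKO.IsMinimizer m τ (Ω n) (μs n) (ρs n)) →
        ∃ (φ : ℕ → ℕ) (ρ : Measure (EuclideanSpace ℝ (Fin d))),
          StrictMono φ ∧ JKO.IsMinimizer m τ (⋃ n, Ω n) μ ρ ∧
            Tendsto (fun k => JKO.W2 (ρs (φ k)) ρ) atTop (𝓝 0)) ∧
    (∀ (μs ρs : ℕ → Measure (JKO.Torus d)) (μ : Measure (JKO.Torus d)),
        (∀ n, μs n ∈ JKO.P2 Set.univ) →
        μ ∈ JKO.P2 Set.univ →
        Tendsto (fun n => JKO.W2 (μs n) μ) atTop (𝓝 0) →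
        (∀ n, JKO.IsMinimizer m τ Set.univ (μs n) (ρs n)) →
        ∃ (φ : ℕ → ℕ) (ρ : Measure (JKO.Torus d)),
          StrictMono φ ∧ JKO.IsMinimizer m τ Set.univ μ ρ ∧
            Tendsto (fun k => JKO.W2 (ρs (φ k)) ρ) atTop (𝓝 0)) := by
  exact ⟨fun Ω μs ρs μ hΩ hΩd hunb hμs hμ hW hmin =>
      JKO.exists_limit_minimizer_of_convex hd hm0 hτ hΩ hΩd hunb hμs hμ hW hmin,
    fun μs ρs μ hμs hμ hW hmin =>
      JKO.exists_limit_minimizer_of_compact hm0 hτ hμs hμ hW hmin⟩
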